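/- **Setting.** Let $K$ be a field (for instance $\mathbb C$) and let $M$ be a $k\times k$ block matrix over $K$ with $m_q\times n_q$ diagonal blocks $\Sigma_q$, $m_q,n_q\ge 1$, $q=0,\dots,k-1$. A *merging tree* is a full binary tree whose leaves, from left to right, are the blocks $0,\dots,k-1$; it is *balanced* if all its leaves lie on its two lowest levels (in particular if at each vertex the left subtree has as many leaves as the right one, or one more). A vertex $v$ stands for the set of the consecutive blocks below it. Its *neutered union* $N_v$ is the submatrix of $M$ formed by the columns of the blocks in $v$ and the rows of all the other blocks. For a balanced merging tree, $M$ is a *balanced $\rho$-HSS matrix* if $\operatorname{rank} N_v\le\rho$ for all vertices $v$. Such a matrix is given by the entries of its diagonal blocks and, for every vertex $v$, by a generating pair $N_v=F_vH_v$ of a length $r_v\le\rho$ (that is, $F_v$ has $r_v$ columns and $H_v$ has $r_v$ rows). An *algorithm* is an algebraic computation tree over $K$: it performs operations $+,-,\times,\div$ on input entries, constants of $K$ and earlier results, may branch on whether a computed value is zero, must never divide by zero, and is charged $1$ for every operation and every zero test. Fix $K$, the block sizes, a balanced merging tree, $\rho$ and the lengths $r_v$. Let $\alpha(M)$ denote the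 cost of computing $M\mathbf u$ from the given data of $M$ and a vector $\mathbf u$, and let $\beta(M)$ denote the cost of computing $M^{-1}\mathbf u$ from the same input. Here the cost is maximized over all vectors $\mathbf u$ and all balanced $\rho$-HSS matrices $M$ of this format with their data (all nonsingular ones for $\beta$), and minimized over all algorithms that are correct on all of these inputs. For the transpose, $\alpha(M^T)$ and $\beta(M^T)$ are the costs, in the same sense, of computing $M^T\mathbf u$ and $(M^T)^{-1}\mathbf u$ from the data of $M$ and $\mathbf u$. **Theorem.** Write $l=\lceil\log_2 k\rceil$, $m=\sum_q m_q$, $n=\sum_q n_q$, $n_+=\max_q n_q$, and $s=\sum_q m_qn_q$. (i) For balanced $\rho$-HSS matrices $M$ with $m_q\times n_q$ diagonal blocks, $$\alpha(M)<2s+(m+4(m+n)\rho)\,l.$$ (ii) If $m=n$, then for nonsingular balanced $\rho$-HSS matrices $M$ with $m_q\times n_q$ diagonal blocks, $$\beta(M)=O\bigl(n_+s+(n_+^2+\rho n_++l\rho^2)n+(k\rho+n)\rho^2\bigr).$$ (iii) For balanced $\rho$-HSS matrices $M$ with $n_q\times m_q$ diagonal blocks, the bound of (i) holds for $\alpha(M^T)$,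 and, if $m=n$ and $M$ is nonsingular, the bound of (ii) holds for $\beta(M^T)$. The constant in $O(\cdot)$ is absolute: it does not depend on $K$, $k$, the block sizes, the tree, $\rho$, the lengths $r_v$ or the matrices. -/

import Mathlib

open scoped Matrix

/-! ### Arithmetic algorithms and their cost -/

/-- A place from which an instruction reads a value: a constant of the field, an input entry,
or the value produced by the `j`-th arithmetic operation performed so far. -/
inductive Source (K ι : Type*) where
  | const (c : K)
  | input (i : ι)
  | temp (j : ℕ)

/-- The value read; `vals` lists the results of the operations performed so far, in order. -/
def Source.value {K ι : Type*} [Zero K] (x : ι → K) (vals : List K) : Source K ι → K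
  | .const c => c
  | .input i => x i
  | .temp j => vals.getD j 0

/-- The four arithmetic operations. -/
inductive ArithOp where
  | add
  | sub
  | mul
  | div

open Classical in
/-- The result of an operation; a division by zero has no result. -/
noncomputable def ArithOp.apply {K : Type*} [Field K] (a b : K) : ArithOp → Option K
  | .add => some (a + b)
  | .sub => some (a - b)
  | .mul => some (a * b)
  | .div => if b = 0 then none else some (a / b)

/-- Algorithms: algebraic computation trees over `K` with input entries indexed by `ι` and
output entries indexed by `ω`. A tree performs an arithmetic operation, or branches on whether
a value is zero, or halts and names its output entries. -/
inductive CompTree (K ι ω : Type*) where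
  | halt (out : ω → Source K ι)
  | compute (op : ArithOp) (a b : Source K ι) (next : CompTree K ι ω)
  | branch (a : Source K ι) (ifZero ifNonzero : CompTree K ι ω)

open Classical in
/-- The run on the input `x`: the output together with the cost, that is the number of
arithmetic operations and zero tests performed; `none` if a division by zero is attempted. -/
noncomputable def CompTree.run {K ι ω : Type*} [Field K] (x : ι → K) :
    CompTree K ι ω → List K → Option ((ω → K) × ℕ)
  | .halt out, vals => some (fun o => (out o).value x vals, 0)
  | .compute op a b next, vals =>
      (op.apply (a.value x vals) (b.value x vals)).bind fun v =>
        (next.run x (vals ++ [v])).map fun y => (y.1, y.2 + 1)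
  | .branch a p q, vals =>
      (if a.value x vals = 0 then p.run x vals else q.run x vals).map fun y => (y.1, y.2 + 1)

/-- The algorithm `P` solves the problem with instances `θ : Θ`, where `θ` is presented as
`input θ` and has to be answered by `answer θ`, at cost at most `c` on every instance. -/
def CompTree.SolvesWithin {K ι ω Θ : Type*} [Field K] (P : CompTree K ι ω)
    (input : Θ → ι → K) (answer : Θ → ω → K) (c : ℕ) : Prop :=
  ∀ θ, ∃ c' ≤ c, P.run (input θ) [] = some (answer θ, c')

/-- The arithmetic cost of a problem: the cost maximized over its instances and minimized over
all algorithms that solve it. -/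
noncomputable def arithCost {K ι ω Θ : Type*} [Field K]
    (input : Θ → ι → K) (answer : Θ → ω → K) : ℕ∞ :=
  ⨅ (P : CompTree K ι ω) (c : ℕ) (_ : P.SolvesWithin input answer c), (c : ℕ∞)

/-! ### Merging trees -/

/-- Binary trees that describe the recursive merging of the diagonal blocks; the leaves, from
left to right, are the blocks number `0, 1, 2, …`. -/
inductive MergeTree where
  | leaf
  | node (left right : MergeTree)

namespace MergeTree

/-- The number of leaves. -/
def numLeaves : MergeTree → ℕ
  | leaf => 1
  | node a b => a.numLeaves + b.numLeaves

/-- The largest depth of a leaf. -/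
def height : MergeTree → ℕ
  | leaf => 0
  | node a b => max a.height b.height + 1

/-- The smallest depth of a leaf. -/
def minDepth : MergeTree → ℕ
  | leaf => 0
  | node a b => min a.minDepth b.minDepth + 1

/-- All leaves lie on the two lowest levels. -/
def IsBalanced (t : MergeTree) : Prop := t.height ≤ t.minDepth + 1

/-- At every vertex the left subtree has as many leaves as the right one, or one more. -/
def IsWeightBalanced : MergeTree → Prop
  | leaf => True
  | node a b => b.numLeaves ≤ a.numLeaves ∧ a.numLeaves ≤ b.numLeaves + 1 ∧
      a.IsWeightBalanced ∧ b.IsWeightBalanced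

theorem numLeaves_pos (t : MergeTree) : 0 < t.numLeaves := by
  induction t with
  | leaf => exact Nat.one_pos
  | node a b ha hb => exact Nat.add_pos_left ha _

/-- `IsBalanced` covers the trees that are balanced at every vertex. -/
theorem IsWeightBalanced.isBalanced {t : MergeTree} (h : t.IsWeightBalanced) :
    t.IsBalanced := by
  have key : ∀ t : MergeTree, t.IsWeightBalanced →
      t.height = Nat.clog 2 t.numLeaves ∧ t.minDepth = Nat.log 2 t.numLeaves := by
    intro t
    induction t with
    | leaf => intro _; simp [height, minDepth, numLeaves]
    | node a b iha ihb =>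
      rintro ⟨h1, h2, ha, hb⟩
      obtain ⟨a1, a2⟩ := iha ha
      obtain ⟨b1, b2⟩ := ihb hb
      have pa := a.numLeaves_pos
      have pb := b.numLeaves_pos
      have e1 : (a.numLeaves + b.numLeaves + 2 - 1) / 2 = a.numLeaves := by omega
      have e2 : (a.numLeaves + b.numLeaves) / 2 = b.numLeaves := by omega
      constructor
      · rw [height, numLeaves, Nat.clog_of_two_le (by norm_num) (by omega), e1, a1, b1,
          max_eq_left (Nat.clog_mono_right 2 h1)]
      · rw [minDepth, numLeaves, Nat.log_of_one_lt_of_le (by norm_num) (by omega), e2, a2, b2,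
          min_eq_right (Nat.log_mono_right h1)]
  obtain ⟨h1, h2⟩ := key t h
  rw [IsBalanced, h1, h2]
  exact Nat.clog_le_of_le_pow (Nat.lt_pow_succ_log_self (by norm_num) _).le

/-- The vertices of the tree whose first leaf is block number `a`. A vertex is recorded as the
pair `(b, c)` for which it is the union of the blocks number `b, …, c - 1`. -/
def vertices : MergeTree → ℕ → Finset (ℕ × ℕ)
  | leaf, a => {(a, a + 1)}
  | node s t, a =>
      insert (a, a + (s.numLeaves + t.numLeaves))
        (s.vertices a ∪ t.vertices (a + s.numLeaves))

/-- The vertices of a merging tree of the blocks number `0, …, k - 1`. -/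
abbrev Vertex (t : MergeTree) : Type := {v : ℕ × ℕ // v ∈ t.vertices 0}

/-- Block number `q` is one of the blocks merged into the vertex `v`. -/
def Vertex.Contains {t : MergeTree} (v : t.Vertex) (q : ℕ) : Prop :=
  v.1.1 ≤ q ∧ q < v.1.2

end MergeTree

/-! ### Balanced HSS matrices -/

/-- Indices of rows (or columns) split into `k` consecutive groups of sizes `m 0, …, m (k-1)`. -/
abbrev BlockIdx {k : ℕ} (m : Fin k → ℕ) : Type := Σ q : Fin k, Fin (m q)

/-- Rows outside the diagonal block that belongs to the vertex `v`. -/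
abbrev OutsideIdx {k : ℕ} {t : MergeTree} (m : Fin k → ℕ) (v : t.Vertex) : Type :=
  {i : BlockIdx m // ¬ v.Contains i.1}

/-- Columns of the block column that belongs to the vertex `v`. -/
abbrev InsideIdx {k : ℕ} {t : MergeTree} (n : Fin k → ℕ) (v : t.Vertex) : Type :=
  {j : BlockIdx n // v.Contains j.1}

/-- The neutered union at `v`: the block column of `v` without the merged diagonal block. -/
def neutered {K : Type*} {k : ℕ} {t : MergeTree} {m n : Fin k → ℕ}
    (M : Matrix (BlockIdx m) (BlockIdx n) K) (v : t.Vertex) :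
    Matrix (OutsideIdx m v) (InsideIdx n v) K :=
  M.submatrix Subtype.val Subtype.val

open Classical in
/-- `M` is `ρ`-HSS along the merging tree `t`: all neutered unions have rank at most `ρ`.
For a balanced tree `t`, this says that `M` is a balanced `ρ`-HSS matrix. -/
def IsHSS {K : Type*} [Field K] {k : ℕ} {m n : Fin k → ℕ} (t : MergeTree) (ρ : ℕ)
    (M : Matrix (BlockIdx m) (BlockIdx n) K) : Prop :=
  ∀ v : t.Vertex, (neutered M v).rank ≤ ρ

/-- A `ρ`-HSS matrix together with the data by which it is given: its diagonal blocks and, for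
every neutered union `N_v`, a generating pair `N_v = F_v H_v` of length `r v`. -/
structure HSSMatrix (K : Type*) [Field K] {k : ℕ} (t : MergeTree) (ρ : ℕ) (m n : Fin k → ℕ)
    (r : t.Vertex → ℕ) where
  M : Matrix (BlockIdx m) (BlockIdx n) K
  isHSS : IsHSS t ρ M
  diag : ∀ q, Matrix (Fin (m q)) (Fin (n q)) K
  F : ∀ v : t.Vertex, Matrix (OutsideIdx m v) (Fin (r v)) K
  H : ∀ v : t.Vertex, Matrix (Fin (r v)) (InsideIdx n v) K
  diag_eq : ∀ q i j, M ⟨q, i⟩ ⟨q, j⟩ = diag q i j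
  neutered_eq : ∀ v, neutered M v = F v * H v

/-- Names of the input entries: the entries of the diagonal blocks, of the generators, and of
the given vector, which is indexed by `σ`. -/
inductive InputIdx {k : ℕ} (t : MergeTree) (m n : Fin k → ℕ) (r : t.Vertex → ℕ) (σ : Type) where
  | diag (q : Fin k) (i : Fin (m q)) (j : Fin (n q))
  | genF (v : t.Vertex) (i : OutsideIdx m v) (h : Fin (r v))
  | genH (v : t.Vertex) (h : Fin (r v)) (j : InsideIdx n v)
  | vec (i : σ)

/-- The input of an algorithm: the data of the matrix, not its entries, and the vector `u`. -/
def HSSMatrix.input {K : Type*} [Field K] {k : ℕ} {t : MergeTree} {ρ : ℕ} {m n : Fin k → ℕ}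
    {r : t.Vertex → ℕ} {σ : Type} (A : HSSMatrix K t ρ m n r) (u : σ → K) :
    InputIdx t m n r σ → K
  | .diag q i j => A.diag q i j
  | .genF v i h => A.F v i h
  | .genH v h j => A.H v h j
  | .vec i => u i

open Classical in
/-- An HSS matrix that is nonsingular, with its inverse. The data stay those of the matrix. -/
structure NonsingularHSSMatrix (K : Type*) [Field K] {k : ℕ} (t : MergeTree) (ρ : ℕ)
    (m n : Fin k → ℕ) (r : t.Vertex → ℕ) extends HSSMatrix K t ρ m n r where
  Minv : Matrix (BlockIdx n) (BlockIdx m) K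
  mul_inv : M * Minv = 1
  inv_mul : Minv * M = 1

section Cost

variable (K : Type*) [Field K] {k : ℕ} (t : MergeTree) (ρ : ℕ) (m n : Fin k → ℕ)
  (r : t.Vertex → ℕ)

/-- The cost `α` of computing `M u` from the data of `M` and from `u`: one algorithm has to
serve all `ρ`-HSS matrices `M` of the given format and all vectors `u`. -/
noncomputable def alphaCost : ℕ∞ :=
  arithCost (fun θ : HSSMatrix K t ρ m n r × (BlockIdx n → K) => θ.1.input θ.2)
    (fun θ => θ.1.M *ᵥ θ.2)

/-- The cost `α` of computing `Mᵀ u` from the data of `M` and from `u`. -/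
noncomputable def alphaTransposeCost : ℕ∞ :=
  arithCost (fun θ : HSSMatrix K t ρ m n r × (BlockIdx m → K) => θ.1.input θ.2)
    (fun θ => θ.1.Mᵀ *ᵥ θ.2)

/-- The cost `β` of computing `M⁻¹ u` from the data of `M` and from `u`: one algorithm has to
serve all nonsingular `ρ`-HSS matrices `M` of the given format and all vectors `u`. -/
noncomputable def betaCost : ℕ∞ :=
  arithCost (fun θ : NonsingularHSSMatrix K t ρ m n r × (BlockIdx m → K) =>
      θ.1.toHSSMatrix.input θ.2)
    (fun θ => θ.1.Minv *ᵥ θ.2)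

/-- The cost `β` of computing `(Mᵀ)⁻¹ u` from the data of `M` and from `u`. -/
noncomputable def betaTransposeCost : ℕ∞ :=
  arithCost (fun θ : NonsingularHSSMatrix K t ρ m n r × (BlockIdx n → K) =>
      θ.1.toHSSMatrix.input θ.2)
    (fun θ => θ.1.Minvᵀ *ᵥ θ.2)

end Cost

/-- The bound `2s + (m + 4(m+n)ρ)l` for matrices with `m q × n q` diagonal blocks. -/
def alphaBound {k : ℕ} (ρ : ℕ) (m n : Fin k → ℕ) : ℕ :=
  2 * (∑ q, m q * n q) + (∑ q, m q + 4 * (∑ q, m q + ∑ q, n q) * ρ) * Nat.clog 2 k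

/-- The expression `n₊ s + (n₊² + ρ n₊ + l ρ²) n + (k ρ + n) ρ²` for matrices with
`m q × n q` diagonal blocks. -/
def betaBound {k : ℕ} (ρ : ℕ) (m n : Fin k → ℕ) : ℕ :=
  (Finset.univ.sup n) * (∑ q, m q * n q) +
    ((Finset.univ.sup n) ^ 2 + ρ * (Finset.univ.sup n) + Nat.clog 2 k * ρ ^ 2) * (∑ q, n q) +
    (k * ρ + ∑ q, n q) * ρ ^ 2

/-! ### Straight-line reasoning about computation trees -/

/-! Algorithms are handled through `Reach`: a state holds the instances still possible and the
functions of the instance computed so far. A zero test shrinks the set of instances, so pivot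
positions are constant on each branch. `Reach.exists_run` turns such chains into computation trees.

Products with M. The two off-diagonal blocks at an inner vertex are parts of the neutered unions of
its children, so they factor with length at most ρ. Adding their products with vectors costs 2ρ per
row and column on every level (`Given.fastMul`, `mulVecCost_le`).

Inverse. Every vertex carries a matrix B with ρ rows that spans the row space of its neutered union
N; the rest of the matrix sees x only through Bx. Since M is nonsingular, the diagonal block stacked
on B is injective. Elimination gives equations W(g, y) = 0 for the pairs g = Mx, y = Bx, and an
operator L that recovers x (`IsElim`). At an inner vertex the unknowns are only the 2ρ entries of
B₁x₁ and B₂x₂ (`IsElim.merge`); `Reach.compress` makes the bases nested. At the root N has no rows,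
B = 0, and L contains M⁻¹. Above the leaves L is applied through its factors, so Lᵀ is as cheap as
L, which gives the inverse of the transpose.

Cost. At a vertex E = (rows) − (columns) + ρ ≥ 0 equations remain, and E₁ + E₂ = E + ρ for the
children. The work at a vertex with N columns is O(ρ(E + ρ)(N + E + ρ)), up to lower terms. E may
grow by ρ with every level, so a worst-case bound on E is too weak. The sum of E³ is O(kρ³), because
(E + ρ)³ ≤ (3/2)E³ + 32ρ³ grows more slowly than the number of vertices (`cubeSum_le`). For the sum
of ρEN, let μ move by ±(E₁ − E₂) from a vertex to its children, a fair martingale. The quantity 2E −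
μ changes by ρ − E at each step, so the sum of E along a path is controlled by μ at its leaf
(`crossSum_le`). The bound ρxμ ≤ Lρ²x + x³ + μ⁴/(L²ρ) and a fourth-moment estimate with L = l + 1
finish the proof. -/

/-- A state of knowledge about an instance `θ`: the set of instances that are still possible, and
the functions of the instance that have been computed. -/
structure KState (Θ K : Type*) where
  S : Set Θ
  A : Set (Θ → K)

namespace KState

variable {Θ K : Type*}

/-- The value `f θ` is available in the given state. -/
def Known (st : KState Θ K) (f : Θ → K) : Prop :=
  ∃ g, (g ∈ st.A ∨ ∃ c, g = fun _ => c) ∧ ∀ θ ∈ st.S, g θ = f θ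

/-- Ordered so that knowledge persists: a test shrinks `S`, an operation enlarges `A`, and both
preserve `Known`. -/
instance : LE (KState Θ K) := ⟨fun st st' => st'.S ⊆ st.S ∧ st.A ⊆ st'.A⟩

theorem leRefl (st : KState Θ K) : st ≤ st := ⟨subset_rfl, subset_rfl⟩

theorem leTrans {a b c : KState Θ K} (h : a ≤ b) (h' : b ≤ c) : a ≤ c :=
  ⟨h'.1.trans h.1, h.2.trans h'.2⟩

theorem Known.mono {st st' : KState Θ K} {f : Θ → K} (h : st.Known f) (hs : st ≤ st') :
    st'.Known f := by
  obtain ⟨g, hg, hgf⟩ := h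
  exact ⟨g, hg.imp_left fun h => hs.2 h, fun θ hθ => hgf θ (hs.1 hθ)⟩

theorem Known.congr {st : KState Θ K} {f f' : Θ → K} (h : st.Known f)
    (hf : ∀ θ ∈ st.S, f θ = f' θ) : st.Known f' := by
  obtain ⟨g, hg, hgf⟩ := h
  exact ⟨g, hg, fun θ hθ => (hgf θ hθ).trans (hf θ hθ)⟩

theorem known_const (st : KState Θ K) (c : K) : st.Known fun _ => c :=
  ⟨_, Or.inr ⟨c, rfl⟩, fun _ _ => rfl⟩

/-- All entries of the matrix are available. -/
def KnownMat {ι κ : Type*} (st : KState Θ K) (M : Θ → Matrix ι κ K) : Prop :=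
  ∀ i j, st.Known fun θ => M θ i j

/-- All entries of the vector are available. -/
def KnownVec {ι : Type*} (st : KState Θ K) (x : Θ → ι → K) : Prop :=
  ∀ i, st.Known fun θ => x θ i

theorem KnownMat.mono {ι κ : Type*} {st st' : KState Θ K} {M : Θ → Matrix ι κ K}
    (h : st.KnownMat M) (hs : st ≤ st') : st'.KnownMat M := fun i j => (h i j).mono hs

theorem KnownVec.mono {ι : Type*} {st st' : KState Θ K} {x : Θ → ι → K}
    (h : st.KnownVec x) (hs : st ≤ st') : st'.KnownVec x := fun i => (h i).mono hs

theorem KnownVec.congr {ι : Type*} {st : KState Θ K} {x x' : Θ → ι → K}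
    (h : st.KnownVec x) (hx : ∀ θ ∈ st.S, x θ = x' θ) : st.KnownVec x' :=
  fun i => (h i).congr fun θ hθ => by rw [hx θ hθ]

theorem KnownMat.submatrix {ι κ ι' κ' : Type*} {st : KState Θ K} {M : Θ → Matrix ι κ K}
    (h : st.KnownMat M) (f : ι' → ι) (g : κ' → κ) :
    st.KnownMat fun θ => (M θ).submatrix f g := fun i j => h (f i) (g j)

theorem KnownMat.transpose {ι κ : Type*} {st : KState Θ K} {M : Θ → Matrix ι κ K}
    (h : st.KnownMat M) : st.KnownMat fun θ => (M θ)ᵀ := fun i j => h j i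

theorem KnownMat.fromBlocks {ι κ ι' κ' : Type*} {st : KState Θ K} {A : Θ → Matrix ι κ K}
    {B : Θ → Matrix ι κ' K} {C : Θ → Matrix ι' κ K} {D : Θ → Matrix ι' κ' K}
    (hA : st.KnownMat A) (hB : st.KnownMat B) (hC : st.KnownMat C) (hD : st.KnownMat D) :
    st.KnownMat fun θ => Matrix.fromBlocks (A θ) (B θ) (C θ) (D θ) := by
  rintro (i | i) (j | j)
  exacts [hA i j, hB i j, hC i j, hD i j]

theorem KnownMat.fromRows {ι κ ι' : Type*} {st : KState Θ K} {A : Θ → Matrix ι κ K}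
    {B : Θ → Matrix ι' κ K} (hA : st.KnownMat A) (hB : st.KnownMat B) :
    st.KnownMat fun θ => Matrix.fromRows (A θ) (B θ) := by
  rintro (i | i) j
  exacts [hA i j, hB i j]

theorem KnownMat.fromCols {ι κ κ' : Type*} {st : KState Θ K} {A : Θ → Matrix ι κ K}
    {B : Θ → Matrix ι κ' K} (hA : st.KnownMat A) (hB : st.KnownMat B) :
    st.KnownMat fun θ => Matrix.fromCols (A θ) (B θ) := by
  rintro i (j | j)
  exacts [hA i j, hB i j]

theorem KnownVec.comp {ι κ : Type*} {st : KState Θ K} {x : Θ → ι → K} (h : st.KnownVec x)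
    (f : κ → ι) : st.KnownVec fun θ => x θ ∘ f := fun i => h (f i)

theorem KnownVec.sumElim {ι κ : Type*} {st : KState Θ K} {x : Θ → ι → K} {y : Θ → κ → K}
    (h : st.KnownVec x) (h' : st.KnownVec y) : st.KnownVec fun θ => Sum.elim (x θ) (y θ) := by
  rintro (i | i)
  exacts [h i, h' i]

end KState

/-! ### Chains of operations and zero tests, with their cost -/

open KState

/-- From the given state, one can reach states that satisfy `Q` by at most `c` arithmetic
operations and zero tests. -/
inductive Reach {Θ K : Type*} [Field K] (Q : KState Θ K → Prop) : ℕ → KState Θ K → Prop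
  | done {c : ℕ} {st : KState Θ K} : Q st → Reach Q c st
  | op {c : ℕ} {st : KState Θ K} (o : ArithOp) (f g h : Θ → K) :
      st.Known f → st.Known g → (∀ θ ∈ st.S, o.apply (f θ) (g θ) = some (h θ)) →
      Reach Q c ⟨st.S, insert h st.A⟩ → Reach Q (c + 1) st
  | test {c : ℕ} {st : KState Θ K} (f : Θ → K) : st.Known f →
      Reach Q c ⟨st.S ∩ {θ | f θ = 0}, st.A⟩ → Reach Q c ⟨st.S ∩ {θ | f θ ≠ 0}, st.A⟩ →
      Reach Q (c + 1) st

namespace Reach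

variable {Θ K : Type*} [Field K] {Q Q' : KState Θ K → Prop} {c c' : ℕ} {st : KState Θ K}

theorem mono_cost (h : Reach Q c st) (hc : c ≤ c') : Reach Q c' st := by
  induction h generalizing c' with
  | done h => exact .done h
  | op o f g h hf hg hh _ ih =>
    obtain ⟨d, rfl⟩ : ∃ d, c' = d + 1 := ⟨c' - 1, by omega⟩
    exact .op o f g h hf hg hh (ih (by omega))
  | test f hf _ _ ih₁ ih₂ =>
    obtain ⟨d, rfl⟩ : ∃ d, c' = d + 1 := ⟨c' - 1, by omega⟩
    exact .test f hf (ih₁ (by omega)) (ih₂ (by omega))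

theorem bind (h : Reach Q c st) (h' : ∀ st', st ≤ st' → Q st' → Reach Q' c' st') :
    Reach Q' (c + c') st := by
  induction h with
  | done h => exact (h' _ (leRefl _) h).mono_cost (by omega)
  | @op c st o f g h hf hg hh _ ih =>
    rw [Nat.add_right_comm]
    have hle : st ≤ ⟨st.S, insert h st.A⟩ := ⟨subset_rfl, Set.subset_insert _ _⟩
    exact .op o f g h hf hg hh (ih fun st' hs => h' st' (leTrans hle hs))
  | @test c st f hf _ _ ih₁ ih₂ =>
    rw [Nat.add_right_comm]
    have h₁ : st ≤ ⟨st.S ∩ {θ | f θ = 0}, st.A⟩ := ⟨Set.inter_subset_left, subset_rfl⟩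
    have h₂ : st ≤ ⟨st.S ∩ {θ | f θ ≠ 0}, st.A⟩ := ⟨Set.inter_subset_left, subset_rfl⟩
    exact .test f hf (ih₁ fun st' hs => h' st' (leTrans h₁ hs))
      (ih₂ fun st' hs => h' st' (leTrans h₂ hs))

theorem imp (h : Reach Q c st) (h' : ∀ st', st ≤ st' → Q st' → Q' st') : Reach Q' c st :=
  (h.bind (c' := 0) fun st' hs hq => .done (h' st' hs hq))

/-- `Reach.bind` with the total cost given beforehand. -/
theorem bind_le {d : ℕ} (h : Reach Q c st) (hd : c + c' ≤ d)
    (h' : ∀ st', st ≤ st' → Q st' → Reach Q' c' st') : Reach Q' d st :=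
  (h.bind h').mono_cost hd

theorem arith (o : ArithOp) {f g h : Θ → K} (hf : st.Known f) (hg : st.Known g)
    (hh : ∀ θ ∈ st.S, o.apply (f θ) (g θ) = some (h θ)) :
    Reach (fun st' => st'.Known h) 1 st :=
  .op o f g h hf hg hh (.done ⟨h, Or.inl (Set.mem_insert _ _), fun _ _ => rfl⟩)

theorem add {f g : Θ → K} (hf : st.Known f) (hg : st.Known g) :
    Reach (fun st' => st'.Known fun θ => f θ + g θ) 1 st :=
  arith .add hf hg fun _ _ => rfl

theorem sub {f g : Θ → K} (hf : st.Known f) (hg : st.Known g) :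
    Reach (fun st' => st'.Known fun θ => f θ - g θ) 1 st :=
  arith .sub hf hg fun _ _ => rfl

theorem mul {f g : Θ → K} (hf : st.Known f) (hg : st.Known g) :
    Reach (fun st' => st'.Known fun θ => f θ * g θ) 1 st :=
  arith .mul hf hg fun _ _ => rfl

theorem div {f g : Θ → K} (hf : st.Known f) (hg : st.Known g) (h0 : ∀ θ ∈ st.S, g θ ≠ 0) :
    Reach (fun st' => st'.Known fun θ => f θ / g θ) 1 st :=
  arith .div hf hg fun θ hθ => by simp [ArithOp.apply, h0 θ hθ]

/-- Compute the members of a finite family one after the other. -/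
theorem finset {ι : Type*} (s : Finset ι) (f : ι → Θ → K) (c : ℕ)
    (h : ∀ i ∈ s, ∀ st', st ≤ st' → Reach (fun st'' => st''.Known (f i)) c st') :
    Reach (fun st' => ∀ i ∈ s, st'.Known (f i)) (s.card * c) st := by
  classical
  induction s using Finset.induction_on generalizing st with
  | empty => exact .done (by simp)
  | insert a s ha ih =>
    rw [Finset.card_insert_of_notMem ha, Nat.succ_mul, Nat.add_comm]
    refine (h a (Finset.mem_insert_self _ _) st (leRefl _)).bind fun st' hs hk => ?_
    refine (ih fun i hi st'' hs' =>
      h i (Finset.mem_insert_of_mem hi) st'' (leTrans hs hs')).imp fun st'' hs' hk' => ?_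
    intro i hi
    rcases Finset.mem_insert.1 hi with rfl | hi
    · exact hk.mono hs'
    · exact hk' i hi

theorem family {ι : Type*} [Fintype ι] (f : ι → Θ → K) (c : ℕ)
    (h : ∀ i, ∀ st', st ≤ st' → Reach (fun st'' => st''.Known (f i)) c st') :
    Reach (fun st' => ∀ i, st'.Known (f i)) (Fintype.card ι * c) st :=
  (finset Finset.univ f c fun i _ => h i).imp fun _ _ hk i => hk i (Finset.mem_univ _)

theorem vec {ι : Type*} [Fintype ι] {x : Θ → ι → K} (c : ℕ)
    (h : ∀ i, ∀ st', st ≤ st' → Reach (fun st'' => st''.Known fun θ => x θ i) c st') :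
    Reach (fun st' => st'.KnownVec x) (Fintype.card ι * c) st :=
  family (fun i θ => x θ i) c h

theorem mat {ι κ : Type*} [Fintype ι] [Fintype κ] {M : Θ → Matrix ι κ K} (c : ℕ)
    (h : ∀ i j, ∀ st', st ≤ st' → Reach (fun st'' => st''.Known fun θ => M θ i j) c st') :
    Reach (fun st' => st'.KnownMat M) (Fintype.card ι * Fintype.card κ * c) st := by
  rw [← Fintype.card_prod]
  exact (family (fun (p : ι × κ) θ => M θ p.1 p.2) c fun p => h p.1 p.2).imp
    fun _ _ hk i j => hk (i, j)

/-- Accumulate a dot product onto a value. -/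
theorem add_sum {ι : Type*} (s : Finset ι) {f : Θ → K} {a b : ι → Θ → K}
    (hf : st.Known f) (ha : ∀ i ∈ s, st.Known (a i)) (hb : ∀ i ∈ s, st.Known (b i)) :
    Reach (fun st' => st'.Known fun θ => f θ + ∑ i ∈ s, a i θ * b i θ) (2 * s.card) st := by
  classical
  induction s using Finset.induction_on generalizing st with
  | empty => exact .done (by simpa using hf)
  | insert i s hi ih =>
    rw [Finset.card_insert_of_notMem hi]
    refine bind_le (c' := 2) (ih hf (fun j hj => ha j (Finset.mem_insert_of_mem hj))
      (fun j hj => hb j (Finset.mem_insert_of_mem hj))) (by omega) fun st₁ h₁ k₁ => ?_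
    refine bind_le (c' := 1) (mul ((ha i (Finset.mem_insert_self _ _)).mono h₁)
      ((hb i (Finset.mem_insert_self _ _)).mono h₁)) (by omega) fun st₂ h₂ k₂ => ?_
    refine (add (k₁.mono h₂) k₂).imp fun st₃ _ k₃ => ?_
    convert k₃ using 2 with θ
    rw [Finset.sum_insert hi]
    ring

/-- Subtract a dot product from a value. -/
theorem sub_sum {ι : Type*} (s : Finset ι) {f : Θ → K} {a b : ι → Θ → K}
    (hf : st.Known f) (ha : ∀ i ∈ s, st.Known (a i)) (hb : ∀ i ∈ s, st.Known (b i)) :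
    Reach (fun st' => st'.Known fun θ => f θ - ∑ i ∈ s, a i θ * b i θ) (2 * s.card) st := by
  classical
  induction s using Finset.induction_on generalizing st with
  | empty => exact .done (by simpa using hf)
  | insert i s hi ih =>
    rw [Finset.card_insert_of_notMem hi]
    refine bind_le (c' := 2) (ih hf (fun j hj => ha j (Finset.mem_insert_of_mem hj))
      (fun j hj => hb j (Finset.mem_insert_of_mem hj))) (by omega) fun st₁ h₁ k₁ => ?_
    refine bind_le (c' := 1) (mul ((ha i (Finset.mem_insert_self _ _)).mono h₁)
      ((hb i (Finset.mem_insert_self _ _)).mono h₁)) (by omega) fun st₂ h₂ k₂ => ?_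
    refine (sub (k₁.mono h₂) k₂).imp fun st₃ _ k₃ => ?_
    convert k₃ using 2 with θ
    rw [Finset.sum_insert hi]
    ring

/-- The first product starts the sum, which saves one addition. This saving makes the bound in (i)
strict. -/
theorem sum {ι : Type*} [Fintype ι] {a b : ι → Θ → K}
    (ha : ∀ i, st.Known (a i)) (hb : ∀ i, st.Known (b i)) :
    Reach (fun st' => st'.Known fun θ => ∑ i, a i θ * b i θ) (2 * Fintype.card ι - 1) st := by
  classical
  rcases isEmpty_or_nonempty ι with h | ⟨⟨i⟩⟩
  · exact .done (by simpa using known_const st (0 : K))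
  · have hc : (Finset.univ.erase i).card + 1 = Fintype.card ι := by
      rw [Finset.card_erase_add_one (Finset.mem_univ i), Finset.card_univ]
    refine bind_le (mul (ha i) (hb i)) (c' := 2 * (Finset.univ.erase i).card) (by omega)
      fun st₁ h₁ k₁ => ?_
    refine (add_sum (Finset.univ.erase i) k₁ (fun j _ => (ha j).mono h₁)
      (fun j _ => (hb j).mono h₁)).imp fun st₂ _ k₂ => ?_
    convert k₂ using 2 with θ
    rw [Finset.add_sum_erase Finset.univ (fun j => a j θ * b j θ) (Finset.mem_univ i)]

section Matrices

variable {ι κ τ : Type*} [Fintype ι] [Fintype κ] [Fintype τ]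

theorem mulVec {M : Θ → Matrix ι κ K} {x : Θ → κ → K} (hM : st.KnownMat M) (hx : st.KnownVec x) :
    Reach (fun st' => st'.KnownVec fun θ => M θ *ᵥ x θ)
      (Fintype.card ι * (2 * Fintype.card κ - 1)) st :=
  vec _ fun i _ hs => sum (a := fun j θ => M θ i j) (b := fun j θ => x θ j)
    (fun j => (hM i j).mono hs) (fun j => (hx j).mono hs)

theorem add_mulVec {y : Θ → ι → K} {M : Θ → Matrix ι κ K} {x : Θ → κ → K} (hy : st.KnownVec y)
    (hM : st.KnownMat M) (hx : st.KnownVec x) :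
    Reach (fun st' => st'.KnownVec fun θ => y θ + M θ *ᵥ x θ)
      (Fintype.card ι * (2 * Fintype.card κ)) st :=
  vec _ fun i _ hs => add_sum Finset.univ (a := fun j θ => M θ i j) (b := fun j θ => x θ j)
    ((hy i).mono hs) (fun j _ => (hM i j).mono hs) (fun j _ => (hx j).mono hs)

theorem sub_mulVec {y : Θ → ι → K} {M : Θ → Matrix ι κ K} {x : Θ → κ → K} (hy : st.KnownVec y)
    (hM : st.KnownMat M) (hx : st.KnownVec x) :
    Reach (fun st' => st'.KnownVec fun θ => y θ - M θ *ᵥ x θ)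
      (Fintype.card ι * (2 * Fintype.card κ)) st :=
  vec _ fun i _ hs => sub_sum Finset.univ (a := fun j θ => M θ i j) (b := fun j θ => x θ j)
    ((hy i).mono hs) (fun j _ => (hM i j).mono hs) (fun j _ => (hx j).mono hs)

theorem matMul {M : Θ → Matrix ι κ K} {N : Θ → Matrix κ τ K} (hM : st.KnownMat M)
    (hN : st.KnownMat N) :
    Reach (fun st' => st'.KnownMat fun θ => M θ * N θ)
      (Fintype.card ι * Fintype.card τ * (2 * Fintype.card κ)) st :=
  mat _ fun i k _ hs => (sum (a := fun j θ => M θ i j) (b := fun j θ => N θ j k)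
    (fun j => (hM i j).mono hs) (fun j => (hN j k).mono hs)).mono_cost (by omega)

theorem neg_matMul {M : Θ → Matrix ι κ K} {N : Θ → Matrix κ τ K} (hM : st.KnownMat M)
    (hN : st.KnownMat N) :
    Reach (fun st' => st'.KnownMat fun θ => -(M θ * N θ))
      (Fintype.card ι * Fintype.card τ * (2 * Fintype.card κ)) st :=
  mat _ fun i k _ hs => (sub_sum Finset.univ (known_const _ 0)
    (a := fun j θ => M θ i j) (b := fun j θ => N θ j k)
    (fun j _ => (hM i j).mono hs) (fun j _ => (hN j k).mono hs)).imp fun _ _ h => by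
      simpa [Matrix.mul_apply] using h

/-- Look for a member of a finite family that does not vanish. -/
theorem search (f : ι → Θ → K) (hf : ∀ i, st.Known (f i)) :
    Reach (fun st' => (∃ i, ∀ θ ∈ st'.S, f i θ ≠ 0) ∨ ∀ i, ∀ θ ∈ st'.S, f i θ = 0)
      (Fintype.card ι) st := by
  classical
  suffices h : ∀ (s : Finset ι) (st : KState Θ K), (∀ i, st.Known (f i)) →
      Reach (fun st' => (∃ i, ∀ θ ∈ st'.S, f i θ ≠ 0) ∨ ∀ i ∈ s, ∀ θ ∈ st'.S, f i θ = 0)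
        s.card st from
    (h Finset.univ st hf).imp fun _ _ h => h.imp_right fun h i => h i (Finset.mem_univ _)
  intro s
  induction s using Finset.induction_on with
  | empty => exact fun st _ => .done (Or.inr (by simp))
  | insert a s ha ih =>
    intro st hf
    rw [Finset.card_insert_of_notMem ha]
    -- In the nonzero branch the index `a` serves all remaining instances, so a pivot found this way
    -- does not depend on `θ`.
    refine .test (f a) (hf a) ?_ (.done (Or.inl ⟨a, fun θ hθ => hθ.2⟩))
    have hle : st ≤ ⟨st.S ∩ {θ | f a θ = 0}, st.A⟩ := ⟨Set.inter_subset_left, subset_rfl⟩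
    refine (ih _ fun i => (hf i).mono hle).imp fun st' hs h => h.imp_right fun h i hi θ hθ => ?_
    rcases Finset.mem_insert.1 hi with rfl | hi
    · exact (hs.1 hθ).2
    · exact h i hi θ hθ

end Matrices

/-- A chain of operations and tests is an algebraic computation tree. -/
theorem exists_run {ι ω : Type*} {input : Θ → ι → K} {answer : Θ → ω → K}
    (h : Reach (fun st' => ∀ o, st'.Known fun θ => answer θ o) c st)
    (vals : Θ → List K) (len : ℕ) (hlen : ∀ θ ∈ st.S, (vals θ).length = len)
    (hA : ∀ f ∈ st.A, ∃ s : Source K ι, ∀ θ ∈ st.S, ∀ l : List K,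
      s.value (input θ) (vals θ ++ l) = f θ) :
    ∃ P : CompTree K ι ω, ∀ θ ∈ st.S, ∃ c' ≤ c,
      P.run (input θ) (vals θ) = some (answer θ, c') := by
  -- The arbitrary tail `l` keeps a source valid when later results are appended.
  have src : ∀ {st : KState Θ K} {vals : Θ → List K} {f : Θ → K},
      (∀ f ∈ st.A, ∃ s : Source K ι, ∀ θ ∈ st.S, ∀ l : List K,
        s.value (input θ) (vals θ ++ l) = f θ) → st.Known f →
      ∃ s : Source K ι, ∀ θ ∈ st.S, ∀ l : List K, s.value (input θ) (vals θ ++ l) = f θ := by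
    rintro st vals f hA ⟨g, hg | ⟨c, rfl⟩, hgf⟩
    · obtain ⟨s, hs⟩ := hA g hg
      exact ⟨s, fun θ hθ l => (hs θ hθ l).trans (hgf θ hθ)⟩
    · exact ⟨.const c, fun θ hθ l => hgf θ hθ⟩
  induction h generalizing vals len with
  | done h =>
    choose s hs using fun o => src hA (h o)
    refine ⟨.halt s, fun θ hθ => ⟨0, Nat.zero_le _, ?_⟩⟩
    simp only [CompTree.run, Option.some.injEq, Prod.mk.injEq, and_true]
    funext o
    simpa using hs o θ hθ []
  | @op c st o f g h hf hg hh _ ih =>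
    obtain ⟨a, ha⟩ := src hA hf
    obtain ⟨b, hb⟩ := src hA hg
    obtain ⟨P, hP⟩ := ih (fun θ => vals θ ++ [h θ]) (len + 1)
      (fun θ hθ => by simp [hlen θ hθ]) (by
        intro e he
        rcases he with rfl | he
        -- All instances on a branch have performed equally many operations, so the new result has
        -- the same position for all of them.
        · refine ⟨.temp len, fun θ hθ l => ?_⟩
          have := hlen θ hθ
          subst this
          simp [Source.value]
        · obtain ⟨s, hs⟩ := hA e he
          exact ⟨s, fun θ hθ l => by rw [List.append_assoc]; exact hs θ hθ _⟩)
    refine ⟨.compute o a b P, fun θ hθ => ?_⟩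
    obtain ⟨c', hc', hr⟩ := hP θ hθ
    have ha' := ha θ hθ []
    have hb' := hb θ hθ []
    rw [List.append_nil] at ha' hb'
    exact ⟨c' + 1, by omega, by simp [CompTree.run, ha', hb', hh θ hθ, hr]⟩
  | @test c st f hf _ _ ih₁ ih₂ =>
    obtain ⟨a, ha⟩ := src hA hf
    obtain ⟨P, hP⟩ := ih₁ vals len (fun θ hθ => hlen θ hθ.1) fun e he => by
      obtain ⟨s, hs⟩ := hA e he
      exact ⟨s, fun θ hθ => hs θ hθ.1⟩
    obtain ⟨P', hP'⟩ := ih₂ vals len (fun θ hθ => hlen θ hθ.1) fun e he => by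
      obtain ⟨s, hs⟩ := hA e he
      exact ⟨s, fun θ hθ => hs θ hθ.1⟩
    refine ⟨.branch a P P', fun θ hθ => ?_⟩
    have ha' := ha θ hθ []
    rw [List.append_nil] at ha'
    by_cases h0 : f θ = 0
    · obtain ⟨c', hc', hr⟩ := hP θ ⟨hθ, h0⟩
      exact ⟨c' + 1, by omega, by simp [CompTree.run, ha', h0, hr]⟩
    · obtain ⟨c', hc', hr⟩ := hP' θ ⟨hθ, h0⟩
      exact ⟨c' + 1, by omega, by simp [CompTree.run, ha', h0, hr]⟩

theorem arithCost_le {ι ω : Type*} {input : Θ → ι → K} {answer : Θ → ω → K}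
    (h : Reach (fun st' => ∀ o, st'.Known fun θ => answer θ o) c
      ⟨Set.univ, Set.range fun i θ => input θ i⟩) :
    arithCost input answer ≤ (c : ℕ∞) := by
  obtain ⟨P, hP⟩ := h.exists_run (input := input) (fun _ => []) 0 (fun _ _ => rfl) (by
    rintro _ ⟨i, rfl⟩
    exact ⟨.input i, fun _ _ _ => rfl⟩)
  exact iInf₂_le_of_le P c (iInf_le _ fun θ => hP θ trivial)

end Reach

/-! ### Rank reduction and a single pivot step -/

section LinearAlgebra

variable {K : Type*} [Field K] {ι κ τ : Type*} [Fintype κ] [Fintype τ]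

/-- Wedderburn's rank reduction: subtracting a cross through a nonzero entry lowers the rank. -/
theorem Matrix.rank_sub_cross_lt (F : Matrix ι κ K) {s : ι} {t : κ} (h : F s t ≠ 0) :
    (Matrix.of fun i j => F i j - F i t / F s t * F s j).rank < F.rank := by
  classical
  set G : Matrix ι κ K := Matrix.of fun i j => F i j - F i t / F s t * F s j with hG
  have hGx : ∀ x, G *ᵥ x = F *ᵥ x - (F *ᵥ x) s • fun i => F i t / F s t := by
    intro x
    ext i
    simp only [hG, Matrix.mulVec, dotProduct, Matrix.of_apply, Pi.sub_apply, Pi.smul_apply,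
      smul_eq_mul, sub_mul, Finset.sum_sub_distrib, mul_assoc, ← Finset.mul_sum]
    ring
  -- The kernel grows strictly: column `t` of `G` vanishes, while that of `F` does not.
  have hlt : LinearMap.ker F.mulVecLin < LinearMap.ker G.mulVecLin := by
    refine lt_of_le_of_ne (fun x hx => ?_) fun heq => ?_
    · rw [LinearMap.mem_ker, Matrix.mulVecLin_apply] at hx ⊢
      rw [hGx, hx]
      simp
    · have hmem : Pi.single t 1 ∈ LinearMap.ker G.mulVecLin := by
        rw [LinearMap.mem_ker, Matrix.mulVecLin_apply]
        ext i
        simp [hG, h]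
      rw [← heq, LinearMap.mem_ker, Matrix.mulVecLin_apply] at hmem
      exact h (by simpa using congrFun hmem s)
  have h₁ := LinearMap.finrank_range_add_finrank_ker F.mulVecLin
  have h₂ := LinearMap.finrank_range_add_finrank_ker G.mulVecLin
  have h₃ := Submodule.finrank_lt_finrank_of_lt hlt
  unfold Matrix.rank
  omega

/-- One step of Gaussian elimination with the pivot in row `s` of the first column. -/
theorem Matrix.eliminate_step {p q : ℕ} (A : Matrix (Fin (p + 1)) (Fin (q + 1)) K)
    (U : Matrix (Fin (p + 1)) τ K) (s : Fin (p + 1)) (h : A s 0 ≠ 0) (z : Fin (q + 1) → K)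
    (t : τ → K) :
    A *ᵥ z + U *ᵥ t = 0 ↔
      z 0 + ((fun j : Fin q => A s j.succ / A s 0) ⬝ᵥ fun j => z j.succ) +
        (fun j => U s j / A s 0) ⬝ᵥ t = 0 ∧
      (Matrix.of fun (i : Fin p) (j : Fin q) => A (s.succAbove i) j.succ -
          A (s.succAbove i) 0 * (A s j.succ / A s 0)) *ᵥ (fun j => z j.succ) +
        (Matrix.of fun (i : Fin p) j => U (s.succAbove i) j -
          A (s.succAbove i) 0 * (U s j / A s 0)) *ᵥ t = 0 := by
  set α := (fun j : Fin q => A s j.succ / A s 0) ⬝ᵥ fun j => z j.succ with hα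
  set β := (fun j => U s j / A s 0) ⬝ᵥ t with hβ
  have hs : (A *ᵥ z + U *ᵥ t) s = A s 0 * (z 0 + α + β) := by
    simp only [hα, hβ, Pi.add_apply, Matrix.mulVec, dotProduct, Fin.sum_univ_succ, mul_add,
      Finset.mul_sum]
    congr 1
    · congr 1
      exact Finset.sum_congr rfl fun j _ => by field_simp
    · exact Finset.sum_congr rfl fun j _ => by field_simp
  have hi : ∀ i, ((Matrix.of fun (i : Fin p) (j : Fin q) => A (s.succAbove i) j.succ -
          A (s.succAbove i) 0 * (A s j.succ / A s 0)) *ᵥ (fun j => z j.succ) +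
        (Matrix.of fun (i : Fin p) j => U (s.succAbove i) j -
          A (s.succAbove i) 0 * (U s j / A s 0)) *ᵥ t) i =
      (A *ᵥ z + U *ᵥ t) (s.succAbove i) - A (s.succAbove i) 0 * (z 0 + α + β) := by
    intro i
    simp only [hα, hβ, Pi.add_apply, Matrix.mulVec, dotProduct, Fin.sum_univ_succ, mul_add,
      Matrix.of_apply, sub_mul, Finset.sum_sub_distrib, Finset.mul_sum, mul_assoc]
    ring
  constructor
  · intro h0
    have h1 : z 0 + α + β = 0 := by
      rw [h0, Pi.zero_apply, eq_comm, mul_eq_zero] at hs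
      exact hs.resolve_left h
    refine ⟨h1, ?_⟩
    ext i
    rw [hi, h0, h1]
    simp
  · rintro ⟨h1, h2⟩
    ext i
    rcases eq_or_ne i s with rfl | his
    · rw [hs, h1]
      simp
    · obtain ⟨i, rfl⟩ := Fin.exists_succAbove_eq his
      have := hi i
      rw [h2, h1, mul_zero, sub_zero] at this
      exact this.symm

theorem Matrix.card_le_card_of_injective [Fintype ι] {A : Matrix ι κ K}
    (h : ∀ z, A *ᵥ z = 0 → z = 0) :
    Fintype.card κ ≤ Fintype.card ι := by
  have := LinearMap.finrank_le_finrank_of_injective (f := A.mulVecLin)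
    ((injective_iff_map_eq_zero _).2 fun z hz => h z hz)
  simpa using this

end LinearAlgebra

/-! ### Rank factorization and Gaussian elimination as algorithms -/

namespace Reach

variable {Θ K : Type*} [Field K]

/-- Compute a factorization through `R` dimensions of a matrix of rank at most `R`, with the rows
of the second factor in the row space. -/
theorem rankFactor {ι κ : Type*} [Fintype ι] [Fintype κ] (R : ℕ) {st : KState Θ K}
    {F : Θ → Matrix ι κ K} (hF : st.KnownMat F) (hR : ∀ θ ∈ st.S, (F θ).rank ≤ R) :
    Reach (fun st' => ∃ (Y : Θ → Matrix ι (Fin R) K) (B : Θ → Matrix (Fin R) κ K),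
      st'.KnownMat Y ∧ st'.KnownMat B ∧
        ∀ θ ∈ st'.S, F θ = Y θ * B θ ∧ ∃ Z : Matrix (Fin R) ι K, B θ = Z * F θ)
      (R * (4 * (Fintype.card ι * Fintype.card κ))) st := by
  classical
  induction R generalizing st F with
  | zero =>
    refine .done ⟨fun _ => 0, fun _ => 0, fun _ _ => known_const _ _, fun _ _ => known_const _ _,
      fun θ hθ => ⟨?_, 0, by simp⟩⟩
    rw [Matrix.zero_mul]
    have h0 : (F θ).mulVecLin = 0 :=
      LinearMap.range_eq_bot.1 (Submodule.finrank_eq_zero.1 (Nat.le_zero.1 (hR θ hθ)))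
    ext i j
    have := congrFun (LinearMap.congr_fun h0 (Pi.single j 1)) i
    simpa using this
  | succ R ih =>
    set a := Fintype.card ι * Fintype.card κ with ha
    -- One round takes at most `a` tests for a pivot, `a` divisions for its column and `2 * a`
    -- operations to subtract the cross.
    refine bind_le (c' := R * (4 * a) + 3 * a)
      (search (fun (e : ι × κ) θ => F θ e.1 e.2) fun e => hF e.1 e.2) ?_ ?_
    · rw [Fintype.card_prod, ← ha]; nlinarith
    rintro st₁ hs₁ (⟨⟨s, t⟩, hst⟩ | h0)
    · have hκ : 0 < Fintype.card κ := Fintype.card_pos_iff.2 ⟨t⟩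
      have hcard : Fintype.card ι ≤ a := Nat.le_mul_of_pos_right _ hκ
      refine bind_le (c' := R * (4 * a) + 2 * a)
        (vec (x := fun θ i => F θ i t / F θ s t) 1 fun i st' hs' =>
          div (((hF i t).mono hs₁).mono hs') (((hF s t).mono hs₁).mono hs')
            fun θ hθ => hst θ (hs'.1 hθ)) (by omega) fun st₂ hs₂ hy => ?_
      have hF₂ := (hF.mono hs₁).mono hs₂
      let G : Θ → Matrix ι κ K := fun θ => Matrix.of fun i j =>
        F θ i j - F θ i t / F θ s t * F θ s j
      refine bind_le (c' := R * (4 * a))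
        (mat (M := G) 2 fun i j st' hs' => ((mul ((hy i).mono hs') ((hF₂ s j).mono hs')).bind
          fun st'' hs'' hk => sub ((hF₂ i j).mono (leTrans hs' hs'')) hk))
        (by rw [← ha]; omega) fun st₃ hs₃ hG => ?_
      refine (ih hG fun θ hθ => Nat.le_of_lt_succ
        (lt_of_lt_of_le (Matrix.rank_sub_cross_lt (F θ) (hst θ (hs₂.1 (hs₃.1 hθ))))
          (hR θ (hs₁.1 (hs₂.1 (hs₃.1 hθ)))))).imp ?_
      rintro st₄ hs₄ ⟨Y, B, hY, hB, hYB⟩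
      refine ⟨fun θ => Matrix.of fun i l =>
          Fin.cases (motive := fun _ => K) (F θ i t / F θ s t) (fun l => Y θ i l) l,
        fun θ => Matrix.of fun l j =>
          Fin.cases (motive := fun _ => K) (F θ s j) (fun l => B θ l j) l,
        fun i j => ?_, fun i j => ?_, fun θ hθ => ?_⟩
      · refine Fin.cases ?_ (fun j => ?_) j
        · exact (hy i).mono (leTrans hs₃ hs₄)
        · exact hY i j
      · refine Fin.cases ?_ (fun i => ?_) i
        · exact (hF₂ s j).mono (leTrans hs₃ hs₄)
        · exact hB i j
      · obtain ⟨h₁, Z, h₂⟩ := hYB θ hθ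
        constructor
        · ext i j
          have := congrFun (congrFun h₁ i) j
          rw [Matrix.mul_apply] at this ⊢
          simp only [Matrix.of_apply, Fin.sum_univ_succ, Fin.cases_zero, Fin.cases_succ]
          rw [← this]
          simp [G]
        -- The first row of the new `Z` selects row `s` of `F`; the others compose the old `Z` with
        -- the subtraction of the cross.
        · refine ⟨Matrix.of fun l i => Fin.cases (motive := fun _ => K) (if i = s then 1 else 0)
            (fun l => Z l i - if i = s then ∑ i', Z l i' * (F θ i' t / F θ s t) else 0) l, ?_⟩
          ext l j
          rw [Matrix.mul_apply]
          refine Fin.cases ?_ (fun l => ?_) l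
          · simp
          · simp only [Matrix.of_apply, Fin.cases_succ, h₂, Matrix.mul_apply, G, sub_mul, mul_sub,
              Finset.sum_sub_distrib, ite_mul, zero_mul, Finset.sum_ite_eq', Finset.mem_univ,
              if_true, Finset.sum_mul, mul_assoc]
    · refine .done ⟨fun _ => 0, fun _ => 0, fun _ _ => known_const _ _,
        fun _ _ => known_const _ _, fun θ hθ => ⟨?_, 0, by simp⟩⟩
      rw [Matrix.zero_mul]
      ext i j
      exact h0 (i, j) θ hθ

/-- Injectivity supplies a pivot in the first column and passes to the reduced system. After `q`
pivots the `r` rows left involve only `t` and form `W`; back substitution yields `V`. -/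
theorem eliminate_fin {τ : Type*} [Fintype τ] (r q : ℕ) {st : KState Θ K}
    {A : Θ → Matrix (Fin (r + q)) (Fin q) K} {U : Θ → Matrix (Fin (r + q)) τ K}
    (hA : st.KnownMat A) (hU : st.KnownMat U)
    (hinj : ∀ θ ∈ st.S, ∀ z, A θ *ᵥ z = 0 → z = 0) :
    Reach (fun st' => ∃ (V : Θ → Matrix (Fin q) τ K) (W : Θ → Matrix (Fin r) τ K),
      st'.KnownMat V ∧ st'.KnownMat W ∧ ∀ θ ∈ st'.S, ∀ z t,
        A θ *ᵥ z + U θ *ᵥ t = 0 ↔ z = V θ *ᵥ t ∧ W θ *ᵥ t = 0)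
      (q * (8 * ((r + q) * (q + Fintype.card τ)))) st := by
  induction q generalizing st with
  | zero =>
    refine .done ⟨fun _ => 0, U, fun i => i.elim0, hU, fun θ _ z t => ?_⟩
    rw [Matrix.mulVec_eq_sum]
    simp only [Finset.univ_eq_empty, Finset.sum_empty, zero_add]
    exact ⟨fun h => ⟨Subsingleton.elim _ _, h⟩, fun h => h.2⟩
  | succ q ih =>
    set c := Fintype.card τ with hc
    set p := r + q with hp
    have hpos : 1 ≤ p + 1 := by omega
    refine bind_le (c' := 7 * ((p + 1) * (q + 1 + c)) + q * (8 * (p * (q + c))))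
      (search (fun i θ => A θ i 0) fun i => hA i 0) ?_ ?_
    · rw [Fintype.card_fin]
      have h1 : q * (8 * (p * (q + c))) ≤ q * (8 * ((p + 1) * (q + 1 + c))) := by gcongr <;> omega
      have h2 : p + 1 ≤ (p + 1) * (q + 1 + c) := Nat.le_mul_of_pos_right _ (by omega)
      have h3 : r + (q + 1) = p + 1 := by omega
      rw [h3]
      nlinarith
    rintro st₁ hs₁ (⟨s, hst⟩ | h0)
    · have hA₁ := hA.mono hs₁
      have hU₁ := hU.mono hs₁
      let a : Θ → Fin q → K := fun θ j => A θ s j.succ / A θ s 0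
      let u : Θ → τ → K := fun θ j => U θ s j / A θ s 0
      let A' : Θ → Matrix (Fin p) (Fin q) K := fun θ => Matrix.of fun i j =>
        A θ (s.succAbove i) j.succ - A θ (s.succAbove i) 0 * a θ j
      let U' : Θ → Matrix (Fin p) τ K := fun θ => Matrix.of fun i j =>
        U θ (s.succAbove i) j - A θ (s.succAbove i) 0 * u θ j
      have e1 : q + c + 2 * (p * (q + c)) + c * (2 * q + 1) ≤ 7 * ((p + 1) * (q + 1 + c)) := by
        have : q ≤ p := by omega
        nlinarith [Nat.mul_le_mul_right c this]
      refine bind_le (c' := c + 2 * (p * (q + c)) + c * (2 * q + 1) + q * (8 * (p * (q + c))))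
        (vec (x := a) 1 fun j st' hs' =>
          div ((hA₁ s j.succ).mono hs') ((hA₁ s 0).mono hs') fun θ hθ => hst θ (hs'.1 hθ))
        (by rw [Fintype.card_fin]; omega) fun st₂ hs₂ ha => ?_
      refine bind_le (c' := 2 * (p * (q + c)) + c * (2 * q + 1) + q * (8 * (p * (q + c))))
        (vec (x := u) 1 fun j st' hs' =>
          div ((hU₁ s j).mono (leTrans hs₂ hs')) ((hA₁ s 0).mono (leTrans hs₂ hs'))
            fun θ hθ => hst θ (hs₂.1 (hs'.1 hθ)))
        (by rw [← hc]; omega) fun st₃ hs₃ hu => ?_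
      have h₁₃ := leTrans hs₂ hs₃
      refine bind_le (c' := 2 * (p * c) + c * (2 * q + 1) + q * (8 * (p * (q + c))))
        (mat (M := A') 2 fun i j st' hs' =>
          (mul ((hA₁ (s.succAbove i) 0).mono (leTrans h₁₃ hs')) ((ha j).mono (leTrans hs₃ hs'))).bind
            fun st'' hs'' hk => sub ((hA₁ _ j.succ).mono (leTrans h₁₃ (leTrans hs' hs''))) hk)
        (by rw [Fintype.card_fin, Fintype.card_fin, mul_add p]; omega) fun st₄ hs₄ hA' => ?_
      have h₁₄ := leTrans h₁₃ hs₄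
      refine bind_le (c' := c * (2 * q + 1) + q * (8 * (p * (q + c))))
        (mat (M := U') 2 fun i j st' hs' =>
          (mul ((hA₁ (s.succAbove i) 0).mono (leTrans h₁₄ hs'))
            ((hu j).mono (leTrans hs₄ hs'))).bind
            fun st'' hs'' hk => sub ((hU₁ _ j).mono (leTrans h₁₄ (leTrans hs' hs''))) hk)
        (by rw [Fintype.card_fin, ← hc]; omega) fun st₅ hs₅ hU' => ?_
      have h₁₅ := leTrans h₁₄ hs₅
      have step := fun θ (hθ : θ ∈ st₁.S) =>
        Matrix.eliminate_step (A θ) (U θ) s (hst θ hθ)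
      refine bind_le (c' := c * (2 * q + 1)) (ih (hA'.mono hs₅) hU' fun θ hθ z hz => ?_)
        (by rw [add_comm]) ?_
      -- A kernel vector of the reduced matrix extends to one of `A` by the entry that the pivot
      -- equation dictates.
      · have := (step θ (h₁₅.1 hθ) (Fin.cons (-(a θ ⬝ᵥ z)) z) 0).2
          ⟨by simp [a], by simpa [A', a] using hz⟩
        rw [Matrix.mulVec_zero, add_zero] at this
        have := hinj θ (hs₁.1 (h₁₅.1 hθ)) _ this
        ext j
        simpa using congrFun this j.succ
      · rintro st₆ hs₆ ⟨V, W, hV, hW, hVW⟩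
        have hs₃₆ := leTrans hs₄ (leTrans hs₅ hs₆)
        -- The row of `V` for `z 0`, from substituting the other entries into the pivot equation.
        let v : Θ → τ → K := fun θ j => 0 - u θ j - ∑ i, a θ i * V θ i j
        refine (vec (x := v) (2 * q + 1) fun j st' hs' => ?_).imp ?_
        · refine bind_le (c' := 2 * q) (sub (known_const _ 0) ((hu j).mono (leTrans hs₃₆ hs')))
            (by omega) fun st'' hs'' hk => ?_
          refine (sub_sum Finset.univ hk (a := fun i θ => a θ i) (b := fun i θ => V θ i j)
            (fun i _ => (ha i).mono (leTrans hs₃ (leTrans hs₃₆ (leTrans hs' hs''))))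
            fun i _ => (hV i j).mono (leTrans hs' hs'')).mono_cost ?_
          simp
        · intro st₇ hs₇ hv
          refine ⟨fun θ => Matrix.of (Fin.cons (v θ) (V θ)), W, fun i j => ?_, hW.mono hs₇,
            fun θ hθ z t => ?_⟩
          · refine Fin.cases ?_ (fun i => ?_) i
            · exact hv j
            · exact (hV i j).mono hs₇
          · have hθ₆ := hs₇.1 hθ
            refine (step θ (h₁₅.1 (hs₆.1 hθ₆)) z t).trans
              ((and_congr_right' (hVW θ hθ₆ (fun j => z j.succ) t)).trans ?_)
            rw [← and_assoc]
            refine and_congr_left fun _ => ?_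
            have hvt : v θ ⬝ᵥ t = -(u θ ⬝ᵥ t) - a θ ⬝ᵥ (V θ *ᵥ t) := by
              rw [Matrix.dotProduct_mulVec]
              simp only [v, dotProduct, Matrix.vecMul, zero_sub, sub_mul, neg_mul,
                Finset.sum_sub_distrib, Finset.sum_neg_distrib]
            constructor
            · rintro ⟨h1, h2⟩
              ext j
              refine Fin.cases ?_ (fun j => ?_) j
              · change z 0 = v θ ⬝ᵥ t
                rw [hvt, ← h2]
                linear_combination h1
              · exact congrFun h2 j
            · intro hz
              have h2 : (fun j : Fin q => z j.succ) = V θ *ᵥ t := by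
                ext j
                exact congrFun hz j.succ
              have h1 : z 0 = v θ ⬝ᵥ t := congrFun hz 0
              refine ⟨?_, h2⟩
              rw [h2, h1, hvt]
              simp only [a, u]
              ring
    -- A vanishing first column contradicts injectivity, so no instance is left on this branch.
    · refine .done ⟨fun _ => 0, fun _ => 0, fun _ _ => known_const _ _, fun _ _ => known_const _ _,
        fun θ hθ => ?_⟩
      have h1 : A θ *ᵥ Pi.single 0 1 = 0 := by
        ext i
        simpa using h0 i θ hθ
      have h2 := congrFun (hinj θ (hs₁.1 hθ) _ h1) 0
      simp at h2

/-- Solve `A z + U t = 0` for `z`, with the conditions on `t` for solvability. -/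
theorem eliminate {ι κ τ : Type*} [Fintype ι] [Fintype κ] [Fintype τ] {st : KState Θ K}
    {A : Θ → Matrix ι κ K} {U : Θ → Matrix ι τ K} (hA : st.KnownMat A) (hU : st.KnownMat U)
    (hinj : ∀ θ ∈ st.S, ∀ z, A θ *ᵥ z = 0 → z = 0) (r : ℕ)
    (hr' : Fintype.card ι - Fintype.card κ = r) :
    Reach (fun st' => ∃ (V : Θ → Matrix κ τ K) (W : Θ → Matrix (Fin r) τ K),
      st'.KnownMat V ∧ st'.KnownMat W ∧ ∀ θ ∈ st'.S, ∀ z t,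
        A θ *ᵥ z + U θ *ᵥ t = 0 ↔ z = V θ *ᵥ t ∧ W θ *ᵥ t = 0)
      (Fintype.card κ * (8 * (Fintype.card ι * (Fintype.card κ + Fintype.card τ)))) st := by
  -- An instance is needed to know that there are at least as many rows as columns; without one,
  -- nothing has to be computed.
  rcases st.S.eq_empty_or_nonempty with h | ⟨θ₀, hθ₀⟩
  · exact .done ⟨fun _ => 0, fun _ => 0, fun _ _ => known_const _ _, fun _ _ => known_const _ _,
      fun θ hθ => by simp [h] at hθ⟩
  have hle := Matrix.card_le_card_of_injective (hinj θ₀ hθ₀)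
  have hr : Fintype.card ι = r + Fintype.card κ := by omega
  let e := (Fintype.equivFinOfCardEq hr).symm
  let f := (Fintype.equivFin κ).symm
  have key : ∀ θ z, (A θ).submatrix e f *ᵥ z = (A θ *ᵥ (z ∘ f.symm)) ∘ e := fun θ z =>
    Matrix.submatrix_mulVec_equiv _ _ _ _
  have keyU : ∀ θ t, (U θ).submatrix e id *ᵥ t = (U θ *ᵥ t) ∘ e := fun θ t =>
    Matrix.submatrix_mulVec_equiv _ _ _ (Equiv.refl _)
  have h0 : ∀ x : ι → K, x ∘ e = 0 ↔ x = 0 := fun x =>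
    ⟨fun h => by ext i; simpa using congrFun h (e.symm i), fun h => by rw [h]; rfl⟩
  refine ((eliminate_fin r _ (hA.submatrix e f) (hU.submatrix e id) fun θ hθ z hz => ?_).imp ?_
    ).mono_cost (by rw [hr])
  · rw [key, h0] at hz
    have := hinj θ hθ _ hz
    ext j
    simpa using congrFun this (f j)
  · rintro st' hs ⟨V, W, hV, hW, hVW⟩
    refine ⟨fun θ => (V θ).submatrix f.symm id, W, hV.submatrix _ _, hW, fun θ hθ z t => ?_⟩
    have := hVW θ hθ (z ∘ f) t
    rw [key, keyU, Function.comp_assoc, f.self_comp_symm, Function.comp_id, ← Pi.add_comp,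
      h0] at this
    rw [this]
    refine and_congr_left fun _ => ⟨fun h => ?_, fun h => ?_⟩
    · ext j
      simpa [Matrix.mulVec, dotProduct] using congrFun h (f.symm j)
    · rw [h]
      ext j
      simp [Matrix.mulVec, dotProduct]

end Reach

/-! ### Block matrices along a tree -/

/-- Binary trees with labelled leaves. -/
inductive BlockTree (α : Type) where
  | leaf (a : α)
  | node (l r : BlockTree α)

namespace BlockTree

variable {α : Type}

/-- The sum of `g` over the leaves. -/
def sum (g : α → ℕ) : BlockTree α → ℕ
  | leaf a => g a
  | node l r => l.sum g + r.sum g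

/-- The largest depth of a leaf. -/
def height : BlockTree α → ℕ
  | leaf _ => 0
  | node l r => max l.height r.height + 1

end BlockTree

/-! ### Fast products when the off-diagonal blocks are given by generators -/

section Given

variable {α : Type} {Θ K : Type*} [Field K]

/-- The matrix is given by a generating pair of length at most `ρ` with available entries. -/
def LowRank {ι κ : Type*} (ρ : ℕ) (st : KState Θ K) (M : Θ → Matrix ι κ K) : Prop :=
  ∃ r ≤ ρ, ∃ (F : Θ → Matrix ι (Fin r) K) (H : Θ → Matrix (Fin r) κ K),
    st.KnownMat F ∧ st.KnownMat H ∧ ∀ θ ∈ st.S, M θ = F θ * H θ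

/-- The diagonal blocks at the leaves are available, and the off-diagonal blocks at the other
vertices are given by generating pairs. -/
inductive Given (ρ : ℕ) (st : KState Θ K) (m n : α → ℕ) :
    BlockTree α → ∀ (I J : Type) [Fintype I] [Fintype J], (Θ → Matrix I J K) → Prop
  | leaf {a : α} {I J : Type} [Fintype I] [Fintype J] {M : Θ → Matrix I J K} :
      Fintype.card I = m a → Fintype.card J = n a → st.KnownMat M → Given ρ st m n (.leaf a) I J M
  | node {l r : BlockTree α} {I₁ I₂ J₁ J₂ : Type} [Fintype I₁] [Fintype I₂] [Fintype J₁]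
      [Fintype J₂] {A : Θ → Matrix I₁ J₁ K} {B : Θ → Matrix I₁ J₂ K} {C : Θ → Matrix I₂ J₁ K}
      {D : Θ → Matrix I₂ J₂ K} :
      Given ρ st m n l I₁ J₁ A → Given ρ st m n r I₂ J₂ D → LowRank ρ st B → LowRank ρ st C →
      Given ρ st m n (.node l r) (I₁ ⊕ I₂) (J₁ ⊕ J₂)
        (fun θ => Matrix.fromBlocks (A θ) (B θ) (C θ) (D θ))

variable {ρ : ℕ} {st st' : KState Θ K} {m n : α → ℕ} {T : BlockTree α}

theorem LowRank.mono {ι κ : Type*} {M : Θ → Matrix ι κ K} (h : LowRank ρ st M) (hs : st ≤ st') :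
    LowRank ρ st' M := by
  obtain ⟨r, hr, F, H, hF, hH, hM⟩ := h
  exact ⟨r, hr, F, H, hF.mono hs, hH.mono hs, fun θ hθ => hM θ (hs.1 hθ)⟩

theorem LowRank.transpose {ι κ : Type*} {M : Θ → Matrix ι κ K} (h : LowRank ρ st M) :
    LowRank ρ st fun θ => (M θ)ᵀ := by
  obtain ⟨r, hr, F, H, hF, hH, hM⟩ := h
  exact ⟨r, hr, _, _, hH.transpose, hF.transpose, fun θ hθ => by
    simp only [hM θ hθ, Matrix.transpose_mul]⟩

variable {I J : Type} [Fintype I] [Fintype J]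

theorem Given.transpose {M : Θ → Matrix I J K} (h : Given ρ st m n T I J M) :
    Given ρ st n m T J I fun θ => (M θ)ᵀ := by
  induction h with
  | leaf hI hJ hM => exact .leaf hJ hI hM.transpose
  | node _ _ hB hC ih₁ ih₂ =>
    simp only [Matrix.fromBlocks_transpose]
    exact .node ih₁ ih₂ hC.transpose hB.transpose

theorem Given.card {M : Θ → Matrix I J K} (h : Given ρ st m n T I J M) :
    Fintype.card I = T.sum m ∧ Fintype.card J = T.sum n := by
  induction h with
  | leaf hI hJ hM => exact ⟨hI, hJ⟩
  | node _ _ _ _ ih₁ ih₂ =>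
    simp only [Fintype.card_sum, BlockTree.sum]
    omega

/-- The cost of a matrix-vector product along a tree. -/
def mulVecCost (ρ : ℕ) (m n : α → ℕ) : BlockTree α → ℕ
  | .leaf a => m a * (2 * n a - 1)
  | .node l r => mulVecCost ρ m n l + mulVecCost ρ m n r +
      2 * ρ * ((l.sum m + r.sum m) + (l.sum n + r.sum n))

/-- Every level costs `2 * ρ` per row and column. The operation saved per row at the leaves appears
as `T.sum m` on the left, which gives a strict bound even for height zero. -/
theorem mulVecCost_le (hm : ∀ a, 0 < m a) (hn : ∀ a, 0 < n a) (T : BlockTree α) :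
    0 < T.sum m ∧ mulVecCost ρ m n T + T.sum m ≤
      2 * T.sum (fun a => m a * n a) + 2 * ρ * (T.sum m + T.sum n) * T.height := by
  induction T with
  | leaf a =>
    refine ⟨hm a, ?_⟩
    simp only [mulVecCost, BlockTree.sum, BlockTree.height]
    obtain ⟨d, hd⟩ : ∃ d, n a = d + 1 := ⟨n a - 1, by have := hn a; omega⟩
    rw [hd, show 2 * (d + 1) - 1 = 2 * d + 1 by omega]
    apply le_of_eq
    ring
  | node l r hl hr =>
    obtain ⟨hl₀, hl⟩ := hl
    obtain ⟨hr₀, hr⟩ := hr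
    refine ⟨Nat.add_pos_left hl₀ _, ?_⟩
    simp only [mulVecCost, BlockTree.sum, BlockTree.height]
    have h1 := Nat.mul_le_mul_left (2 * ρ * (l.sum m + l.sum n)) (le_max_left l.height r.height)
    have h2 := Nat.mul_le_mul_left (2 * ρ * (r.sum m + r.sum n)) (le_max_right l.height r.height)
    generalize max l.height r.height = h at *
    ring_nf at *
    omega

namespace Reach

/-- Add the product of a matrix of low rank with a vector. -/
theorem add_lowRank_mulVec {ι κ : Type*} [Fintype ι] [Fintype κ] {N : Θ → Matrix ι κ K}
    (hN : LowRank ρ st N) {y : Θ → ι → K} {x : Θ → κ → K} (hy : st.KnownVec y)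
    (hx : st.KnownVec x) :
    Reach (fun st' => st'.KnownVec fun θ => y θ + N θ *ᵥ x θ)
      (2 * ρ * (Fintype.card ι + Fintype.card κ)) st := by
  obtain ⟨r, hr, F, H, hF, hH, hM⟩ := hN
  refine bind_le (c' := Fintype.card ι * (2 * r)) (mulVec hH hx) ?_ fun st₁ h₁ k₁ => ?_
  · rw [Fintype.card_fin]
    have h1 : r * (2 * Fintype.card κ - 1) ≤ ρ * (2 * Fintype.card κ) :=
      Nat.mul_le_mul hr (Nat.sub_le _ _)
    nlinarith [Nat.mul_le_mul_left (Fintype.card ι) hr]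
  · have h := add_mulVec (hy.mono h₁) (hF.mono h₁) k₁
    rw [Fintype.card_fin] at h
    refine h.imp fun st₂ h₂ k₂ => k₂.congr fun θ hθ => ?_
    rw [hM θ (h₁.1 (h₂.1 hθ)), Matrix.mulVec_mulVec]

end Reach

/-- From the given state on, products of the matrix with available vectors have cost at most
`c`. -/
def FastMul {ι κ : Type*} [Fintype κ] (st : KState Θ K) (M : Θ → Matrix ι κ K) (c : ℕ) : Prop :=
  ∀ st', st ≤ st' → ∀ x : Θ → κ → K, st'.KnownVec x →
    Reach (fun st'' => st''.KnownVec fun θ => M θ *ᵥ x θ) c st'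

theorem FastMul.mono {ι κ : Type*} [Fintype κ] {M : Θ → Matrix ι κ K} {c : ℕ}
    (h : FastMul st M c) (hs : st ≤ st') : FastMul st' M c :=
  fun st'' hs' => h st'' (leTrans hs hs')

-- The diagonal blocks are applied recursively; the products with the two off-diagonal blocks are
-- accumulated onto the results through their generators.
open Reach in
theorem Given.fastMul {M : Θ → Matrix I J K} (h : Given ρ st m n T I J M) :
    FastMul st M (mulVecCost ρ m n T) := by
  induction h with
  | leaf hI hJ hM =>
    intro st' hs x hx
    have := mulVec (hM.mono hs) hx
    rwa [hI, hJ] at this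
  | @node l r I₁ I₂ J₁ J₂ _ _ _ _ A B C D h₁ h₂ hB hC ih₁ ih₂ =>
    intro st' hs x hx
    have hx₁ := hx.comp Sum.inl
    have hx₂ := hx.comp Sum.inr
    obtain ⟨cI₁, cJ₁⟩ := h₁.card
    obtain ⟨cI₂, cJ₂⟩ := h₂.card
    refine bind_le (ih₁ st' hs _ hx₁) (c' := mulVecCost ρ m n r +
      2 * ρ * ((l.sum m + r.sum m) + (l.sum n + r.sum n))) (Nat.add_assoc _ _ _).ge
      fun st₁ hs₁ k₁ => ?_
    refine bind_le (ih₂ st₁ (leTrans hs hs₁) _ (hx₂.mono hs₁))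
      (c' := 2 * ρ * ((l.sum m + r.sum m) + (l.sum n + r.sum n))) le_rfl fun st₂ hs₂ k₂ => ?_
    have hs' := leTrans hs₁ hs₂
    refine bind_le (add_lowRank_mulVec (hB.mono (leTrans hs hs')) (k₁.mono hs₂) (hx₂.mono hs'))
      (c' := 2 * ρ * (r.sum m + l.sum n)) (by rw [cI₁, cJ₂]; apply le_of_eq; ring)
      fun st₃ hs₃ k₃ => ?_
    have hs'' := leTrans hs' hs₃
    have h := add_lowRank_mulVec (hC.mono (leTrans hs hs'')) (k₂.mono hs₃) (hx₁.mono hs'')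
    rw [cI₂, cJ₁] at h
    refine h.imp fun st₄ hs₄ k₄ => ((k₃.mono hs₄).sumElim k₄).congr fun θ _ => ?_
    rw [Matrix.fromBlocks_mulVec, add_comm (C θ *ᵥ _)]

end Given

/-! ### The algebra of merging two eliminated blocks -/

section Elimination

variable {K : Type*} [Field K]

/-- `W` describes the vectors `(M x, B x)`, and `L` recovers `x` from such a vector. -/
structure IsElim {I J R P : Type*} [Fintype I] [Fintype J] [Fintype R] (M : Matrix I J K)
    (B : Matrix R J K) (W : Matrix P (I ⊕ R) K) (L : Matrix J (I ⊕ R) K) : Prop where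
  mulVec_eq_zero_iff : ∀ g y, W *ᵥ Sum.elim g y = 0 ↔ ∃ x, M *ᵥ x = g ∧ B *ᵥ x = y
  mulVec_eq : ∀ x, L *ᵥ Sum.elim (M *ᵥ x) (B *ᵥ x) = x

section Merge

variable {I₁ I₂ J₁ J₂ R P₁ P₂ : Type*} [Fintype I₁] [Fintype I₂] [Fintype J₁] [Fintype J₂]
  [Fintype R]

/-- The equations for the unknowns of the two children of a vertex. -/
def mergeMatrix (W₁ : Matrix P₁ (I₁ ⊕ R) K) (W₂ : Matrix P₂ (I₂ ⊕ R) K) (F₁ : Matrix I₂ R K)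
    (F₂ : Matrix I₁ R K) (X₁ X₂ : Matrix R R K) : Matrix ((P₁ ⊕ P₂) ⊕ R) (R ⊕ R) K :=
  Matrix.fromRows
    (Matrix.fromBlocks W₁.toCols₂ (-(W₁.toCols₁ * F₂)) (-(W₂.toCols₁ * F₁)) W₂.toCols₂)
    (Matrix.fromCols X₁ X₂)

/-- The right-hand side of the equations for the unknowns of the two children of a vertex. -/
def mergeRhs [DecidableEq R] (W₁ : Matrix P₁ (I₁ ⊕ R) K) (W₂ : Matrix P₂ (I₂ ⊕ R) K) :
    Matrix ((P₁ ⊕ P₂) ⊕ R) ((I₁ ⊕ I₂) ⊕ R) K :=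
  Matrix.fromBlocks (Matrix.fromBlocks W₁.toCols₁ 0 0 W₂.toCols₁) 0 0 (-1)

/-- The solution operator of a vertex from those of its children. -/
def mergeSol [DecidableEq I₁] [DecidableEq I₂] (L₁ : Matrix J₁ (I₁ ⊕ R) K)
    (L₂ : Matrix J₂ (I₂ ⊕ R) K) (F₁ : Matrix I₂ R K) (F₂ : Matrix I₁ R K)
    (V : Matrix (R ⊕ R) ((I₁ ⊕ I₂) ⊕ R) K) : Matrix (J₁ ⊕ J₂) ((I₁ ⊕ I₂) ⊕ R) K :=
  Matrix.fromRows
    (L₁ * Matrix.fromRows (Matrix.fromCols (Matrix.fromCols 1 0) 0 - F₂ * V.toRows₂) V.toRows₁)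
    (L₂ * Matrix.fromRows (Matrix.fromCols (Matrix.fromCols 0 1) 0 - F₁ * V.toRows₁) V.toRows₂)

theorem Matrix.mulVec_sumElim_toCols {ι κ κ' : Type*} [Fintype κ] [Fintype κ']
    (W : Matrix ι (κ ⊕ κ') K) (x : κ → K) (y : κ' → K) :
    W *ᵥ Sum.elim x y = W.toCols₁ *ᵥ x + W.toCols₂ *ᵥ y := by
  conv_lhs => rw [← Matrix.fromCols_toCols W]
  rw [Matrix.fromCols_mulVec, Sum.elim_comp_inl, Sum.elim_comp_inr]

theorem Matrix.transpose_mulVec_toRows {ι ι' κ : Type*} [Fintype ι] [Fintype ι']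
    (G : Matrix (ι ⊕ ι') κ K) (v : ι ⊕ ι' → K) :
    Gᵀ *ᵥ v = G.toRows₁ᵀ *ᵥ (v ∘ Sum.inl) + G.toRows₂ᵀ *ᵥ (v ∘ Sum.inr) := by
  conv_lhs => rw [← Sum.elim_comp_inl_inr v]
  rw [Matrix.mulVec_sumElim_toCols]
  rfl

variable {W₁ : Matrix P₁ (I₁ ⊕ R) K} {W₂ : Matrix P₂ (I₂ ⊕ R) K} {F₁ : Matrix I₂ R K}
  {F₂ : Matrix I₁ R K} {X₁ X₂ : Matrix R R K}

/-- Here `y₁`, `y₂` stand for `B₁ x₁`, `B₂ x₂`. Once they are fixed, the children have the separate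
right-hand sides `g₁ - F₂ y₂` and `g₂ - F₁ y₁`, and their equations become linear conditions on
`y₁`, `y₂`. -/
theorem mergeMatrix_mulVec [DecidableEq R] (y₁ y₂ y : R → K) (g₁ : I₁ → K) (g₂ : I₂ → K) :
    mergeMatrix W₁ W₂ F₁ F₂ X₁ X₂ *ᵥ Sum.elim y₁ y₂ +
        mergeRhs W₁ W₂ *ᵥ Sum.elim (Sum.elim g₁ g₂) y = 0 ↔
      (W₁ *ᵥ Sum.elim (g₁ - F₂ *ᵥ y₂) y₁ = 0 ∧ W₂ *ᵥ Sum.elim (g₂ - F₁ *ᵥ y₁) y₂ = 0) ∧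
        X₁ *ᵥ y₁ + X₂ *ᵥ y₂ = y := by
  have e₁ : W₁ *ᵥ Sum.elim (g₁ - F₂ *ᵥ y₂) y₁ =
      W₁.toCols₂ *ᵥ y₁ + -(W₁.toCols₁ * F₂) *ᵥ y₂ + W₁.toCols₁ *ᵥ g₁ := by
    rw [Matrix.mulVec_sumElim_toCols, Matrix.mulVec_sub, Matrix.neg_mulVec, Matrix.mulVec_mulVec]
    abel
  have e₂ : W₂ *ᵥ Sum.elim (g₂ - F₁ *ᵥ y₁) y₂ =
      -(W₂.toCols₁ * F₁) *ᵥ y₁ + W₂.toCols₂ *ᵥ y₂ + W₂.toCols₁ *ᵥ g₂ := by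
    rw [Matrix.mulVec_sumElim_toCols, Matrix.mulVec_sub, Matrix.neg_mulVec, Matrix.mulVec_mulVec]
    abel
  have key : mergeMatrix W₁ W₂ F₁ F₂ X₁ X₂ *ᵥ Sum.elim y₁ y₂ +
        mergeRhs W₁ W₂ *ᵥ Sum.elim (Sum.elim g₁ g₂) y =
      Sum.elim (Sum.elim (W₁ *ᵥ Sum.elim (g₁ - F₂ *ᵥ y₂) y₁)
        (W₂ *ᵥ Sum.elim (g₂ - F₁ *ᵥ y₁) y₂)) (X₁ *ᵥ y₁ + X₂ *ᵥ y₂ - y) := by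
    rw [e₁, e₂, mergeMatrix, mergeRhs, Matrix.fromRows_mulVec, Matrix.fromBlocks_mulVec,
      Matrix.fromBlocks_mulVec, Matrix.fromBlocks_mulVec, Matrix.fromCols_mulVec]
    simp only [Sum.elim_comp_inl, Sum.elim_comp_inr, Matrix.zero_mulVec, Matrix.neg_mulVec,
      Matrix.one_mulVec, add_zero, zero_add]
    ext ((i | i) | i) <;> simp [sub_eq_add_neg]
  rw [key]
  constructor
  · intro h
    refine ⟨⟨?_, ?_⟩, sub_eq_zero.1 ?_⟩
    · ext i; exact congrFun h (.inl (.inl i))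
    · ext i; exact congrFun h (.inl (.inr i))
    · ext i; exact congrFun h (.inr i)
  · rintro ⟨⟨h₁, h₂⟩, h₃⟩
    rw [h₁, h₂, sub_eq_zero.2 h₃]
    ext ((i | i) | i) <;> rfl

variable {M₁₁ : Matrix I₁ J₁ K} {M₁₂ : Matrix I₁ J₂ K} {M₂₁ : Matrix I₂ J₁ K}
  {M₂₂ : Matrix I₂ J₂ K} {B₁ : Matrix R J₁ K} {B₂ : Matrix R J₂ K} {B : Matrix R (J₁ ⊕ J₂) K}
  {L₁ : Matrix J₁ (I₁ ⊕ R) K} {L₂ : Matrix J₂ (I₂ ⊕ R) K}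

/-- The off-diagonal blocks and `B` see the vector only through `B₁ x₁` and `B₂ x₂`, so the system
decouples given these. -/
theorem fromBlocks_mulVec_eq_iff (h₁₂ : M₁₂ = F₂ * B₂) (h₂₁ : M₂₁ = F₁ * B₁)
    (hB : B = Matrix.fromCols (X₁ * B₁) (X₂ * B₂)) (x₁ : J₁ → K) (x₂ : J₂ → K) (g₁ : I₁ → K)
    (g₂ : I₂ → K) (y : R → K) :
    (Matrix.fromBlocks M₁₁ M₁₂ M₂₁ M₂₂ *ᵥ Sum.elim x₁ x₂ = Sum.elim g₁ g₂ ∧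
        B *ᵥ Sum.elim x₁ x₂ = y) ↔
      (M₁₁ *ᵥ x₁ = g₁ - F₂ *ᵥ (B₂ *ᵥ x₂) ∧ M₂₂ *ᵥ x₂ = g₂ - F₁ *ᵥ (B₁ *ᵥ x₁)) ∧
        X₁ *ᵥ (B₁ *ᵥ x₁) + X₂ *ᵥ (B₂ *ᵥ x₂) = y := by
  rw [Matrix.fromBlocks_mulVec, hB, Matrix.fromCols_mulVec, h₁₂, h₂₁]
  simp only [Sum.elim_comp_inl, Sum.elim_comp_inr, Matrix.mulVec_mulVec]
  rw [Sum.elim_eq_iff, eq_sub_iff_add_eq, eq_sub_iff_add_eq, add_comm (M₁₁ *ᵥ x₁),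
    add_comm (M₂₂ *ᵥ x₂)]

/-- By the descriptions of the children, a kernel vector consists of `B₁ x₁` and `B₂ x₂` for a
solution of the homogeneous system of the merged block. That solution is zero, hence so is the
kernel vector. -/
theorem IsElim.mergeMatrix_injective [DecidableEq R] (e₁ : IsElim M₁₁ B₁ W₁ L₁)
    (e₂ : IsElim M₂₂ B₂ W₂ L₂)
    (h₁₂ : M₁₂ = F₂ * B₂) (h₂₁ : M₂₁ = F₁ * B₁) (hB : B = Matrix.fromCols (X₁ * B₁) (X₂ * B₂))
    (hinj : ∀ x, Matrix.fromBlocks M₁₁ M₁₂ M₂₁ M₂₂ *ᵥ x = 0 → B *ᵥ x = 0 → x = 0)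
    (z : R ⊕ R → K) (hz : mergeMatrix W₁ W₂ F₁ F₂ X₁ X₂ *ᵥ z = 0) : z = 0 := by
  have h := mergeMatrix_mulVec (W₁ := W₁) (W₂ := W₂) (F₁ := F₁) (F₂ := F₂) (X₁ := X₁) (X₂ := X₂)
    (z ∘ Sum.inl) (z ∘ Sum.inr) 0 0 0
  have h0 : (Sum.elim (Sum.elim 0 0) 0 : (I₁ ⊕ I₂) ⊕ R → K) = 0 := by
    ext ((i | i) | i) <;> rfl
  rw [h0, Matrix.mulVec_zero, add_zero, Sum.elim_comp_inl_inr, e₁.mulVec_eq_zero_iff,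
    e₂.mulVec_eq_zero_iff] at h
  obtain ⟨⟨⟨x₁, h1, h1'⟩, x₂, h2, h2'⟩, h3⟩ := h.1 hz
  rw [← h1', ← h2'] at h3
  rw [← h2'] at h1
  rw [← h1'] at h2
  obtain ⟨h4, h5⟩ := (fromBlocks_mulVec_eq_iff h₁₂ h₂₁ hB x₁ x₂ 0 0 0).2 ⟨⟨h1, h2⟩, h3⟩
  have h00 : (Sum.elim 0 0 : I₁ ⊕ I₂ → K) = 0 := by
    ext (i | i) <;> rfl
  have hx := hinj _ (h4.trans h00) h5
  have hx₁ : x₁ = 0 := by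
    ext i; exact congrFun hx (.inl i)
  have hx₂ : x₂ = 0 := by
    ext i; exact congrFun hx (.inr i)
  rw [hx₁, Matrix.mulVec_zero] at h1'
  rw [hx₂, Matrix.mulVec_zero] at h2'
  ext (i | i)
  · exact (congrFun h1' i).symm
  · exact (congrFun h2' i).symm

/-- The form in which the operator is evaluated: find the intermediate unknowns by `V`, correct the
right-hand sides, call the children. -/
theorem mergeSol_mulVec [DecidableEq I₁] [DecidableEq I₂]
    (V : Matrix (R ⊕ R) ((I₁ ⊕ I₂) ⊕ R) K) (t : (I₁ ⊕ I₂) ⊕ R → K) :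
    mergeSol L₁ L₂ F₁ F₂ V *ᵥ t = Sum.elim
      (L₁ *ᵥ Sum.elim ((t ∘ Sum.inl) ∘ Sum.inl - F₂ *ᵥ ((V *ᵥ t) ∘ Sum.inr))
        ((V *ᵥ t) ∘ Sum.inl))
      (L₂ *ᵥ Sum.elim ((t ∘ Sum.inl) ∘ Sum.inr - F₁ *ᵥ ((V *ᵥ t) ∘ Sum.inl))
        ((V *ᵥ t) ∘ Sum.inr)) := by
  have p₁ : Matrix.fromCols (Matrix.fromCols (1 : Matrix I₁ I₁ K) (0 : Matrix I₁ I₂ K))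
      (0 : Matrix I₁ R K) *ᵥ t = (t ∘ Sum.inl) ∘ Sum.inl := by
    rw [Matrix.fromCols_mulVec, Matrix.fromCols_mulVec]
    simp
  have p₂ : Matrix.fromCols (Matrix.fromCols (0 : Matrix I₂ I₁ K) (1 : Matrix I₂ I₂ K))
      (0 : Matrix I₂ R K) *ᵥ t = (t ∘ Sum.inl) ∘ Sum.inr := by
    rw [Matrix.fromCols_mulVec, Matrix.fromCols_mulVec]
    simp
  have q₁ : V.toRows₁ *ᵥ t = (V *ᵥ t) ∘ Sum.inl := rfl
  have q₂ : V.toRows₂ *ᵥ t = (V *ᵥ t) ∘ Sum.inr := rfl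
  rw [mergeSol, Matrix.fromRows_mulVec, ← Matrix.mulVec_mulVec, ← Matrix.mulVec_mulVec,
    Matrix.fromRows_mulVec, Matrix.fromRows_mulVec, Matrix.sub_mulVec, Matrix.sub_mulVec,
    ← Matrix.mulVec_mulVec, ← Matrix.mulVec_mulVec, p₁, p₂, q₁, q₂]

/-- `W t = 0` means that intermediate unknowns `z` exist, and the children turn such a `z` into the
two halves of a solution. As `z = V t` is the only choice, it equals `(B₁ x₁, B₂ x₂)` for any given
`x`, so the operators of the children recover both halves. -/
theorem IsElim.merge [DecidableEq R] [DecidableEq I₁] [DecidableEq I₂] (e₁ : IsElim M₁₁ B₁ W₁ L₁)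
    (e₂ : IsElim M₂₂ B₂ W₂ L₂) (h₁₂ : M₁₂ = F₂ * B₂) (h₂₁ : M₂₁ = F₁ * B₁)
    (hB : B = Matrix.fromCols (X₁ * B₁) (X₂ * B₂)) {P : Type*}
    {V : Matrix (R ⊕ R) ((I₁ ⊕ I₂) ⊕ R) K} {W : Matrix P ((I₁ ⊕ I₂) ⊕ R) K}
    (hVW : ∀ z t, mergeMatrix W₁ W₂ F₁ F₂ X₁ X₂ *ᵥ z + mergeRhs W₁ W₂ *ᵥ t = 0 ↔
      z = V *ᵥ t ∧ W *ᵥ t = 0) :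
    IsElim (Matrix.fromBlocks M₁₁ M₁₂ M₂₁ M₂₂) B W (mergeSol L₁ L₂ F₁ F₂ V) := by
  constructor
  · intro g y
    have hg : Sum.elim (g ∘ Sum.inl) (g ∘ Sum.inr) = g := Sum.elim_comp_inl_inr g
    trans ∃ z, mergeMatrix W₁ W₂ F₁ F₂ X₁ X₂ *ᵥ z + mergeRhs W₁ W₂ *ᵥ Sum.elim g y = 0
    · simp only [hVW]
      exact ⟨fun h => ⟨_, rfl, h⟩, fun ⟨_, _, h⟩ => h⟩
    constructor
    · rintro ⟨z, hz⟩
      rw [← Sum.elim_comp_inl_inr z, ← hg, mergeMatrix_mulVec, e₁.mulVec_eq_zero_iff,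
        e₂.mulVec_eq_zero_iff] at hz
      obtain ⟨⟨⟨x₁, h1, h1'⟩, x₂, h2, h2'⟩, h3⟩ := hz
      refine ⟨Sum.elim x₁ x₂, ?_⟩
      rw [← hg]
      refine (fromBlocks_mulVec_eq_iff h₁₂ h₂₁ hB x₁ x₂ _ _ y).2 ⟨⟨?_, ?_⟩, ?_⟩
      · rw [h2', h1]
      · rw [h1', h2]
      · rw [h1', h2', h3]
    · rintro ⟨x, hx⟩
      rw [← hg, ← Sum.elim_comp_inl_inr x, fromBlocks_mulVec_eq_iff h₁₂ h₂₁ hB] at hx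
      refine ⟨Sum.elim (B₁ *ᵥ (x ∘ Sum.inl)) (B₂ *ᵥ (x ∘ Sum.inr)), ?_⟩
      rw [← hg, mergeMatrix_mulVec, e₁.mulVec_eq_zero_iff, e₂.mulVec_eq_zero_iff]
      exact ⟨⟨⟨_, hx.1.1, rfl⟩, ⟨_, hx.1.2, rfl⟩⟩, hx.2⟩
  · intro x
    set t := Sum.elim (Matrix.fromBlocks M₁₁ M₁₂ M₂₁ M₂₂ *ᵥ x) (B *ᵥ x) with ht
    set g := Matrix.fromBlocks M₁₁ M₁₂ M₂₁ M₂₂ *ᵥ x with hgdef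
    have hg : Sum.elim (g ∘ Sum.inl) (g ∘ Sum.inr) = g := Sum.elim_comp_inl_inr g
    have hx := (fromBlocks_mulVec_eq_iff (M₁₁ := M₁₁) (M₂₂ := M₂₂) h₁₂ h₂₁ hB (x ∘ Sum.inl)
      (x ∘ Sum.inr) (g ∘ Sum.inl) (g ∘ Sum.inr) (B *ᵥ x)).1
        (by simp only [Sum.elim_comp_inl_inr, hgdef, and_self])
    obtain ⟨⟨hx₁, hx₂⟩, hx₃⟩ := hx
    have hz : Sum.elim (B₁ *ᵥ (x ∘ Sum.inl)) (B₂ *ᵥ (x ∘ Sum.inr)) = V *ᵥ t := by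
      refine ((hVW _ _).1 ?_).1
      rw [ht, ← hg, mergeMatrix_mulVec, e₁.mulVec_eq_zero_iff, e₂.mulVec_eq_zero_iff]
      refine ⟨⟨⟨_, hx₁, rfl⟩, ⟨_, hx₂, rfl⟩⟩, ?_⟩
      exact hx₃
    have hz₁' : (V *ᵥ t) ∘ Sum.inl = B₁ *ᵥ (x ∘ Sum.inl) := by rw [← hz]; rfl
    have hz₂' : (V *ᵥ t) ∘ Sum.inr = B₂ *ᵥ (x ∘ Sum.inr) := by rw [← hz]; rfl
    have ht' : t ∘ Sum.inl = g := rfl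
    rw [mergeSol_mulVec, hz₁', hz₂', ht', ← hx₁, ← hx₂, e₁.mulVec_eq, e₂.mulVec_eq,
      Sum.elim_comp_inl_inr]

/-- The factors of `mergeSol` in reverse order. The transpose of the solution operator is used
because the neutered unions of the transposed matrix are not assumed to have low rank. -/
theorem mergeSol_transpose_mulVec [DecidableEq I₁] [DecidableEq I₂]
    (V : Matrix (R ⊕ R) ((I₁ ⊕ I₂) ⊕ R) K) (x₁ : J₁ → K) (x₂ : J₂ → K) :
    (mergeSol L₁ L₂ F₁ F₂ V)ᵀ *ᵥ Sum.elim x₁ x₂ =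
      Sum.elim (Sum.elim ((L₁ᵀ *ᵥ x₁) ∘ Sum.inl) ((L₂ᵀ *ᵥ x₂) ∘ Sum.inl)) (fun _ => 0) +
        Vᵀ *ᵥ Sum.elim
          ((L₁ᵀ *ᵥ x₁) ∘ Sum.inr - F₁ᵀ *ᵥ ((L₂ᵀ *ᵥ x₂) ∘ Sum.inl))
          ((L₂ᵀ *ᵥ x₂) ∘ Sum.inr - F₂ᵀ *ᵥ ((L₁ᵀ *ᵥ x₁) ∘ Sum.inl)) := by
  have p₁ : ∀ a : I₁ → K, (Matrix.fromCols (Matrix.fromCols (1 : Matrix I₁ I₁ K)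
      (0 : Matrix I₁ I₂ K)) (0 : Matrix I₁ R K))ᵀ *ᵥ a =
        Sum.elim (Sum.elim a (0 : I₂ → K)) (0 : R → K) := by
    intro a
    rw [Matrix.transpose_fromCols, Matrix.transpose_fromCols, Matrix.fromRows_mulVec,
      Matrix.fromRows_mulVec]
    simp
  have p₂ : ∀ a : I₂ → K, (Matrix.fromCols (Matrix.fromCols (0 : Matrix I₂ I₁ K)
      (1 : Matrix I₂ I₂ K)) (0 : Matrix I₂ R K))ᵀ *ᵥ a =
        Sum.elim (Sum.elim (0 : I₁ → K) a) (0 : R → K) := by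
    intro a
    rw [Matrix.transpose_fromCols, Matrix.transpose_fromCols, Matrix.fromRows_mulVec,
      Matrix.fromRows_mulVec]
    simp
  rw [mergeSol, Matrix.transpose_fromRows, Matrix.fromCols_mulVec, Sum.elim_comp_inl,
    Sum.elim_comp_inr, Matrix.transpose_mul, Matrix.transpose_mul, ← Matrix.mulVec_mulVec,
    ← Matrix.mulVec_mulVec, Matrix.transpose_mulVec_toRows, Matrix.transpose_mulVec_toRows,
    Matrix.transpose_mulVec_toRows, Sum.elim_comp_inl, Sum.elim_comp_inr]
  simp only [Matrix.toRows₁_fromRows, Matrix.toRows₂_fromRows, Matrix.transpose_sub,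
    Matrix.transpose_mul, Matrix.sub_mulVec, Matrix.mulVec_sub, ← Matrix.mulVec_mulVec, p₁, p₂]
  have e : (Sum.elim (Sum.elim ((L₁ᵀ *ᵥ x₁) ∘ Sum.inl) ((L₂ᵀ *ᵥ x₂) ∘ Sum.inl)) (fun _ => 0) :
      (I₁ ⊕ I₂) ⊕ R → K) = Sum.elim (Sum.elim ((L₁ᵀ *ᵥ x₁) ∘ Sum.inl) (0 : I₂ → K)) (0 : R → K) +
        Sum.elim (Sum.elim (0 : I₁ → K) ((L₂ᵀ *ᵥ x₂) ∘ Sum.inl)) (0 : R → K) := by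
    ext ((i | i) | i) <;> simp
  rw [e]
  abel

end Merge

end Elimination

/-! ### Nested row bases, costs, and fast solution operators -/

section HSS

variable {α : Type} {Θ K : Type*} [Field K]

/-- In addition to `Given`, the block columns below the vertices have rank at most `ρ` outside
their diagonal blocks; the matrix `N` contains the rows outside the block at the root. -/
inductive GivenHSS (ρ : ℕ) (st : KState Θ K) (m n : α → ℕ) :
    BlockTree α → ∀ (Ω I J : Type) [Fintype Ω] [Fintype I] [Fintype J],
      (Θ → Matrix Ω J K) → (Θ → Matrix I J K) → Prop
  | leaf {a : α} {Ω I J : Type} [Fintype Ω] [Fintype I] [Fintype J] {N : Θ → Matrix Ω J K}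
      {M : Θ → Matrix I J K} : Fintype.card I = m a → Fintype.card J = n a → st.KnownMat M →
      GivenHSS ρ st m n (.leaf a) Ω I J N M
  | node {l r : BlockTree α} {Ω I₁ I₂ J₁ J₂ : Type} [Fintype Ω] [Fintype I₁] [Fintype I₂]
      [Fintype J₁] [Fintype J₂] {N₁ : Θ → Matrix Ω J₁ K} {N₂ : Θ → Matrix Ω J₂ K}
      {A : Θ → Matrix I₁ J₁ K} {B : Θ → Matrix I₁ J₂ K} {C : Θ → Matrix I₂ J₁ K}
      {D : Θ → Matrix I₂ J₂ K} :
      GivenHSS ρ st m n l (Ω ⊕ I₂) I₁ J₁ (fun θ => Matrix.fromRows (N₁ θ) (C θ)) A →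
      GivenHSS ρ st m n r (Ω ⊕ I₁) I₂ J₂ (fun θ => Matrix.fromRows (N₂ θ) (B θ)) D →
      LowRank ρ st B → LowRank ρ st C →
      (∀ θ ∈ st.S, (Matrix.fromRows (N₁ θ) (C θ)).rank ≤ ρ) →
      (∀ θ ∈ st.S, (Matrix.fromRows (N₂ θ) (B θ)).rank ≤ ρ) →
      GivenHSS ρ st m n (.node l r) Ω (I₁ ⊕ I₂) (J₁ ⊕ J₂)
        (fun θ => Matrix.fromCols (N₁ θ) (N₂ θ))
        (fun θ => Matrix.fromBlocks (A θ) (B θ) (C θ) (D θ))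

/-- The number of equations that remain at a vertex after the elimination. -/
def elimRows (ρ : ℕ) (m n : α → ℕ) : BlockTree α → ℕ
  | .leaf a => (m a + ρ) - n a
  | .node l r => (elimRows ρ m n l + elimRows ρ m n r + ρ) - (ρ + ρ)

/-- The cost of the elimination. -/
def elimCost (ρ : ℕ) (m n : α → ℕ) : BlockTree α → ℕ
  | .leaf a => n a * (8 * ((m a + ρ) * (n a + (m a + ρ))))
  | .node l r =>
      (10 * ρ ^ 2 * (r.sum m + l.sum n) + 10 * ρ ^ 2 * (l.sum m + r.sum n)) +
      (elimCost ρ m n l + elimCost ρ m n r) +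
      (elimRows ρ m n l * ρ * (2 * l.sum m) + elimRows ρ m n r * ρ * (2 * r.sum m)) +
      (ρ + ρ) * (8 * ((elimRows ρ m n l + elimRows ρ m n r + ρ) *
        ((ρ + ρ) + ((l.sum m + r.sum m) + ρ))))

/-- The cost of a substitution after the elimination. -/
def solveCost (ρ : ℕ) (m n : α → ℕ) : BlockTree α → ℕ
  | .leaf a => n a * (2 * (m a + ρ))
  | .node l r => solveCost ρ m n l + solveCost ρ m n r +
      (4 * ρ * ((l.sum m + r.sum m) + ρ) + 2 * ρ * (l.sum m + r.sum m))

variable {ρ : ℕ} {st st' : KState Θ K} {m n : α → ℕ} {T : BlockTree α}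

theorem GivenHSS.card {Ω I J : Type} [Fintype Ω] [Fintype I] [Fintype J] {N : Θ → Matrix Ω J K}
    {M : Θ → Matrix I J K} (h : GivenHSS ρ st m n T Ω I J N M) :
    Fintype.card I = T.sum m ∧ Fintype.card J = T.sum n := by
  induction h with
  | leaf hI hJ hM => exact ⟨hI, hJ⟩
  | node _ _ _ _ _ _ ih₁ ih₂ =>
    simp only [Fintype.card_sum, BlockTree.sum]
    omega

namespace Reach

/-- Extend a basis of the row space of `N`, restricted to the columns at a child, to the
additional rows `C`. -/
theorem compress {Ω ι κ : Type*} [Fintype Ω] [Fintype ι] [Fintype κ] {C : Θ → Matrix ι κ K}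
    {B : Θ → Matrix (Fin ρ) κ K} {N : Θ → Matrix Ω κ K} (hC : LowRank ρ st C)
    (hB : st.KnownMat B) (hN : ∀ θ ∈ st.S, ∃ Z : Matrix (Fin ρ) Ω K, B θ = Z * N θ)
    (hR : ∀ θ ∈ st.S, (Matrix.fromRows (N θ) (C θ)).rank ≤ ρ) :
    Reach (fun st' => ∃ (B' : Θ → Matrix (Fin ρ) κ K) (X : Θ → Matrix (Fin ρ) (Fin ρ) K)
      (F : Θ → Matrix ι (Fin ρ) K), st'.KnownMat B' ∧ st'.KnownMat X ∧ st'.KnownMat F ∧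
        ∀ θ ∈ st'.S, B θ = X θ * B' θ ∧ C θ = F θ * B' θ ∧
          ∃ Z : Matrix (Fin ρ) (Ω ⊕ ι) K, B' θ = Z * Matrix.fromRows (N θ) (C θ))
      (10 * ρ ^ 2 * (Fintype.card ι + Fintype.card κ)) st := by
  obtain ⟨r, hr, F, H, hF, hH, hFH⟩ := hC
  have hrank : ∀ θ, (F θ).rank ≤ ρ := fun θ =>
    ((F θ).rank_le_card_width.trans (by simp)).trans hr
  set i := Fintype.card ι with hi
  set j := Fintype.card κ with hj
  have hi' : ρ * (4 * (i * r)) ≤ 4 * ρ ^ 2 * i := by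
    nlinarith [Nat.mul_le_mul_left (ρ * i) hr]
  have hj' : ρ * j * (2 * r) ≤ 2 * ρ ^ 2 * j := by
    nlinarith [Nat.mul_le_mul_left (ρ * j) hr]
  -- Rows of `H` may lie outside the row space of `C`. With `F = Y E` and `E = Z' F`, the rows of `E
  -- H = Z' C` span exactly that space.
  refine bind_le (c' := 2 * ρ ^ 2 * j + 8 * ρ ^ 2 * j + 2 * ρ ^ 2 * i)
    (rankFactor ρ hF fun θ _ => hrank θ) ?_ ?_
  · rw [Fintype.card_fin, ← hi]; nlinarith
  rintro st₁ h₁ ⟨Y, E, hY, hE, hYE⟩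
  refine bind_le (c' := 8 * ρ ^ 2 * j + 2 * ρ ^ 2 * i) (matMul hE (hH.mono h₁)) ?_
    fun st₂ h₂ hG => ?_
  · rw [Fintype.card_fin, Fintype.card_fin, ← hj]; linarith
  have h₀₂ := leTrans h₁ h₂
  -- The stacked matrix has its rows in the row space of `(N; C)`, hence rank at most `ρ`. It has
  -- only `2 * ρ` rows, so the rows in `Ω` cost nothing.
  refine bind_le (c' := 2 * ρ ^ 2 * i)
    (rankFactor ρ ((hB.mono h₀₂).fromRows hG) fun θ hθ => ?_) ?_ ?_
  · obtain ⟨Z, hZ⟩ := hN θ (h₀₂.1 hθ)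
    obtain ⟨-, Z', hZ'⟩ := hYE θ (h₂.1 hθ)
    have : Matrix.fromRows (B θ) (E θ * H θ) =
        Matrix.fromBlocks Z 0 0 Z' * Matrix.fromRows (N θ) (C θ) := by
      rw [Matrix.fromBlocks_mul_fromRows, hFH θ (h₀₂.1 hθ), hZ, ← Matrix.mul_assoc Z',
        ← hZ']
      simp
    rw [this]
    exact (Matrix.rank_mul_le_right _ _).trans (hR θ (h₀₂.1 hθ))
  · rw [Fintype.card_sum, Fintype.card_fin, ← hj]
    apply le_of_eq
    ring
  rintro st₃ h₃ ⟨Y', B', hY', hB', hYB'⟩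
  have h := matMul (hY.mono (leTrans h₂ h₃)) (hY'.submatrix Sum.inr id)
  rw [Fintype.card_fin, ← hi] at h
  refine (h.mono_cost (by apply le_of_eq; ring)).imp fun st₄ h₄ hF' => ?_
  refine ⟨B', fun θ => (Y' θ).submatrix Sum.inl id, _, hB'.mono h₄,
    (hY'.submatrix Sum.inl id).mono h₄, hF', fun θ hθ => ?_⟩
  have hθ₃ := h₄.1 hθ
  have hθ₂ := h₃.1 hθ₃
  have hθ₀ := h₀₂.1 hθ₂
  obtain ⟨h5, Z'', h6⟩ := hYB' θ hθ₃
  obtain ⟨h7, Z', hZ'⟩ := hYE θ (h₂.1 hθ₂)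
  obtain ⟨Z, hZ⟩ := hN θ hθ₀
  have e₁ : B θ = (Y' θ).submatrix Sum.inl id * B' θ := by
    ext a b
    exact congrFun (congrFun h5 (.inl a)) b
  have e₂ : E θ * H θ = (Y' θ).submatrix Sum.inr id * B' θ := by
    ext a b
    exact congrFun (congrFun h5 (.inr a)) b
  refine ⟨e₁, ?_, Z'' * Matrix.fromBlocks Z 0 0 Z', ?_⟩
  · rw [Matrix.mul_assoc, ← e₂, hFH θ hθ₀, ← Matrix.mul_assoc, ← h7]
  · rw [h6, Matrix.mul_assoc, Matrix.fromBlocks_mul_fromRows, hFH θ hθ₀, hZ, ← Matrix.mul_assoc Z',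
      ← hZ']
    simp

end Reach

section Merge

variable {I₁ I₂ J₁ J₂ : Type} [Fintype I₁] [Fintype I₂] [Fintype J₁] [Fintype J₂]
  [DecidableEq I₁] [DecidableEq I₂] {L₁ : Θ → Matrix J₁ (I₁ ⊕ Fin ρ) K}
  {L₂ : Θ → Matrix J₂ (I₂ ⊕ Fin ρ) K} {F₁ : Θ → Matrix I₂ (Fin ρ) K}
  {F₂ : Θ → Matrix I₁ (Fin ρ) K}
  {V : Θ → Matrix (Fin ρ ⊕ Fin ρ) ((I₁ ⊕ I₂) ⊕ Fin ρ) K} {c₁ c₂ : ℕ}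

open Reach

theorem fastMul_mergeSol (h₁ : FastMul st L₁ c₁) (h₂ : FastMul st L₂ c₂) (hF₁ : st.KnownMat F₁)
    (hF₂ : st.KnownMat F₂) (hV : st.KnownMat V) :
    FastMul st (fun θ => mergeSol (L₁ θ) (L₂ θ) (F₁ θ) (F₂ θ) (V θ))
      (c₁ + c₂ + (4 * ρ * ((Fintype.card I₁ + Fintype.card I₂) + ρ) +
        2 * ρ * (Fintype.card I₁ + Fintype.card I₂))) := by
  intro st' hs x hx
  set i₁ := Fintype.card I₁ with hi₁
  set i₂ := Fintype.card I₂ with hi₂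
  refine bind_le (mulVec (hV.mono hs) hx) (c' := c₁ + c₂ + 2 * ρ * (i₁ + i₂)) ?_
    fun st₁ hs₁ k₁ => ?_
  · simp only [Fintype.card_sum, Fintype.card_fin, ← hi₁, ← hi₂]
    have : (ρ + ρ) * (2 * (i₁ + i₂ + ρ) - 1) ≤ (ρ + ρ) * (2 * (i₁ + i₂ + ρ)) :=
      Nat.mul_le_mul_left _ (Nat.sub_le _ _)
    nlinarith
  have hs₀₁ := leTrans hs hs₁
  have hg := (hx.mono hs₁).comp Sum.inl
  have k₁₁ := k₁.comp Sum.inl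
  have k₁₂ := k₁.comp Sum.inr
  refine bind_le (sub_mulVec (hg.comp Sum.inl) (hF₂.mono hs₀₁) k₁₂)
    (c' := c₁ + c₂ + 2 * ρ * i₂) (by rw [Fintype.card_fin, ← hi₁]; nlinarith) fun st₂ hs₂ k₂ => ?_
  refine bind_le (sub_mulVec ((hg.comp Sum.inr).mono hs₂) ((hF₁.mono hs₀₁).mono hs₂)
    (k₁₁.mono hs₂)) (c' := c₁ + c₂) (by rw [Fintype.card_fin, ← hi₂]; nlinarith)
    fun st₃ hs₃ k₃ => ?_
  have hs₁₃ := leTrans hs₂ hs₃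
  refine bind_le (h₁ st₃ (leTrans hs₀₁ hs₁₃) _ ((k₂.mono hs₃).sumElim (k₁₁.mono hs₁₃)))
    (c' := c₂) le_rfl fun st₄ hs₄ k₄ => ?_
  have hs₁₄ := leTrans hs₁₃ hs₄
  refine (h₂ st₄ (leTrans hs₀₁ hs₁₄) _ ((k₃.mono hs₄).sumElim (k₁₂.mono hs₁₄))).imp
    fun st₅ hs₅ k₅ => ((k₄.mono hs₅).sumElim k₅).congr fun θ _ => ?_
  rw [mergeSol_mulVec]

theorem fastMul_mergeSol_transpose (h₁ : FastMul st (fun θ => (L₁ θ)ᵀ) c₁)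
    (h₂ : FastMul st (fun θ => (L₂ θ)ᵀ) c₂) (hF₁ : st.KnownMat F₁)
    (hF₂ : st.KnownMat F₂) (hV : st.KnownMat V) :
    FastMul st (fun θ => (mergeSol (L₁ θ) (L₂ θ) (F₁ θ) (F₂ θ) (V θ))ᵀ)
      (c₁ + c₂ + (4 * ρ * ((Fintype.card I₁ + Fintype.card I₂) + ρ) +
        2 * ρ * (Fintype.card I₁ + Fintype.card I₂))) := by
  intro st' hs x hx
  set i₁ := Fintype.card I₁ with hi₁
  set i₂ := Fintype.card I₂ with hi₂
  refine bind_le (h₁ st' hs _ (hx.comp Sum.inl)) (c' := c₂ + (4 * ρ * (i₁ + i₂ + ρ) +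
    2 * ρ * (i₁ + i₂))) (Nat.add_assoc _ _ _).ge fun st₁ hs₁ k₁ => ?_
  have hs₀₁ := leTrans hs hs₁
  refine bind_le (h₂ st₁ hs₀₁ _ ((hx.comp Sum.inr).mono hs₁)) (c' := 4 * ρ * (i₁ + i₂ + ρ) +
    2 * ρ * (i₁ + i₂)) le_rfl fun st₂ hs₂ k₂ => ?_
  have hs₀₂ := leTrans hs₀₁ hs₂
  have k₁ := k₁.mono hs₂
  have k₁₁ := k₁.comp Sum.inl
  have k₁₂ := k₁.comp Sum.inr
  have k₂₁ := k₂.comp Sum.inl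
  have k₂₂ := k₂.comp Sum.inr
  refine bind_le (sub_mulVec k₁₂ (hF₁.mono hs₀₂).transpose k₂₁)
    (c' := 4 * ρ * (i₁ + i₂ + ρ) + 2 * ρ * i₁) (by rw [Fintype.card_fin, ← hi₂]; nlinarith)
    fun st₃ hs₃ k₃ => ?_
  refine bind_le (sub_mulVec (k₂₂.mono hs₃) ((hF₂.mono hs₀₂).mono hs₃).transpose (k₁₁.mono hs₃))
    (c' := 4 * ρ * (i₁ + i₂ + ρ)) (by rw [Fintype.card_fin, ← hi₁]; nlinarith)
    fun st₄ hs₄ k₄ => ?_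
  have hs₂₄ := leTrans hs₃ hs₄
  refine ((add_mulVec (((k₁₁.sumElim k₂₁).sumElim
      (x := fun _ => Sum.elim _ _) (y := fun _ _ => (0 : K)) fun _ => known_const _ 0).mono hs₂₄)
    ((hV.mono hs₀₂).mono hs₂₄).transpose ((k₃.mono hs₄).sumElim k₄)).mono_cost ?_).imp
    fun st₅ hs₅ k₅ => k₅.congr fun θ _ => ?_
  · simp only [Fintype.card_sum, Fintype.card_fin, ← hi₁, ← hi₂]
    apply le_of_eq
    ring
  · conv_rhs => rw [← Sum.elim_comp_inl_inr (x θ), mergeSol_transpose_mulVec]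

end Merge

end HSS

/-! ### The elimination along the tree and its feasibility -/

section HSS

variable {α : Type} {Θ K : Type*} [Field K] {ρ : ℕ} {st st' : KState Θ K} {m n : α → ℕ}
  {T : BlockTree α}

theorem Matrix.mulVec_eq_zero_of_eq_mul {Ω J R : Type*} [Fintype J] [Fintype R]
    {N : Matrix Ω J K} {B : Matrix R J K} (h : ∃ Y : Matrix Ω R K, N = Y * B)
    {x : J → K} (hx : B *ᵥ x = 0) :
    N *ᵥ x = 0 := by
  obtain ⟨Y, rfl⟩ := h
  rw [← Matrix.mulVec_mulVec, hx, Matrix.mulVec_zero]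

/-- From the equations for `(M x, B x)` one obtains the description of a block at a leaf. -/
theorem isElim_leaf {I J R P : Type*} [Fintype I] [Fintype J] [Fintype R] [DecidableEq I]
    [DecidableEq R] {M : Matrix I J K} {B : Matrix R J K} {V : Matrix J (I ⊕ R) K}
    {W : Matrix P (I ⊕ R) K}
    (h : ∀ z t, Matrix.fromRows M B *ᵥ z + (-1 : Matrix (I ⊕ R) (I ⊕ R) K) *ᵥ t = 0 ↔
      z = V *ᵥ t ∧ W *ᵥ t = 0) : IsElim M B W V := by
  have h' : ∀ z g y, M *ᵥ z = g ∧ B *ᵥ z = y ↔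
      z = V *ᵥ Sum.elim g y ∧ W *ᵥ Sum.elim g y = 0 := by
    intro z g y
    rw [← h, Matrix.neg_mulVec, Matrix.one_mulVec, ← sub_eq_add_neg, sub_eq_zero,
      Matrix.fromRows_mulVec, Sum.elim_eq_iff]
  refine ⟨fun g y => ?_, fun x => (((h' x _ _).1 ⟨rfl, rfl⟩).1).symm⟩
  simp only [h']
  exact ⟨fun hw => ⟨_, rfl, hw⟩, fun ⟨_, _, hw⟩ => hw⟩

open Reach in
/-- The elimination along the tree, which prepares fast products with the solution operator and
with its transpose. -/
theorem GivenHSS.elim {Ω I J : Type} [Fintype Ω] [Fintype I] [Fintype J] {N : Θ → Matrix Ω J K}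
    {M : Θ → Matrix I J K} (h : GivenHSS ρ st m n T Ω I J N M) :
    ∀ st', st ≤ st' → ∀ B : Θ → Matrix (Fin ρ) J K, st'.KnownMat B →
      (∀ θ ∈ st'.S, (∃ Y : Matrix Ω (Fin ρ) K, N θ = Y * B θ) ∧
        (∃ Z : Matrix (Fin ρ) Ω K, B θ = Z * N θ) ∧
        ∀ x, M θ *ᵥ x = 0 → N θ *ᵥ x = 0 → x = 0) →
      Reach (fun st'' => ∃ (W : Θ → Matrix (Fin (elimRows ρ m n T)) (I ⊕ Fin ρ) K)
        (L : Θ → Matrix J (I ⊕ Fin ρ) K), st''.KnownMat W ∧ FastMul st'' L (solveCost ρ m n T) ∧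
          FastMul st'' (fun θ => (L θ)ᵀ) (solveCost ρ m n T) ∧
          ∀ θ ∈ st''.S, IsElim (M θ) (B θ) (W θ) (L θ))
        (elimCost ρ m n T) st' := by
  classical
  induction h with
  | @leaf a Ω I J _ _ _ N M hI hJ hM =>
    intro st₀ hs₀ B hB hyp
    have hneg : st₀.KnownMat fun _ => (-1 : Matrix (I ⊕ Fin ρ) (I ⊕ Fin ρ) K) :=
      fun _ _ => known_const _ _
    refine ((eliminate ((hM.mono hs₀).fromRows hB) hneg (fun θ hθ z hz => ?_)
      (elimRows ρ m n (.leaf a)) ?_).imp ?_).mono_cost ?_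
    · obtain ⟨hY, -, hinj⟩ := hyp θ hθ
      rw [Matrix.fromRows_mulVec] at hz
      have h₁ : M θ *ᵥ z = 0 := funext fun i => congrFun hz (.inl i)
      have h₂ : B θ *ᵥ z = 0 := funext fun i => congrFun hz (.inr i)
      exact hinj z h₁ (Matrix.mulVec_eq_zero_of_eq_mul hY h₂)
    · rw [Fintype.card_sum, Fintype.card_fin, hI, hJ, elimRows]
    · rintro st₁ hs₁ ⟨V, W, hV, hW, hVW⟩
      refine ⟨W, V, hW, fun st₂ hs₂ x hx => ?_, fun st₂ hs₂ x hx => ?_, fun θ hθ =>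
        isElim_leaf (hVW θ hθ)⟩
      · refine (mulVec (hV.mono hs₂) hx).mono_cost ?_
        rw [Fintype.card_sum, Fintype.card_fin, hI, hJ]
        exact Nat.mul_le_mul_left _ (Nat.sub_le _ _)
      · refine (mulVec (hV.mono hs₂).transpose hx).mono_cost ?_
        rw [Fintype.card_sum, Fintype.card_fin, hI, hJ, solveCost]
        calc (m a + ρ) * (2 * n a - 1) ≤ (m a + ρ) * (2 * n a) :=
              Nat.mul_le_mul_left _ (Nat.sub_le _ _)
          _ = n a * (2 * (m a + ρ)) := by ring
    · rw [Fintype.card_sum, Fintype.card_fin, hI, hJ, elimCost]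
  | @node l r Ω I₁ I₂ J₁ J₂ _ _ _ _ _ N₁ N₂ A B C D h₁ h₂ hB hC hR₁ hR₂ ih₁ ih₂ =>
    intro st₀ hs₀ E hE hyp
    obtain ⟨cI₁, cJ₁⟩ := h₁.card
    obtain ⟨cI₂, cJ₂⟩ := h₂.card
    have hE₁ : st₀.KnownMat fun θ => (E θ).toCols₁ := fun i j => hE i (.inl j)
    have hE₂ : st₀.KnownMat fun θ => (E θ).toCols₂ := fun i j => hE i (.inr j)
    set p₁ := elimRows ρ m n l with hp₁
    set p₂ := elimRows ρ m n r with hp₂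
    refine bind_le (compress (hC.mono hs₀) hE₁ (N := N₁) (fun θ hθ => ?_)
      fun θ hθ => hR₁ θ (hs₀.1 hθ)) (c' := 10 * ρ ^ 2 * (l.sum m + r.sum n) +
      (elimCost ρ m n l + elimCost ρ m n r) +
      (p₁ * ρ * (2 * l.sum m) + p₂ * ρ * (2 * r.sum m)) +
      (ρ + ρ) * (8 * ((p₁ + p₂ + ρ) * ((ρ + ρ) + ((l.sum m + r.sum m) + ρ))))) ?_ ?_
    · obtain ⟨-, ⟨Z, hZ⟩, -⟩ := hyp θ hθ
      refine ⟨Z, ?_⟩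
      ext i j
      exact congrFun (congrFun hZ i) (.inl j)
    · rw [cI₂, cJ₁, elimCost]
      apply le_of_eq
      ring
    rintro st₁ hs₁ ⟨B₁, X₁, F₁, hB₁, hX₁, hF₁, hc₁⟩
    refine bind_le (compress (hB.mono (leTrans hs₀ hs₁)) (hE₂.mono hs₁) (N := N₂)
      (fun θ hθ => ?_) fun θ hθ => hR₂ θ (hs₀.1 (hs₁.1 hθ))) (c' :=
      (elimCost ρ m n l + elimCost ρ m n r) +
      (p₁ * ρ * (2 * l.sum m) + p₂ * ρ * (2 * r.sum m)) +
      (ρ + ρ) * (8 * ((p₁ + p₂ + ρ) * ((ρ + ρ) + ((l.sum m + r.sum m) + ρ))))) ?_ ?_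
    · obtain ⟨-, ⟨Z, hZ⟩, -⟩ := hyp θ (hs₁.1 hθ)
      refine ⟨Z, ?_⟩
      ext i j
      exact congrFun (congrFun hZ i) (.inr j)
    · rw [cI₁, cJ₂]
      apply le_of_eq
      ring
    rintro st₂ hs₂ ⟨B₂, X₂, F₂, hB₂, hX₂, hF₂, hc₂⟩
    have hs₀₂ := leTrans hs₁ hs₂
    have hEX : ∀ θ ∈ st₂.S, E θ = Matrix.fromCols (X₁ θ * B₁ θ) (X₂ θ * B₂ θ) := by
      intro θ hθ
      rw [← (hc₁ θ (hs₂.1 hθ)).1, ← (hc₂ θ hθ).1, Matrix.fromCols_toCols]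
    refine bind_le (ih₁ st₂ (leTrans hs₀ hs₀₂) B₁ (hB₁.mono hs₂) fun θ hθ => ?_) (c' :=
      elimCost ρ m n r +
      (p₁ * ρ * (2 * l.sum m) + p₂ * ρ * (2 * r.sum m)) +
      (ρ + ρ) * (8 * ((p₁ + p₂ + ρ) * ((ρ + ρ) + ((l.sum m + r.sum m) + ρ))))) ?_ ?_
    -- The outside rows of the left child are those of the parent, `Y X₁ B₁`, and `C = F₁ B₁`.
    -- Injectivity is inherited by extending vectors by zero, with `C` now counted among the outside
    -- rows.
    · obtain ⟨⟨Y, hY⟩, -, hinj⟩ := hyp θ (hs₀₂.1 hθ)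
      obtain ⟨e₁, e₂, e₃⟩ := hc₁ θ (hs₂.1 hθ)
      refine ⟨⟨Matrix.fromRows (Y * X₁ θ) (F₁ θ), ?_⟩, e₃, fun x hx hNx => ?_⟩
      · have e₄ : N₁ θ = Y * (E θ).toCols₁ := by
          ext i j
          exact congrFun (congrFun hY i) (.inl j)
        change Matrix.fromRows (N₁ θ) (C θ) = _
        rw [Matrix.fromRows_mul, ← e₂, Matrix.mul_assoc, ← e₁, ← e₄]
      · rw [Matrix.fromRows_mulVec] at hNx
        have n₁ : N₁ θ *ᵥ x = 0 := funext fun i => congrFun hNx (.inl i)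
        have n₂ : C θ *ᵥ x = 0 := funext fun i => congrFun hNx (.inr i)
        have := hinj (Sum.elim x 0) (by
          rw [Matrix.fromBlocks_mulVec]
          ext (i | i) <;> simp [hx, n₂]) (by
          rw [Matrix.fromCols_mulVec]
          simp [n₁])
        exact funext fun i => congrFun this (.inl i)
    · apply le_of_eq
      ring
    rintro st₃ hs₃ ⟨W₁, L₁, hW₁, hL₁, hLt₁, he₁⟩
    have hs₀₃ := leTrans hs₀₂ hs₃
    refine bind_le (ih₂ st₃ (leTrans hs₀ hs₀₃) B₂ (hB₂.mono hs₃) fun θ hθ => ?_) (c' :=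
      (p₁ * ρ * (2 * l.sum m) + p₂ * ρ * (2 * r.sum m)) +
      (ρ + ρ) * (8 * ((p₁ + p₂ + ρ) * ((ρ + ρ) + ((l.sum m + r.sum m) + ρ))))) ?_ ?_
    · obtain ⟨⟨Y, hY⟩, -, hinj⟩ := hyp θ (hs₀₃.1 hθ)
      obtain ⟨e₁, e₂, e₃⟩ := hc₂ θ (hs₃.1 hθ)
      refine ⟨⟨Matrix.fromRows (Y * X₂ θ) (F₂ θ), ?_⟩, e₃, fun x hx hNx => ?_⟩
      · have e₄ : N₂ θ = Y * (E θ).toCols₂ := by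
          ext i j
          exact congrFun (congrFun hY i) (.inr j)
        change Matrix.fromRows (N₂ θ) (B θ) = _
        rw [Matrix.fromRows_mul, ← e₂, Matrix.mul_assoc, ← e₁, ← e₄]
      · rw [Matrix.fromRows_mulVec] at hNx
        have n₁ : N₂ θ *ᵥ x = 0 := funext fun i => congrFun hNx (.inl i)
        have n₂ : B θ *ᵥ x = 0 := funext fun i => congrFun hNx (.inr i)
        have := hinj (Sum.elim 0 x) (by
          rw [Matrix.fromBlocks_mulVec]
          ext (i | i) <;> simp [hx, n₂]) (by
          rw [Matrix.fromCols_mulVec]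
          simp [n₁])
        exact funext fun i => congrFun this (.inr i)
    · apply le_of_eq
      ring
    rintro st₄ hs₄ ⟨W₂, L₂, hW₂, hL₂, hLt₂, he₂⟩
    have hs₂₄ := leTrans hs₃ hs₄
    have hs₁₄ := leTrans hs₂ hs₂₄
    have hs₀₄ := leTrans hs₁ hs₁₄
    have hF₁₄ := hF₁.mono hs₁₄
    have hF₂₄ := hF₂.mono hs₂₄
    have hW₁₄ := hW₁.mono hs₄
    have hP₁ : st₄.KnownMat fun θ => (W₁ θ).toCols₁ := fun i j => hW₁₄ i (.inl j)
    have hT₁ : st₄.KnownMat fun θ => (W₁ θ).toCols₂ := fun i j => hW₁₄ i (.inr j)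
    have hP₂ : st₄.KnownMat fun θ => (W₂ θ).toCols₁ := fun i j => hW₂ i (.inl j)
    have hT₂ : st₄.KnownMat fun θ => (W₂ θ).toCols₂ := fun i j => hW₂ i (.inr j)
    -- These two products are the only entries of `mergeMatrix` not yet available.
    refine bind_le (neg_matMul hP₁ hF₂₄) (c' := p₂ * ρ * (2 * r.sum m) +
      (ρ + ρ) * (8 * ((p₁ + p₂ + ρ) * ((ρ + ρ) + ((l.sum m + r.sum m) + ρ)))))
      (by rw [Fintype.card_fin, Fintype.card_fin, cI₁]; apply le_of_eq; ring) fun st₅ hs₅ hG₁ => ?_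
    refine bind_le (neg_matMul (hP₂.mono hs₅) (hF₁₄.mono hs₅)) (c' :=
      (ρ + ρ) * (8 * ((p₁ + p₂ + ρ) * ((ρ + ρ) + ((l.sum m + r.sum m) + ρ)))))
      (by rw [Fintype.card_fin, Fintype.card_fin, cI₂]) fun st₆ hs₆ hG₂ => ?_
    have hs₄₆ := leTrans hs₅ hs₆
    have hs₀₆ := leTrans hs₀₄ hs₄₆
    have he : ∀ θ ∈ st₆.S, IsElim (A θ) (B₁ θ) (W₁ θ) (L₁ θ) ∧
        IsElim (D θ) (B₂ θ) (W₂ θ) (L₂ θ) ∧ B θ = F₂ θ * B₂ θ ∧ C θ = F₁ θ * B₁ θ ∧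
        E θ = Matrix.fromCols (X₁ θ * B₁ θ) (X₂ θ * B₂ θ) := fun θ hθ =>
      ⟨he₁ θ (hs₄.1 (hs₄₆.1 hθ)), he₂ θ (hs₄₆.1 hθ), (hc₂ θ (hs₂₄.1 (hs₄₆.1 hθ))).2.1,
        (hc₁ θ (hs₁₄.1 (hs₄₆.1 hθ))).2.1, hEX θ (hs₂₄.1 (hs₄₆.1 hθ))⟩
    have hA' : st₆.KnownMat fun θ =>
        mergeMatrix (W₁ θ) (W₂ θ) (F₁ θ) (F₂ θ) (X₁ θ) (X₂ θ) :=
      ((hT₁.mono hs₄₆).fromBlocks (hG₁.mono hs₆) hG₂ (hT₂.mono hs₄₆)).fromRows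
        ((hX₁.mono (leTrans hs₁₄ hs₄₆)).fromCols (hX₂.mono (leTrans hs₂₄ hs₄₆)))
    have zero : ∀ {X Y : Type} (Q : Matrix X Y K), st₆.KnownMat fun _ => Q :=
      fun _ _ _ => known_const _ _
    have hU : st₆.KnownMat fun θ => mergeRhs (W₁ θ) (W₂ θ) :=
      ((hP₁.mono hs₄₆).fromBlocks (zero _) (zero _) (hP₂.mono hs₄₆)).fromBlocks (zero _) (zero _)
        (zero _)
    refine ((eliminate hA' hU (fun θ hθ z hz => ?_) (elimRows ρ m n (.node l r)) ?_).imp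
      ?_).mono_cost ?_
    · obtain ⟨hY, -, hinj⟩ := hyp θ (hs₀₆.1 hθ)
      obtain ⟨q₁, q₂, q₃, q₄, q₅⟩ := he θ hθ
      exact q₁.mergeMatrix_injective q₂ q₃ q₄ q₅ (fun x hx hEx =>
        hinj x hx (Matrix.mulVec_eq_zero_of_eq_mul hY hEx)) z hz
    · simp only [Fintype.card_sum, Fintype.card_fin, elimRows, hp₁, hp₂]
    · rintro st₇ hs₇ ⟨V, W, hV, hW, hVW⟩
      have hs₄₇ := leTrans hs₄₆ hs₇
      refine ⟨W, fun θ => mergeSol (L₁ θ) (L₂ θ) (F₁ θ) (F₂ θ) (V θ), hW, ?_, ?_,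
        fun θ hθ => ?_⟩
      · have := fastMul_mergeSol (hL₁.mono (leTrans hs₄ hs₄₇)) (hL₂.mono hs₄₇) (hF₁₄.mono hs₄₇)
          (hF₂₄.mono hs₄₇) hV
        rwa [cI₁, cI₂] at this
      · have := fastMul_mergeSol_transpose (hLt₁.mono (leTrans hs₄ hs₄₇)) (hLt₂.mono hs₄₇)
          (hF₁₄.mono hs₄₇) (hF₂₄.mono hs₄₇) hV
        rwa [cI₁, cI₂] at this
      · obtain ⟨q₁, q₂, q₃, q₄, q₅⟩ := he θ (hs₇.1 hθ)
        exact q₁.merge q₂ q₃ q₄ q₅ (hVW θ hθ)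
    · simp only [Fintype.card_sum, Fintype.card_fin, cI₁, cI₂, hp₁, hp₂, le_refl]

/-- All equations of the elimination fit: no vertex has more columns than equations. -/
def BlockTree.Feasible (ρ : ℕ) (m n : α → ℕ) : BlockTree α → Prop
  | .leaf a => n a ≤ m a + ρ
  | .node l r => l.Feasible ρ m n ∧ r.Feasible ρ m n ∧ l.sum n + r.sum n ≤ l.sum m + r.sum m + ρ

/-- The map `x ↦ (M x, N x)` is injective into the product of `I → K` with the range of `N`. -/
theorem Matrix.card_le_of_injective_of_rank_le {Ω I J : Type*} [Fintype Ω] [Fintype I] [Fintype J]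
    {N : Matrix Ω J K} {M : Matrix I J K} (hinj : ∀ x, M *ᵥ x = 0 → N *ᵥ x = 0 → x = 0)
    (hR : N.rank ≤ ρ) : Fintype.card J ≤ Fintype.card I + ρ := by
  let f : (J → K) →ₗ[K] (I → K) × LinearMap.range N.mulVecLin :=
    M.mulVecLin.prod N.mulVecLin.rangeRestrict
  have hf : Function.Injective f := by
    refine (injective_iff_map_eq_zero _).2 fun x hx => ?_
    rw [Prod.ext_iff] at hx
    exact hinj x hx.1 (congrArg Subtype.val hx.2)
  have := LinearMap.finrank_le_finrank_of_injective hf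
  rw [Module.finrank_prod, Module.finrank_fintype_fun_eq_card,
    Module.finrank_fintype_fun_eq_card] at this
  exact this.trans (Nat.add_le_add_left hR _)

/-- Injectivity of the block column passes to the children on extending vectors by zero, so a single
instance settles the sizes at all vertices. -/
theorem GivenHSS.feasible {Ω I J : Type} [Fintype Ω] [Fintype I] [Fintype J]
    {N : Θ → Matrix Ω J K} {M : Θ → Matrix I J K} (h : GivenHSS ρ st m n T Ω I J N M) {θ : Θ}
    (hθ : θ ∈ st.S) (hinj : ∀ x, M θ *ᵥ x = 0 → N θ *ᵥ x = 0 → x = 0) (hR : (N θ).rank ≤ ρ) :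
    T.Feasible ρ m n := by
  induction h with
  | @leaf a Ω I J _ _ _ N M hI hJ hM =>
    have := Matrix.card_le_of_injective_of_rank_le hinj hR
    rwa [hI, hJ] at this
  | @node l r Ω I₁ I₂ J₁ J₂ _ _ _ _ _ N₁ N₂ A B C D h₁ h₂ hB hC hR₁ hR₂ ih₁ ih₂ =>
    have := Matrix.card_le_of_injective_of_rank_le hinj hR
    simp only [Fintype.card_sum, h₁.card, h₂.card] at this
    refine ⟨ih₁ (fun x hx hNx => ?_) (hR₁ θ hθ), ih₂ (fun x hx hNx => ?_) (hR₂ θ hθ), this⟩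
    · rw [Matrix.fromRows_mulVec] at hNx
      have n₁ : N₁ θ *ᵥ x = 0 := funext fun i => congrFun hNx (.inl i)
      have n₂ : C θ *ᵥ x = 0 := funext fun i => congrFun hNx (.inr i)
      have := hinj (Sum.elim x 0) (by
        rw [Matrix.fromBlocks_mulVec]
        ext (i | i) <;> simp [hx, n₂]) (by
        rw [Matrix.fromCols_mulVec]
        simp [n₁])
      exact funext fun i => congrFun this (.inl i)
    · rw [Matrix.fromRows_mulVec] at hNx
      have n₁ : N₂ θ *ᵥ x = 0 := funext fun i => congrFun hNx (.inl i)
      have n₂ : B θ *ᵥ x = 0 := funext fun i => congrFun hNx (.inr i)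
      have := hinj (Sum.elim 0 x) (by
        rw [Matrix.fromBlocks_mulVec]
        ext (i | i) <;> simp [hx, n₂]) (by
        rw [Matrix.fromCols_mulVec]
        simp [n₁])
      exact funext fun i => congrFun this (.inr i)

end HSS

/-! ### Estimates for the cost of elimination and substitution -/

section CostBounds

variable {α : Type} {ρ : ℕ} {m n : α → ℕ}

namespace BlockTree

/-- Feasibility makes the truncated subtractions in `elimRows` exact. -/
theorem Feasible.elimRows_add {T : BlockTree α} (h : T.Feasible ρ m n) :
    elimRows ρ m n T + T.sum n = T.sum m + ρ := by
  induction T with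
  | leaf a =>
    have : n a ≤ m a + ρ := h
    simp only [elimRows, BlockTree.sum]
    omega
  | node l r hl hr =>
    obtain ⟨h₁, h₂, h₃⟩ := h
    have := hl h₁
    have := hr h₂
    simp only [elimRows, BlockTree.sum]
    omega

/-- Each child contributes its own `ρ`, the parent only one. This recursion drives all estimates
below. -/
theorem Feasible.elimRows_children {l r : BlockTree α} (h : (node l r).Feasible ρ m n) :
    elimRows ρ m n l + elimRows ρ m n r = elimRows ρ m n (.node l r) + ρ := by
  have h₁ := h.elimRows_add
  have h₂ := h.1.elimRows_add
  have h₃ := h.2.1.elimRows_add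
  simp only [BlockTree.sum] at h₁
  omega

/-- The number of leaves. -/
def leaves (T : BlockTree α) : ℕ := T.sum fun _ => 1

/-- The sum of the cubes of the numbers of remaining equations over all vertices. -/
def cubeSum (ρ : ℕ) (m n : α → ℕ) : BlockTree α → ℕ
  | leaf a => elimRows ρ m n (leaf a) ^ 3
  | node l r => elimRows ρ m n (node l r) ^ 3 + cubeSum ρ m n l + cubeSum ρ m n r

/-- The sum of the products of the numbers of remaining equations and of columns. -/
def crossSum (ρ : ℕ) (m n : α → ℕ) : BlockTree α → ℕ
  | leaf a => elimRows ρ m n (leaf a) * n a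
  | node l r =>
      elimRows ρ m n (node l r) * (l.sum n + r.sum n) + crossSum ρ m n l + crossSum ρ m n r

theorem mul_sq_le_cube_add_cube (x y : ℕ) : x * y ^ 2 ≤ x ^ 3 + y ^ 3 := by
  rcases le_total x y with h | h
  · calc x * y ^ 2 ≤ y * y ^ 2 := Nat.mul_le_mul_right _ h
      _ = y ^ 3 := by ring
      _ ≤ _ := Nat.le_add_left _ _
  · calc x * y ^ 2 ≤ x * x ^ 2 := Nat.mul_le_mul_left _ (Nat.pow_le_pow_left h 2)
      _ = x ^ 3 := by ring
      _ ≤ _ := Nat.le_add_right _ _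

/-- In the expanded costs of the inner vertices everything except `ρ E N` and `ρ² N` is absorbed
into cubes of `E` and `ρ`. The summand `218 * ρ ^ 3` on the left reflects that there is one inner
vertex fewer than there are leaves. -/
theorem Feasible.cost_le {T : BlockTree α} (h : T.Feasible ρ m n) :
    elimCost ρ m n T + solveCost ρ m n T + 218 * ρ ^ 3 ≤
      60 * T.sum (fun a => n a ^ 3) + 116 * cubeSum ρ m n T + 60 * (ρ ^ 2 * T.sum n * T.height) +
        18 * (ρ * crossSum ρ m n T) + 218 * (ρ ^ 3 * T.leaves) := by
  induction T with
  | leaf a =>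
    have h₁ := h.elimRows_add
    simp only [elimCost, solveCost, BlockTree.sum, cubeSum, height, leaves] at *
    set E := elimRows ρ m n (leaf a)
    rw [← h₁]
    have e₁ := mul_sq_le_cube_add_cube (n a) E
    have e₂ := mul_sq_le_cube_add_cube E (n a)
    have e₃ : n a ^ 2 ≤ n a ^ 3 := by
      rw [pow_succ _ 2]
      rcases Nat.eq_zero_or_pos (n a) with h0 | h0
      · simp [h0]
      · exact Nat.le_mul_of_pos_right _ h0
    have e₄ : E ≤ E ^ 2 := Nat.le_self_pow (by norm_num) _
    have e₅ : n a * E ≤ n a * E ^ 2 := Nat.mul_le_mul_left _ e₄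
    nlinarith
  | node l r hl hr =>
    have hl := hl h.1
    have hr := hr h.2.1
    have h₁ := h.elimRows_add
    have h₂ := h.elimRows_children
    simp only [elimCost, solveCost, BlockTree.sum, cubeSum, crossSum, height, leaves] at *
    set E := elimRows ρ m n (node l r)
    set p₁ := elimRows ρ m n l
    set p₂ := elimRows ρ m n r
    set M := l.sum m + r.sum m with hM
    set N := l.sum n + r.sum n with hN
    have hmN : M ≤ N + E := by omega
    have hh : ρ ^ 2 * l.sum n * l.height + ρ ^ 2 * r.sum n * r.height + ρ ^ 2 * N ≤
        ρ ^ 2 * N * (max l.height r.height + 1) := by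
      have h1 := Nat.mul_le_mul_left (ρ ^ 2 * l.sum n) (le_max_left l.height r.height)
      have h2 := Nat.mul_le_mul_left (ρ ^ 2 * r.sum n) (le_max_right l.height r.height)
      rw [hN]
      nlinarith
    have c₁ : 10 * ρ ^ 2 * (r.sum m + l.sum n) + 10 * ρ ^ 2 * (l.sum m + r.sum n) ≤
        10 * ρ ^ 2 * (2 * N + E) := by
      rw [← mul_add]
      exact Nat.mul_le_mul_left _ (by omega)
    have c₂ : p₁ * ρ * (2 * l.sum m) + p₂ * ρ * (2 * r.sum m) ≤ 2 * ρ * ((E + ρ) * (N + E)) := by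
      have hp₁ : p₁ ≤ E + ρ := by omega
      have hp₂ : p₂ ≤ E + ρ := by omega
      calc p₁ * ρ * (2 * l.sum m) + p₂ * ρ * (2 * r.sum m)
          ≤ (E + ρ) * ρ * (2 * l.sum m) + (E + ρ) * ρ * (2 * r.sum m) := by gcongr
        _ = 2 * ρ * ((E + ρ) * M) := by rw [hM]; ring
        _ ≤ _ := by gcongr
    have c₃ : (ρ + ρ) * (8 * ((p₁ + p₂ + ρ) * ((ρ + ρ) + (M + ρ)))) ≤
        16 * ρ * ((E + 2 * ρ) * (N + E + 3 * ρ)) := by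
      have : p₁ + p₂ + ρ = E + 2 * ρ := by omega
      rw [this]
      calc (ρ + ρ) * (8 * ((E + 2 * ρ) * ((ρ + ρ) + (M + ρ))))
          = 16 * ρ * ((E + 2 * ρ) * (M + 3 * ρ)) := by ring
        _ ≤ _ := by gcongr
    have c₄ : 4 * ρ * (M + ρ) + 2 * ρ * M ≤ 6 * ρ ^ 2 * (N + E + ρ) := by
      have : ρ ≤ ρ ^ 2 := Nat.le_self_pow (by norm_num) _
      calc 4 * ρ * (M + ρ) + 2 * ρ * M ≤ 6 * ρ * (M + ρ) := by nlinarith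
        _ ≤ _ := by gcongr
    have e₁ := mul_sq_le_cube_add_cube ρ E
    have e₂ := mul_sq_le_cube_add_cube E ρ
    clear_value E p₁ p₂ M N
    zify at *
    ring_nf at *
    linarith

/-- The cubes at the children add up to at most `(E + ρ)³ ≤ (3/2) E³ + 32 ρ³`. The rate `7/4` lies
above `3/2`, to pay for the vertex itself, and below `2`, so that the number of leaves dominates.
The constant `512` solves `4 * 32 - 2 * 512 = -512 * (7/4)`. -/
theorem Feasible.cubeSum_le {T : BlockTree α} (h : T.Feasible ρ m n) (H : ℕ)
    (hH : T.height ≤ H) :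
    (cubeSum ρ m n T : ℝ) ≤ 4 * (7 / 4) ^ H * (elimRows ρ m n T : ℝ) ^ 3 +
      512 * (2 ^ H - (7 / 4) ^ H) * (ρ : ℝ) ^ 3 := by
  induction T generalizing H with
  | leaf a =>
    simp only [cubeSum, Nat.cast_pow]
    have h1 : (1 : ℝ) ≤ (7 / 4) ^ H := one_le_pow₀ (by norm_num)
    have h2 : ((7 : ℝ) / 4) ^ H ≤ 2 ^ H := pow_le_pow_left₀ (by norm_num) (by norm_num) _
    have h3 : 0 ≤ (2 ^ H - (7 / 4) ^ H) * (ρ : ℝ) ^ 3 :=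
      mul_nonneg (by linarith) (by positivity)
    have h4 : (0 : ℝ) ≤ (elimRows ρ m n (leaf a) : ℝ) ^ 3 := by positivity
    nlinarith
  | node l r hl hr =>
    obtain ⟨H, rfl⟩ : ∃ H', H = H' + 1 := ⟨H - 1, by simp only [height] at hH; omega⟩
    simp only [height] at hH
    have hl := hl h.1 H (by omega)
    have hr := hr h.2.1 H (by omega)
    have hc := h.elimRows_children
    simp only [cubeSum, Nat.cast_add, Nat.cast_pow]
    have hc' : (elimRows ρ m n l : ℝ) + elimRows ρ m n r = elimRows ρ m n (node l r) + ρ := by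
      exact_mod_cast hc
    set E : ℝ := (elimRows ρ m n (node l r) : ℝ)
    set x : ℝ := (elimRows ρ m n l : ℝ)
    set y : ℝ := (elimRows ρ m n r : ℝ)
    have hE : 0 ≤ E := Nat.cast_nonneg _
    have hx : 0 ≤ x := Nat.cast_nonneg _
    have hy : 0 ≤ y := Nat.cast_nonneg _
    have hρ : (0 : ℝ) ≤ ρ := Nat.cast_nonneg _
    have h1 : x ^ 3 + y ^ 3 ≤ (E + ρ) ^ 3 := by
      rw [← hc']
      nlinarith [mul_nonneg (mul_nonneg hx hy) (add_nonneg hx hy)]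
    have h2 : (E + ρ) ^ 3 ≤ 3 / 2 * E ^ 3 + 32 * (ρ : ℝ) ^ 3 := by
      nlinarith [mul_nonneg (by positivity : (0 : ℝ) ≤ 1 / 2 * E + 3 / 2 * ρ)
        (sq_nonneg (E - 9 / 2 * ρ)), mul_nonneg hE (sq_nonneg (ρ : ℝ)), pow_nonneg hρ 3]
    set P : ℝ := (7 / 4) ^ H with hP
    have hP1 : 1 ≤ P := one_le_pow₀ (by norm_num)
    have h3 : P * (x ^ 3 + y ^ 3) ≤ P * (3 / 2 * E ^ 3 + 32 * (ρ : ℝ) ^ 3) :=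
      mul_le_mul_of_nonneg_left (h1.trans h2) (by linarith)
    have h4 : E ^ 3 ≤ P * E ^ 3 := le_mul_of_one_le_left (by positivity) hP1
    rw [pow_succ (7 / 4 : ℝ) H, pow_succ (2 : ℝ) H, ← hP]
    nlinarith

/-- The martingale `μ` runs from the root to the leaves, with the differences of the numbers of
remaining equations as increments; the values `f` are added over the leaves. -/
def martSum (ρ : ℕ) (m n : α → ℕ) (f : ℕ → ℝ → ℝ) : BlockTree α → ℝ → ℝ
  | leaf a, μ => f (n a) μ
  | node l r, μ =>
      martSum ρ m n f l (μ + ((elimRows ρ m n l : ℝ) - elimRows ρ m n r)) +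
        martSum ρ m n f r (μ - ((elimRows ρ m n l : ℝ) - elimRows ρ m n r))

/-- The two signs cancel the odd powers of the increment `d`, and the mixed term satisfies `12 μ² d²
≤ 6 μ⁴ / L + 6 L d⁴`. Since `|d| ≤ E + ρ`, a multiple of `E⁴` serves as potential: its sum over the
children gains only the factor `7/4 < 2`, up to `ρ⁴`. -/
theorem Feasible.martSum_pow_four_le {T : BlockTree α} (h : T.Feasible ρ m n) {L : ℝ} (hL : 1 ≤ L)
    (H : ℕ) (hH : T.height ≤ H) (μ : ℝ) :
    martSum ρ m n (fun _ μ => μ ^ 4) T μ ≤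
      (2 * (1 + 3 / L)) ^ H *
        (μ ^ 4 + L * (56 * (elimRows ρ m n T : ℝ) ^ 4 + 8800 * H * (ρ : ℝ) ^ 4)) := by
  have hL0 : 0 < L := by linarith
  have hq : 1 ≤ 1 + 3 / L := by
    have : 0 ≤ 3 / L := by positivity
    linarith
  induction T generalizing H μ with
  | leaf a =>
    have h1 : 1 ≤ (2 * (1 + 3 / L)) ^ H := one_le_pow₀ (by linarith)
    have h2 : 0 ≤ L * (56 * (elimRows ρ m n (leaf a) : ℝ) ^ 4 + 8800 * H * (ρ : ℝ) ^ 4) := by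
      positivity
    calc μ ^ 4 ≤ 1 * (μ ^ 4 + L * (56 * (elimRows ρ m n (leaf a) : ℝ) ^ 4 +
          8800 * H * (ρ : ℝ) ^ 4)) := by linarith
      _ ≤ _ := mul_le_mul_of_nonneg_right h1 (by positivity)
  | node l r hl hr =>
    obtain ⟨H, rfl⟩ : ∃ H', H = H' + 1 := ⟨H - 1, by simp only [height] at hH; omega⟩
    simp only [height] at hH
    have hc' : (elimRows ρ m n l : ℝ) + elimRows ρ m n r = elimRows ρ m n (node l r) + ρ := by
      exact_mod_cast h.elimRows_children
    have hl := hl h.1 H (by omega) (μ + ((elimRows ρ m n l : ℝ) - elimRows ρ m n r))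
    have hr := hr h.2.1 H (by omega) (μ - ((elimRows ρ m n l : ℝ) - elimRows ρ m n r))
    simp only [martSum]
    set E : ℝ := (elimRows ρ m n (node l r) : ℝ)
    set x : ℝ := (elimRows ρ m n l : ℝ)
    set y : ℝ := (elimRows ρ m n r : ℝ)
    set q : ℝ := 1 + 3 / L with hqdef
    have hE : 0 ≤ E := Nat.cast_nonneg _
    have hx : 0 ≤ x := Nat.cast_nonneg _
    have hy : 0 ≤ y := Nat.cast_nonneg _
    have hρ : (0 : ℝ) ≤ ρ := Nat.cast_nonneg _
    have h1 : x ^ 4 + y ^ 4 ≤ (E + ρ) ^ 4 := by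
      rw [← hc']
      nlinarith [mul_nonneg hx hy, mul_nonneg (mul_nonneg hx hy) (sq_nonneg (x + y)),
        mul_nonneg (mul_nonneg hx hy) (sq_nonneg x), mul_nonneg (mul_nonneg hx hy) (sq_nonneg y),
        sq_nonneg (x * y)]
    have h2 : (x - y) ^ 4 ≤ (E + ρ) ^ 4 := by
      rw [← hc']
      have : (x - y) ^ 2 ≤ (x + y) ^ 2 := by nlinarith [mul_nonneg hx hy]
      calc (x - y) ^ 4 = ((x - y) ^ 2) ^ 2 := by ring
        _ ≤ ((x + y) ^ 2) ^ 2 := pow_le_pow_left₀ (sq_nonneg _) this 2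
        _ = _ := by ring
    have h3 : (E + ρ) ^ 4 ≤ 7 / 4 * E ^ 4 + 275 * (ρ : ℝ) ^ 4 := by
      have e1 : (E + ρ) ^ 2 ≤ 5 / 4 * E ^ 2 + 5 * (ρ : ℝ) ^ 2 := by
        nlinarith [sq_nonneg (E - 4 * ρ)]
      have e2 : (5 / 4 * E ^ 2 + 5 * (ρ : ℝ) ^ 2) ^ 2 ≤ 7 / 4 * E ^ 4 + 275 * (ρ : ℝ) ^ 4 := by
        nlinarith [sq_nonneg (E ^ 2 - 40 * (ρ : ℝ) ^ 2), sq_nonneg (E ^ 2), sq_nonneg ((ρ : ℝ) ^ 2)]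
      calc (E + ρ) ^ 4 = ((E + ρ) ^ 2) ^ 2 := by ring
        _ ≤ (5 / 4 * E ^ 2 + 5 * (ρ : ℝ) ^ 2) ^ 2 := pow_le_pow_left₀ (sq_nonneg _) e1 2
        _ ≤ _ := e2
    have h4 : (μ + (x - y)) ^ 4 + (μ - (x - y)) ^ 4 ≤ 2 * q * μ ^ 4 + 8 * L * (E + ρ) ^ 4 := by
      have e1 : 2 * (μ ^ 2 * (x - y) ^ 2) ≤ μ ^ 4 / L + L * (x - y) ^ 4 := by
        have : 0 ≤ (μ ^ 2 / L - (x - y) ^ 2) ^ 2 * L := by positivity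
        have e : (μ ^ 2 / L - (x - y) ^ 2) ^ 2 * L =
            μ ^ 4 / L + L * (x - y) ^ 4 - 2 * (μ ^ 2 * (x - y) ^ 2) := by
          field_simp
          ring
        linarith
      have e2 : 2 * q * μ ^ 4 = 2 * μ ^ 4 + 6 * (μ ^ 4 / L) := by
        rw [hqdef]
        field_simp
        ring
      have e3 : L * (x - y) ^ 4 ≤ L * (E + ρ) ^ 4 := mul_le_mul_of_nonneg_left h2 hL0.le
      have e4 : (E + ρ) ^ 4 ≤ L * (E + ρ) ^ 4 := le_mul_of_one_le_left (by positivity) hL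
      have e5 : (μ + (x - y)) ^ 4 + (μ - (x - y)) ^ 4 =
          2 * μ ^ 4 + 12 * (μ ^ 2 * (x - y) ^ 2) + 2 * (x - y) ^ 4 := by ring
      rw [e5, e2]
      linarith
    have hQ : 0 ≤ (2 * q) ^ H := by positivity
    refine (add_le_add hl hr).trans ?_
    rw [← mul_add, pow_succ (2 * q) H, mul_assoc ((2 * q) ^ H)]
    refine mul_le_mul_of_nonneg_left ?_ hQ
    have h5 : 2 * L * (56 * E ^ 4 + 8800 * (H + 1 : ℕ) * (ρ : ℝ) ^ 4) ≤
        2 * q * (L * (56 * E ^ 4 + 8800 * (H + 1 : ℕ) * (ρ : ℝ) ^ 4)) := by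
      have : 0 ≤ L * (56 * E ^ 4 + 8800 * (H + 1 : ℕ) * (ρ : ℝ) ^ 4) := by positivity
      nlinarith
    rw [mul_add (2 * q)]
    push_cast at h5 ⊢
    -- Here `64 = 8 + 56`, from the increment and from the potentials of the children. The induction
    -- closes because `64 * (7/4) = 2 * 56` and `64 * 275 = 2 * 8800`.
    have h6 : L * (64 * (E + ρ) ^ 4) ≤ L * (112 * E ^ 4 + 17600 * (ρ : ℝ) ^ 4) :=
      mul_le_mul_of_nonneg_left (by linarith) hL0.le
    have h7 : L * (56 * (x ^ 4 + y ^ 4)) ≤ L * (56 * (E + ρ) ^ 4) :=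
      mul_le_mul_of_nonneg_left (by linarith) hL0.le
    nlinarith

/-- At the left child `2x - (μ + x - y) = x + y - μ = E + ρ - μ`, and symmetrically on the right, so
`2E - μ` changes by `ρ - E` along each edge. The values of `E` on the path to a leaf telescope, and
`crossSum` weights these path sums by `n a`. -/
theorem Feasible.crossSum_le {T : BlockTree α} (h : T.Feasible ρ m n) (H : ℕ)
    (hH : T.height ≤ H) (μ : ℝ) :
    (crossSum ρ m n T : ℝ) ≤ martSum ρ m n (fun n μ => n * μ) T μ +
      T.sum n * (2 * elimRows ρ m n T - μ + H * ρ) := by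
  induction T generalizing H μ with
  | leaf a =>
    simp only [crossSum, martSum, BlockTree.sum, Nat.cast_mul]
    have h1 : (0 : ℝ) ≤ (elimRows ρ m n (leaf a) : ℝ) * n a := by positivity
    have h2 : (0 : ℝ) ≤ (n a : ℝ) * (H * ρ) := by positivity
    nlinarith
  | node l r hl hr =>
    obtain ⟨H, rfl⟩ : ∃ H', H = H' + 1 := ⟨H - 1, by simp only [height] at hH; omega⟩
    simp only [height] at hH
    have hc' : (elimRows ρ m n l : ℝ) + elimRows ρ m n r = elimRows ρ m n (node l r) + ρ := by
      exact_mod_cast h.elimRows_children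
    have hl := hl h.1 H (by omega) (μ + ((elimRows ρ m n l : ℝ) - elimRows ρ m n r))
    have hr := hr h.2.1 H (by omega) (μ - ((elimRows ρ m n l : ℝ) - elimRows ρ m n r))
    simp only [crossSum, martSum, BlockTree.sum]
    push_cast
    have e₁ : (l.sum n : ℝ) * (2 * elimRows ρ m n l -
        (μ + ((elimRows ρ m n l : ℝ) - elimRows ρ m n r)) + H * ρ) =
        l.sum n * (elimRows ρ m n (node l r) + ρ - μ + H * ρ) := by
      rw [← hc']; ring
    have e₂ : (r.sum n : ℝ) * (2 * elimRows ρ m n r -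
        (μ - ((elimRows ρ m n l : ℝ) - elimRows ρ m n r)) + H * ρ) =
        r.sum n * (elimRows ρ m n (node l r) + ρ - μ + H * ρ) := by
      rw [← hc']; ring
    rw [e₁] at hl
    rw [e₂] at hr
    nlinarith

/-- The first term suffices if `μ ≤ L ρ`, the second if `ρ μ ≤ x²`. Otherwise both `L ρ` and `x` are
at most `μ`, and the third does. -/
theorem mul_le_of_cases {ρ L x μ : ℝ} (hρ : 0 < ρ) (hL : 1 ≤ L) (hx : 0 ≤ x) :
    ρ * (x * μ) ≤ L * ρ ^ 2 * x + x ^ 3 + μ ^ 4 / (L ^ 2 * ρ) := by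
  have hL0 : 0 < L := by linarith
  have h0 : 0 ≤ L * ρ ^ 2 * x := by positivity
  have h1 : 0 ≤ x ^ 3 := by positivity
  have h2 : 0 ≤ μ ^ 4 / (L ^ 2 * ρ) := by positivity
  rcases le_or_gt μ (L * ρ) with h | h
  · have : ρ * (x * μ) ≤ ρ * (x * (L * ρ)) := by gcongr
    nlinarith
  · have hμρ : ρ ≤ μ := by nlinarith
    have hμ : 0 < μ := by linarith
    rcases le_or_gt (ρ * μ) (x ^ 2) with h' | h'
    · have : x * (ρ * μ) ≤ x * x ^ 2 := by gcongr
      nlinarith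
    · have hxμ : x ≤ μ := by
        by_contra hc
        push Not at hc
        nlinarith
      have h3 : ρ * (x * μ) ≤ μ ^ 4 / (L ^ 2 * ρ) := by
        rw [le_div_iff₀ (by positivity)]
        calc ρ * (x * μ) * (L ^ 2 * ρ) = (L * ρ) ^ 2 * (x * μ) := by ring
          _ ≤ μ ^ 2 * (μ * μ) := by gcongr
          _ = μ ^ 4 := by ring
      linarith

/-- The threshold `L ρ` separates the ordinary leaves; those with larger `μ` are charged to the cube
of their size or to the fourth moment. -/
theorem martSum_mul_le (hρ : 0 < ρ) {L : ℝ} (hL : 1 ≤ L) (T : BlockTree α) (μ : ℝ) :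
    ρ * martSum ρ m n (fun n μ => n * μ) T μ ≤ L * (ρ : ℝ) ^ 2 * T.sum n +
      T.sum (fun a => n a ^ 3) + martSum ρ m n (fun _ μ => μ ^ 4) T μ / (L ^ 2 * ρ) := by
  induction T generalizing μ with
  | leaf a =>
    simp only [martSum, BlockTree.sum, Nat.cast_pow]
    exact mul_le_of_cases (by exact_mod_cast hρ) hL (Nat.cast_nonneg _)
  | node l r hl hr =>
    have hl := hl (μ + ((elimRows ρ m n l : ℝ) - elimRows ρ m n r))
    have hr := hr (μ - ((elimRows ρ m n l : ℝ) - elimRows ρ m n r))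
    simp only [martSum, BlockTree.sum]
    push_cast
    rw [add_div]
    linarith

theorem one_add_div_pow_le (l : ℕ) : (1 + 3 / ((l : ℝ) + 1)) ^ l ≤ 27 := by
  have h1 : 1 + 3 / ((l : ℝ) + 1) ≤ Real.exp (3 / ((l : ℝ) + 1)) := by
    rw [add_comm]
    exact Real.add_one_le_exp _
  calc (1 + 3 / ((l : ℝ) + 1)) ^ l ≤ Real.exp (3 / ((l : ℝ) + 1)) ^ l :=
        pow_le_pow_left₀ (by positivity) h1 _
    _ = Real.exp (l * (3 / ((l : ℝ) + 1))) := (Real.exp_nat_mul _ _).symm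
    _ ≤ Real.exp (3 * 1) := by
        refine Real.exp_le_exp.2 ?_
        rw [← mul_div_assoc, div_le_iff₀ (by positivity)]
        linarith
    _ = Real.exp 1 ^ 3 := by
        rw [← Real.exp_nat_mul]
        norm_num
    _ ≤ 3 ^ 3 := pow_le_pow_left₀ (Real.exp_pos _).le
        (Real.exp_one_lt_d9.le.trans (by norm_num)) 3
    _ = 27 := by norm_num

/-- Equal totals give `E = ρ` at the root. With `L = l + 1` the fourth moment is `O(k L² ρ⁴)`, and
division by `L² ρ` leaves `O(k ρ³)`. -/
theorem Feasible.cost_le_of_sum_eq {T : BlockTree α} (h : T.Feasible ρ m n)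
    (hmn : T.sum m = T.sum n) {l : ℕ} (hl : T.height ≤ l) (hk : 2 ^ l ≤ 2 * T.leaves) :
    elimCost ρ m n T + solveCost ρ m n T ≤ 10000000 *
      (T.sum (fun a => n a ^ 3) + (l + 1) * ρ ^ 2 * T.sum n + T.leaves * ρ ^ 3) := by
  have hE : elimRows ρ m n T = ρ := by
    have := h.elimRows_add
    omega
  have h1 := h.cost_le
  have h2 := h.cubeSum_le l hl
  have h3 := h.martSum_pow_four_le (L := l + 1) (by simp) l hl 0
  have h4 := h.crossSum_le l hl 0
  rw [hE] at h2 h3 h4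
  have hk' : (2 : ℝ) ^ l ≤ 2 * T.leaves := by exact_mod_cast hk
  have h5 : (T.cubeSum ρ m n : ℝ) ≤ 1032 * (T.leaves * (ρ : ℝ) ^ 3) := by
    have e1 : ((7 : ℝ) / 4) ^ l ≤ 2 ^ l := pow_le_pow_left₀ (by norm_num) (by norm_num) _
    have e2 : (0 : ℝ) ≤ ((7 : ℝ) / 4) ^ l := by positivity
    have e3 : (0 : ℝ) ≤ (ρ : ℝ) ^ 3 := by positivity
    calc (T.cubeSum ρ m n : ℝ) ≤ (512 * 2 ^ l - 508 * (7 / 4) ^ l) * (ρ : ℝ) ^ 3 := by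
          linarith
      _ ≤ (1024 * T.leaves) * (ρ : ℝ) ^ 3 := by
          refine mul_le_mul_of_nonneg_right ?_ e3
          linarith
      _ ≤ _ := by
          have : (0 : ℝ) ≤ T.leaves * (ρ : ℝ) ^ 3 := by positivity
          linarith
  have h6 : (ρ * T.crossSum ρ m n : ℝ) ≤ 3 * ((l + 1) * (ρ : ℝ) ^ 2 * T.sum n) +
      T.sum (fun a => n a ^ 3) + 478224 * (T.leaves * (ρ : ℝ) ^ 3) := by
    rcases Nat.eq_zero_or_pos ρ with h0 | h0
    · simp [h0]
    have hρ : (0 : ℝ) < ρ := by exact_mod_cast h0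
    have h7 := martSum_mul_le (m := m) (n := n) h0 (L := (l : ℝ) + 1) (by simp) T 0
    have h8 : T.martSum ρ m n (fun _ μ => μ ^ 4) 0 ≤
        478224 * T.leaves * ((l + 1) ^ 2 * (ρ : ℝ) ^ 4) := by
      have e1 := one_add_div_pow_le l
      rw [mul_pow] at h3
      calc T.martSum ρ m n (fun _ μ => μ ^ 4) 0 ≤ _ := h3
        -- The factors bound `2 ^ l` and `(1 + 3 / (l + 1)) ^ l`; moreover `8856 = 56 + 8800` and
        -- `478224 = 54 * 8856`.
        _ ≤ (2 * T.leaves * 27) * (8856 * ((l + 1) ^ 2 * (ρ : ℝ) ^ 4)) := by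
            refine mul_le_mul (mul_le_mul hk' e1 (by positivity) (by positivity)) ?_
              (by positivity) (by positivity)
            have e2 : (0 : ℝ) ≤ (l + 1) * (ρ : ℝ) ^ 4 := by positivity
            have e3 : (0 : ℝ) ≤ (l + 1) * (ρ : ℝ) ^ 4 * l := by positivity
            nlinarith
        _ = _ := by ring
    have h9 : T.martSum ρ m n (fun _ μ => μ ^ 4) 0 / (((l : ℝ) + 1) ^ 2 * ρ) ≤
        478224 * (T.leaves * (ρ : ℝ) ^ 3) := by
      rw [div_le_iff₀ (by positivity)]
      calc _ ≤ _ := h8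
        _ = _ := by ring
    have h10 : (ρ : ℝ) * T.crossSum ρ m n ≤ ρ * (T.martSum ρ m n (fun n μ => n * μ) 0 +
        T.sum n * (2 * ρ - 0 + l * ρ)) := mul_le_mul_of_nonneg_left h4 hρ.le
    have h11 : (0 : ℝ) ≤ (l : ℝ) * ((ρ : ℝ) ^ 2 * T.sum n) := by positivity
    nlinarith
  have h1' : ((elimCost ρ m n T + solveCost ρ m n T : ℕ) : ℝ) + 218 * (ρ : ℝ) ^ 3 ≤
      60 * (T.sum (fun a => n a ^ 3) : ℕ) + 116 * (cubeSum ρ m n T : ℝ) +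
        60 * ((ρ : ℝ) ^ 2 * T.sum n * T.height) + 18 * ((ρ : ℝ) * crossSum ρ m n T) +
        218 * ((ρ : ℝ) ^ 3 * T.leaves) := by exact_mod_cast h1
  have hh : (ρ : ℝ) ^ 2 * T.sum n * T.height ≤ (l + 1) * (ρ : ℝ) ^ 2 * T.sum n := by
    have : (T.height : ℝ) ≤ l + 1 := by
      have : (T.height : ℝ) ≤ l := by exact_mod_cast hl
      linarith
    calc (ρ : ℝ) ^ 2 * T.sum n * T.height ≤ (ρ : ℝ) ^ 2 * T.sum n * (l + 1) := by gcongr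
      _ = _ := by ring
  have g1 : (0 : ℝ) ≤ (ρ : ℝ) ^ 3 := by positivity
  have g2 : (0 : ℝ) ≤ T.leaves * (ρ : ℝ) ^ 3 := by positivity
  have g3 : (0 : ℝ) ≤ (l + 1) * (ρ : ℝ) ^ 2 * T.sum n := by positivity
  have g4 : (0 : ℝ) ≤ (T.sum (fun a => n a ^ 3) : ℕ) := by positivity
  have : ((elimCost ρ m n T + solveCost ρ m n T : ℕ) : ℝ) ≤ ((10000000 *
      (T.sum (fun a => n a ^ 3) + (l + 1) * ρ ^ 2 * T.sum n + T.leaves * ρ ^ 3) : ℕ) : ℝ) := by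
    push_cast at *
    linarith
  exact_mod_cast this

/-- Feasibility at the leaves and convexity of the cube; this lets the transposed bound be stated in
the row sizes. -/
theorem Feasible.sum_cube_le {T : BlockTree α} (h : T.Feasible ρ m n) :
    T.sum (fun a => n a ^ 3) ≤ 4 * (T.sum (fun a => m a ^ 3) + T.leaves * ρ ^ 3) := by
  induction T with
  | leaf a =>
    have h : n a ≤ m a + ρ := h
    simp only [BlockTree.sum, leaves]
    have e1 := mul_sq_le_cube_add_cube (m a) ρ
    have e2 := mul_sq_le_cube_add_cube ρ (m a)
    have : (m a + ρ) ^ 3 ≤ 4 * (m a ^ 3 + ρ ^ 3) := by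
      zify
      nlinarith [mul_nonneg (by positivity : (0 : ℤ) ≤ (m a : ℤ) + ρ)
        (sq_nonneg ((m a : ℤ) - ρ))]
    calc n a ^ 3 ≤ (m a + ρ) ^ 3 := Nat.pow_le_pow_left h 3
      _ ≤ _ := by simpa using this
  | node l r hl hr =>
    have := hl h.1
    have := hr h.2.1
    simp only [BlockTree.sum, leaves] at *
    nlinarith

end BlockTree

end CostBounds

/-! ### From merging trees to block trees -/

namespace MergeTree

/-- The tree with the labels `c a, c (a + 1), …` at its leaves. -/
def label {α : Type} (c : ℕ → α) : MergeTree → ℕ → BlockTree α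
  | leaf, a => .leaf (c a)
  | node s t, a => .node (s.label c a) (t.label c (a + s.numLeaves))

variable {α : Type} (c : ℕ → α)

theorem height_label (s : MergeTree) (a : ℕ) : (s.label c a).height = s.height := by
  induction s generalizing a with
  | leaf => rfl
  | node s t hs ht => simp only [label, BlockTree.height, height, hs, ht]

theorem sum_label (g : α → ℕ) (s : MergeTree) (a : ℕ) :
    (s.label c a).sum g = ∑ i ∈ Finset.range s.numLeaves, g (c (a + i)) := by
  induction s generalizing a with
  | leaf => simp [label, BlockTree.sum, numLeaves]
  | node s t hs ht =>
    simp only [label, BlockTree.sum, numLeaves, hs, ht, Finset.sum_range_add, add_assoc]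

theorem leaves_label (s : MergeTree) (a : ℕ) : (s.label c a).leaves = s.numLeaves := by
  simp [BlockTree.leaves, sum_label]

theorem numLeaves_le_two_pow_height (t : MergeTree) : t.numLeaves ≤ 2 ^ t.height := by
  induction t with
  | leaf => simp [numLeaves, height]
  | node a b ha hb =>
    have h1 : 2 ^ a.height ≤ 2 ^ max a.height b.height :=
      Nat.pow_le_pow_right (by norm_num) (le_max_left _ _)
    have h2 : 2 ^ b.height ≤ 2 ^ max a.height b.height :=
      Nat.pow_le_pow_right (by norm_num) (le_max_right _ _)
    simp only [numLeaves, height, pow_succ]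
    omega

/-- All levels down to `minDepth` are full, and a deeper leaf forces more leaves than that level has
vertices. -/
theorem two_pow_minDepth_le (t : MergeTree) :
    2 ^ t.minDepth ≤ t.numLeaves ∧ (t.minDepth < t.height → 2 ^ t.minDepth < t.numLeaves) := by
  induction t with
  | leaf => simp [numLeaves, height, minDepth]
  | node a b ha hb =>
    obtain ⟨ha, ha'⟩ := ha
    obtain ⟨hb, hb'⟩ := hb
    simp only [numLeaves, height, minDepth, pow_succ]
    rcases lt_trichotomy a.minDepth b.minDepth with h | h | h
    · rw [min_eq_left h.le]
      have := Nat.pow_lt_pow_right (a := 2) (by norm_num) h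
      omega
    · rw [h] at ha ha' ⊢
      rw [min_self]
      refine ⟨by omega, fun h' => ?_⟩
      rcases le_total a.height b.height with h₁ | h₁
      · rw [max_eq_right h₁] at h'
        have := hb' (by omega)
        omega
      · rw [max_eq_left h₁] at h'
        have := ha' (by omega)
        omega
    · rw [min_eq_right h.le]
      have := Nat.pow_lt_pow_right (a := 2) (by norm_num) h
      omega

/-- A height beyond the logarithm would, by balance, give `k ≤ 2 ^ minDepth`, against the counts of
leaves in terms of `minDepth` and `height`. -/
theorem IsBalanced.height_le_clog {t : MergeTree} (h : t.IsBalanced) :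
    t.height ≤ Nat.clog 2 t.numLeaves ∧ 2 ^ Nat.clog 2 t.numLeaves ≤ 2 * t.numLeaves := by
  have h1 := t.two_pow_minDepth_le
  constructor
  · by_contra! hc
    have h2 : t.numLeaves ≤ 2 ^ Nat.clog 2 t.numLeaves := Nat.le_pow_clog (by norm_num) _
    have h3 : 2 ^ Nat.clog 2 t.numLeaves ≤ 2 ^ t.minDepth :=
      Nat.pow_le_pow_right (by norm_num) (by unfold IsBalanced at h; omega)
    have h4 : t.minDepth = t.height ∨ t.minDepth < t.height ∨ t.height < t.minDepth := by omega
    rcases h4 with h4 | h4 | h4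
    · have := Nat.pow_lt_pow_right (a := 2) (by norm_num) (h4 ▸ hc)
      omega
    · have := h1.2 h4
      omega
    · have := Nat.pow_lt_pow_right (a := 2) (by norm_num) h4
      have := t.numLeaves_le_two_pow_height
      omega
  · rcases (Nat.one_le_iff_ne_zero.2 t.numLeaves_pos.ne').eq_or_lt with h2 | h2
    · rw [← h2]
      norm_num
    · have := Nat.pow_pred_clog_lt_self (b := 2) (by norm_num) h2
      have h3 : 0 < Nat.clog 2 t.numLeaves := Nat.clog_pos (by norm_num) h2
      obtain ⟨d, hd⟩ : ∃ d, Nat.clog 2 t.numLeaves = d + 1 := ⟨_, (Nat.succ_pred h3.ne').symm⟩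
      rw [hd] at this ⊢
      rw [Nat.pred_succ] at this
      rw [pow_succ]
      omega

theorem mem_vertices (s : MergeTree) (a : ℕ) : (a, a + s.numLeaves) ∈ s.vertices a := by
  cases s with
  | leaf => simp [vertices, numLeaves]
  | node s t => simp [vertices, numLeaves]

end MergeTree

/-! ### The data of an HSS matrix -/

section Data

variable {Θ K : Type*} {k ρ : ℕ} {t : MergeTree} {m n : Fin k → ℕ} {r : t.Vertex → ℕ}

/-- The state in which the input entries are available. -/
def inputState {ι : Type*} (input : Θ → ι → K) : KState Θ K :=
  ⟨Set.univ, Set.range fun i θ => input θ i⟩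

theorem known_inputState {ι : Type*} (input : Θ → ι → K) (i : ι) :
    (inputState input).Known fun θ => input θ i :=
  ⟨_, Or.inl ⟨i, rfl⟩, fun _ _ => rfl⟩

theorem KState.KnownVec.of_comp_equiv {ι κ : Type*} {st : KState Θ K} {x : Θ → ι → K} (e : κ ≃ ι)
    (h : st.KnownVec fun θ => x θ ∘ e) (o : ι) : st.Known fun θ => x θ o :=
  (h (e.symm o)).congr fun θ _ => congrArg (x θ) (e.apply_symm_apply o)

variable [Field K]

/-- The data of the matrices `A θ` are available. -/
structure KnownData (st : KState Θ K) (A : Θ → HSSMatrix K t ρ m n r) : Prop where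
  diag : ∀ q, st.KnownMat fun θ => (A θ).diag q
  genF : ∀ v, st.KnownMat fun θ => (A θ).F v
  genH : ∀ v, st.KnownMat fun θ => (A θ).H v

theorem knownData_inputState {σ : Type} (A : Θ → HSSMatrix K t ρ m n r) (u : Θ → σ → K) :
    KnownData (inputState fun θ => (A θ).input (u θ)) A where
  diag q i j := known_inputState (fun θ => (A θ).input (u θ)) (.diag q i j)
  genF v i h := known_inputState (fun θ => (A θ).input (u θ)) (.genF v i h)
  genH v h j := known_inputState (fun θ => (A θ).input (u θ)) (.genH v h j)

theorem knownVec_inputState {σ : Type} (A : Θ → HSSMatrix K t ρ m n r) (u : Θ → σ → K) :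
    (inputState fun θ => (A θ).input (u θ)).KnownVec u :=
  fun i => known_inputState (fun θ => (A θ).input (u θ)) (.vec i)

variable {st : KState Θ K} {A : Θ → HSSMatrix K t ρ m n r}

theorem HSSMatrix.submatrix_eq (A : HSSMatrix K t ρ m n r) (v : t.Vertex) {Ω J : Type}
    (g : Ω → OutsideIdx m v) (f : J → InsideIdx n v) :
    A.M.submatrix (fun w => (g w).1) (fun j => (f j).1) =
      (A.F v).submatrix g id * (A.H v).submatrix id f := by
  have h := congrArg (fun N => N.submatrix g f) (A.neutered_eq v)
  rw [← Matrix.submatrix_mul _ _ g id f Function.bijective_id, ← h]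
  rfl

theorem KnownData.lowRank (h : KnownData st A) (hr : ∀ v, r v ≤ ρ) (v : t.Vertex) {Ω J : Type}
    {g : Ω → BlockIdx m} {f : J → BlockIdx n} (hg : ∀ w, ¬ v.Contains (g w).1)
    (hf : ∀ j, v.Contains (f j).1) : LowRank ρ st fun θ => (A θ).M.submatrix g f :=
  ⟨r v, hr v, _, _, (h.genF v).submatrix (fun w => ⟨g w, hg w⟩) id,
    (h.genH v).submatrix id (fun j => ⟨f j, hf j⟩), fun θ _ =>
    (A θ).submatrix_eq v (fun w => ⟨g w, hg w⟩) (fun j => ⟨f j, hf j⟩)⟩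

theorem HSSMatrix.rank_submatrix_le (A : HSSMatrix K t ρ m n r) (hr : ∀ v, r v ≤ ρ)
    (v : t.Vertex) {Ω J : Type} [Fintype J] {g : Ω → BlockIdx m} {f : J → BlockIdx n}
    (hg : ∀ w, ¬ v.Contains (g w).1) (hf : ∀ j, v.Contains (f j).1) :
    (A.M.submatrix g f).rank ≤ ρ := by
  rw [A.submatrix_eq v (fun w => ⟨g w, hg w⟩) (fun j => ⟨f j, hf j⟩)]
  refine (Matrix.rank_mul_le_left _ _).trans (((Matrix.rank_le_card_width _).trans ?_).trans (hr v))
  rw [Fintype.card_fin]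

/-- The block is one of the `d` blocks from number `a` on. -/
def InBlocks (a d : ℕ) (q : Fin k) : Prop := a ≤ q ∧ q < a + d

/-- Index types are iterated disjoint sums, so each vertex is literally a two-by-two block matrix.
Its upper right block lies in the neutered union of the right child, its lower left one in that of
the left child. Together with any rows outside the vertex they still do, which gives the rank
bounds. -/
theorem KnownData.exists_given (h : KnownData st A) (hr : ∀ v, r v ≤ ρ) {c : ℕ → Fin k}
    (hc : ∀ q < k, (c q : ℕ) = q) (s : MergeTree) (a : ℕ) (hs : s.vertices a ⊆ t.vertices 0)
    (hk : a + s.numLeaves ≤ k) :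
    ∃ (I J : Type) (_ : Fintype I) (_ : Fintype J) (e : I → BlockIdx m) (f : J → BlockIdx n),
      (Function.Injective e ∧ ∀ i, i ∈ Set.range e ↔ InBlocks a s.numLeaves i.1) ∧
      (Function.Injective f ∧ ∀ j, j ∈ Set.range f ↔ InBlocks a s.numLeaves j.1) ∧
      Given ρ st m n (s.label c a) I J (fun θ => (A θ).M.submatrix e f) ∧
      ∀ (Ω : Type) [Fintype Ω] (g : Ω → BlockIdx m), (∀ w, ¬ InBlocks a s.numLeaves (g w).1) →
        GivenHSS ρ st m n (s.label c a) Ω I J (fun θ => (A θ).M.submatrix g f)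
          (fun θ => (A θ).M.submatrix e f) := by
  induction s generalizing a with
  | leaf =>
    have hca : (c a : ℕ) = a := hc a (by simp only [MergeTree.numLeaves] at hk; omega)
    have hM : st.KnownMat fun θ => (A θ).M.submatrix
        (fun i : Fin (m (c a)) => (⟨c a, i⟩ : BlockIdx m))
        (fun j : Fin (n (c a)) => (⟨c a, j⟩ : BlockIdx n)) := fun i j =>
      (h.diag (c a) i j).congr fun θ _ => ((A θ).diag_eq (c a) i j).symm
    have hrange : ∀ {m : Fin k → ℕ}, Function.Injective (fun i : Fin (m (c a)) =>
        (⟨c a, i⟩ : BlockIdx m)) ∧ ∀ i : BlockIdx m, i ∈ Set.range (fun i : Fin (m (c a)) =>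
        (⟨c a, i⟩ : BlockIdx m)) ↔ InBlocks a MergeTree.leaf.numLeaves i.1 := by
      refine fun {m} => ⟨fun i i' hi => eq_of_heq (Sigma.mk.inj_iff.1 hi).2, ?_⟩
      rintro ⟨q, i⟩
      constructor
      · rintro ⟨i', hi⟩
        have hq : c a = q := (Sigma.mk.inj_iff.1 hi).1
        rw [Fin.ext_iff] at hq
        simp only [InBlocks, MergeTree.numLeaves]
        omega
      · intro hq
        simp only [InBlocks, MergeTree.numLeaves] at hq
        obtain rfl : q = c a := Fin.ext (by omega)
        exact ⟨i, rfl⟩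
    exact ⟨Fin (m (c a)), Fin (n (c a)), inferInstance, inferInstance, fun i => ⟨c a, i⟩,
      fun j => ⟨c a, j⟩, hrange, hrange, .leaf (Fintype.card_fin _) (Fintype.card_fin _) hM,
      fun Ω _ g _ => .leaf (Fintype.card_fin _) (Fintype.card_fin _) hM⟩
  | node s s' ih ih' =>
    simp only [MergeTree.numLeaves] at hk
    have hs₁ : s.vertices a ⊆ t.vertices 0 := fun v hv =>
      hs (Finset.mem_insert_of_mem (Finset.mem_union_left _ hv))
    have hs₂ : s'.vertices (a + s.numLeaves) ⊆ t.vertices 0 := fun v hv =>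
      hs (Finset.mem_insert_of_mem (Finset.mem_union_right _ hv))
    obtain ⟨I₁, J₁, _, _, e₁, f₁, ⟨he₁, hre₁⟩, ⟨hf₁, hrf₁⟩, hg₁, hh₁⟩ := ih a hs₁ (by omega)
    obtain ⟨I₂, J₂, _, _, e₂, f₂, ⟨he₂, hre₂⟩, ⟨hf₂, hrf₂⟩, hg₂, hh₂⟩ :=
      ih' (a + s.numLeaves) hs₂ (by omega)
    let v₁ : t.Vertex := ⟨_, hs₁ (s.mem_vertices a)⟩
    let v₂ : t.Vertex := ⟨_, hs₂ (s'.mem_vertices (a + s.numLeaves))⟩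
    have me₁ : ∀ i, InBlocks a s.numLeaves (e₁ i).1 := fun i => (hre₁ _).1 ⟨i, rfl⟩
    have me₂ : ∀ i, InBlocks (a + s.numLeaves) s'.numLeaves (e₂ i).1 := fun i => (hre₂ _).1 ⟨i, rfl⟩
    have mf₁ : ∀ j, InBlocks a s.numLeaves (f₁ j).1 := fun j => (hrf₁ _).1 ⟨j, rfl⟩
    have mf₂ : ∀ j, InBlocks (a + s.numLeaves) s'.numLeaves (f₂ j).1 := fun j => (hrf₂ _).1 ⟨j, rfl⟩
    have o₁ : ∀ q : Fin k, InBlocks a s.numLeaves q →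
        ¬ InBlocks (a + s.numLeaves) s'.numLeaves q := by
      intro q h1 h2
      simp only [InBlocks] at h1 h2
      omega
    have hin : ∀ q : Fin k, InBlocks a (s.node s').numLeaves q ↔
        InBlocks a s.numLeaves q ∨ InBlocks (a + s.numLeaves) s'.numLeaves q := by
      intro q
      simp only [InBlocks, MergeTree.numLeaves]
      omega
    have hB : LowRank ρ st fun θ => (A θ).M.submatrix e₁ f₂ :=
      h.lowRank hr v₂ (fun w => o₁ _ (me₁ w)) mf₂
    have hC : LowRank ρ st fun θ => (A θ).M.submatrix e₂ f₁ :=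
      h.lowRank hr v₁ (fun w h' => o₁ _ h' (me₂ w)) mf₁
    have hM : (fun θ => (A θ).M.submatrix (Sum.elim e₁ e₂) (Sum.elim f₁ f₂)) = fun θ =>
        Matrix.fromBlocks ((A θ).M.submatrix e₁ f₁) ((A θ).M.submatrix e₁ f₂)
          ((A θ).M.submatrix e₂ f₁) ((A θ).M.submatrix e₂ f₂) := by
      funext θ
      ext (i | i) (j | j) <;> rfl
    refine ⟨I₁ ⊕ I₂, J₁ ⊕ J₂, inferInstance, inferInstance, Sum.elim e₁ e₂, Sum.elim f₁ f₂,
      ⟨?_, fun i => ?_⟩, ⟨?_, fun j => ?_⟩, ?_, fun Ω _ g hg => ?_⟩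
    · refine he₁.sumElim he₂ fun i j hij => o₁ _ (me₁ i) ?_
      rw [hij]
      exact me₂ j
    · rw [Set.Sum.elim_range, Set.mem_union, hre₁, hre₂, hin]
    · refine hf₁.sumElim hf₂ fun i j hij => o₁ _ (mf₁ i) ?_
      rw [hij]
      exact mf₂ j
    · rw [Set.Sum.elim_range, Set.mem_union, hrf₁, hrf₂, hin]
    · rw [hM]
      exact .node hg₁ hg₂ hB hC
    · have hg' : ∀ w, ¬ InBlocks a s.numLeaves (g w).1 ∧
          ¬ InBlocks (a + s.numLeaves) s'.numLeaves (g w).1 := fun w =>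
        not_or.1 fun h' => hg w ((hin _).2 h')
      have hN : (fun θ => (A θ).M.submatrix g (Sum.elim f₁ f₂)) = fun θ =>
          Matrix.fromCols ((A θ).M.submatrix g f₁) ((A θ).M.submatrix g f₂) := by
        funext θ
        ext i (j | j) <;> rfl
      have hR : ∀ {X Y Z : Type} (x : X → BlockIdx m) (y : Y → BlockIdx m) (z : Z → BlockIdx n) θ,
          Matrix.fromRows ((A θ).M.submatrix x z) ((A θ).M.submatrix y z) =
            (A θ).M.submatrix (Sum.elim x y) z := by
        intro X Y Z x y z θ
        ext (i | i) j <;> rfl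
      have p₁ : ∀ w, ¬ InBlocks a s.numLeaves (Sum.elim g e₂ w).1 := by
        rintro (w | w)
        exacts [(hg' w).1, fun h' => o₁ _ h' (me₂ w)]
      have p₂ : ∀ w, ¬ InBlocks (a + s.numLeaves) s'.numLeaves (Sum.elim g e₁ w).1 := by
        rintro (w | w)
        exacts [(hg' w).2, o₁ _ (me₁ w)]
      rw [hM, hN]
      refine .node ?_ ?_ hB hC (fun θ _ => ?_) fun θ _ => ?_
      · simp only [hR]
        exact hh₁ _ _ p₁
      · simp only [hR]
        exact hh₂ _ _ p₂
      · rw [hR]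
        exact (A θ).rank_submatrix_le hr v₁ p₁ mf₁
      · rw [hR]
        exact (A θ).rank_submatrix_le hr v₂ p₂ mf₂

end Data

/-! ### Assembling the theorem -/

section Main

/-- The block numbers as labels. -/
def blockLabel {k : ℕ} (hk : 0 < k) (q : ℕ) : Fin k := if h : q < k then ⟨q, h⟩ else ⟨0, hk⟩

theorem val_blockLabel {k : ℕ} (hk : 0 < k) {q : ℕ} (hq : q < k) : (blockLabel hk q : ℕ) = q := by
  simp [blockLabel, hq]

theorem blockLabel_val {k : ℕ} (hk : 0 < k) (q : Fin k) : blockLabel hk q = q := by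
  simp [blockLabel]

/-- The merging tree with the block numbers at its leaves. -/
def MergeTree.blockTree {k : ℕ} (t : MergeTree) (h : t.numLeaves = k) : BlockTree (Fin k) :=
  t.label (blockLabel (h ▸ t.numLeaves_pos)) 0

variable {Θ K : Type*} [Field K] {k ρ : ℕ} {t : MergeTree} {m n : Fin k → ℕ} {r : t.Vertex → ℕ}

theorem MergeTree.sum_blockTree (h : t.numLeaves = k) (g : Fin k → ℕ) :
    (t.blockTree h).sum g = ∑ q, g q := by
  simp only [blockTree, sum_label, zero_add, h, Finset.sum_range, blockLabel_val]

theorem MergeTree.leaves_blockTree (h : t.numLeaves = k) : (t.blockTree h).leaves = k :=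
  (t.leaves_label _ _).trans h

theorem MergeTree.IsBalanced.height_blockTree_le (hb : t.IsBalanced) (h : t.numLeaves = k) :
    (t.blockTree h).height ≤ Nat.clog 2 k ∧ 2 ^ Nat.clog 2 k ≤ 2 * k := by
  rw [blockTree, height_label, ← h]
  exact hb.height_le_clog

theorem KnownData.exists_given_blockTree {st : KState Θ K} {A : Θ → HSSMatrix K t ρ m n r}
    (h : KnownData st A) (hr : ∀ v, r v ≤ ρ) (ht : t.numLeaves = k) :
    ∃ (I J : Type) (_ : Fintype I) (_ : Fintype J) (e : I ≃ BlockIdx m) (f : J ≃ BlockIdx n),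
      Given ρ st m n (t.blockTree ht) I J (fun θ => (A θ).M.submatrix e f) ∧
      GivenHSS ρ st m n (t.blockTree ht) Empty I J
        (fun θ => (A θ).M.submatrix Empty.elim f) (fun θ => (A θ).M.submatrix e f) := by
  obtain ⟨I, J, hI, hJ, e, f, ⟨he, hre⟩, ⟨hf, hrf⟩, hg, hh⟩ := h.exists_given hr
    (fun q hq => val_blockLabel (ht ▸ t.numLeaves_pos) hq) t 0 subset_rfl (by omega)
  have hin : ∀ q : Fin k, InBlocks 0 t.numLeaves q := fun q => ⟨Nat.zero_le _, by omega⟩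
  exact ⟨I, J, hI, hJ, Equiv.ofBijective e ⟨he, fun i => (hre i).2 (hin _)⟩,
    Equiv.ofBijective f ⟨hf, fun j => (hrf j).2 (hin _)⟩, hg, hh Empty _ fun w => w.elim⟩

theorem arithCost_mulVec_le (A : Θ → HSSMatrix K t ρ m n r) (u : Θ → BlockIdx n → K)
    (hr : ∀ v, r v ≤ ρ) (ht : t.numLeaves = k) :
    arithCost (fun θ => (A θ).input (u θ)) (fun θ => (A θ).M *ᵥ u θ) ≤
      (mulVecCost ρ m n (t.blockTree ht) : ℕ∞) := by
  obtain ⟨I, J, _, _, e, f, hg, -⟩ :=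
    (knownData_inputState A u).exists_given_blockTree hr ht
  refine Reach.arithCost_le ?_
  refine (hg.fastMul _ (leRefl _) _ ((knownVec_inputState A u).comp f)).imp
    fun st _ h => KnownVec.of_comp_equiv e (h.congr fun θ _ => ?_)
  rw [Matrix.submatrix_mulVec_equiv, Function.comp_assoc, f.self_comp_symm, Function.comp_id]

theorem arithCost_transpose_mulVec_le (A : Θ → HSSMatrix K t ρ m n r) (u : Θ → BlockIdx m → K)
    (hr : ∀ v, r v ≤ ρ) (ht : t.numLeaves = k) :
    arithCost (fun θ => (A θ).input (u θ)) (fun θ => (A θ).Mᵀ *ᵥ u θ) ≤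
      (mulVecCost ρ n m (t.blockTree ht) : ℕ∞) := by
  obtain ⟨I, J, _, _, e, f, hg, -⟩ :=
    (knownData_inputState A u).exists_given_blockTree hr ht
  refine Reach.arithCost_le ?_
  refine (hg.transpose.fastMul _ (leRefl _) _ ((knownVec_inputState A u).comp e)).imp
    fun st _ h => KnownVec.of_comp_equiv f (h.congr fun θ _ => ?_)
  rw [Matrix.transpose_submatrix, Matrix.submatrix_mulVec_equiv, Function.comp_assoc,
    e.self_comp_symm, Function.comp_id]

/-- A nonsingular matrix has a solution operator that can be applied fast. -/
theorem reach_solve (A : Θ → NonsingularHSSMatrix K t ρ m n r) {σ : Type} (u : Θ → σ → K)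
    (hr : ∀ v, r v ≤ ρ) (ht : t.numLeaves = k) :
    ∃ (I J : Type) (_ : Fintype I) (_ : Fintype J) (e : I ≃ BlockIdx m) (f : J ≃ BlockIdx n),
      (Nonempty Θ → (t.blockTree ht).Feasible ρ m n) ∧
      Reach (fun st => ∃ L : Θ → Matrix J (I ⊕ Fin ρ) K,
          FastMul st L (solveCost ρ m n (t.blockTree ht)) ∧
          FastMul st (fun θ => (L θ)ᵀ) (solveCost ρ m n (t.blockTree ht)) ∧
          ∀ θ ∈ st.S, (L θ).submatrix id Sum.inl = (A θ).Minv.submatrix f e)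
        (elimCost ρ m n (t.blockTree ht))
        (inputState fun θ => (A θ).toHSSMatrix.input (u θ)) := by
  classical
  obtain ⟨I, J, _, _, e, f, -, hg⟩ :=
    (knownData_inputState (fun θ => (A θ).toHSSMatrix) u).exists_given_blockTree hr ht
  have hleft : ∀ θ, (A θ).Minv.submatrix f e * (A θ).M.submatrix e f = 1 := fun θ => by
    rw [Matrix.submatrix_mul_equiv, (A θ).inv_mul, Matrix.submatrix_one_equiv]
  have hright : ∀ θ, (A θ).M.submatrix e f * (A θ).Minv.submatrix f e = 1 := fun θ => by
    rw [Matrix.submatrix_mul_equiv, (A θ).mul_inv, Matrix.submatrix_one_equiv]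
  have hinj : ∀ θ x, (A θ).M.submatrix e f *ᵥ x = 0 → x = 0 := fun θ x hx => by
    rw [← Matrix.one_mulVec x, ← hleft θ, ← Matrix.mulVec_mulVec, hx, Matrix.mulVec_zero]
  refine ⟨I, J, inferInstance, inferInstance, e, f, fun ⟨θ⟩ => ?_, ?_⟩
  · refine hg.feasible (Set.mem_univ θ) (fun x hx _ => hinj θ x hx) ?_
    exact (Matrix.rank_le_card_height _).trans (by simp)
  · refine (hg.elim _ (leRefl _) (fun _ => 0) (fun _ _ => known_const _ 0) fun θ _ =>
      ⟨⟨0, Subsingleton.elim _ _⟩, ⟨0, (Matrix.zero_mul _).symm⟩, fun x hx _ => hinj θ x hx⟩).imp ?_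
    rintro st - ⟨W, L, -, hL, hL', hE⟩
    refine ⟨L, hL, hL', fun θ hθ => ?_⟩
    -- At the root `B = 0`, so `L (M x, 0) = x`, and the columns of `L` at `I` form a left inverse
    -- of `M`.
    have h : (L θ).submatrix id Sum.inl * (A θ).M.submatrix e f = 1 := by
      refine Matrix.toLin'.injective (LinearMap.ext fun x => ?_)
      rw [Matrix.toLin'_apply, Matrix.toLin'_apply, Matrix.one_mulVec, ← Matrix.mulVec_mulVec]
      conv_rhs => rw [← (hE θ hθ).mulVec_eq x]
      rw [Matrix.zero_mulVec]
      funext j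
      simp [Matrix.mulVec, dotProduct]
    rw [← Matrix.mul_one ((L θ).submatrix id Sum.inl), ← hright θ, ← Matrix.mul_assoc, h,
      Matrix.one_mul]

theorem arithCost_inv_mulVec_le (A : Θ → NonsingularHSSMatrix K t ρ m n r)
    (u : Θ → BlockIdx m → K) (hr : ∀ v, r v ≤ ρ) (ht : t.numLeaves = k) :
    (Nonempty Θ → (t.blockTree ht).Feasible ρ m n) ∧
    arithCost (fun θ => (A θ).toHSSMatrix.input (u θ)) (fun θ => (A θ).Minv *ᵥ u θ) ≤
      ((elimCost ρ m n (t.blockTree ht) + solveCost ρ m n (t.blockTree ht) : ℕ) : ℕ∞) := by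
  obtain ⟨I, J, _, _, e, f, hf, h⟩ := reach_solve A u hr ht
  refine ⟨hf, Reach.arithCost_le (h.bind ?_)⟩
  rintro st hst ⟨L, hL, -, hLM⟩
  have hu : st.KnownVec fun θ => Sum.elim (u θ ∘ e) (fun _ : Fin ρ => (0 : K)) :=
    (((knownVec_inputState (fun θ => (A θ).toHSSMatrix) u).mono hst).comp e).sumElim
      fun _ => known_const _ 0
  refine (hL st (leRefl _) _ hu).imp fun st' hst' h' =>
    KnownVec.of_comp_equiv f (h'.congr fun θ hθ => ?_)
  have h1 : L θ *ᵥ Sum.elim (u θ ∘ e) (fun _ : Fin ρ => (0 : K)) =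
      (L θ).submatrix id Sum.inl *ᵥ (u θ ∘ e) := by
    funext j
    simp [Matrix.mulVec, dotProduct]
  rw [h1, hLM θ (hst'.1 hθ), Matrix.submatrix_mulVec_equiv, Function.comp_assoc,
    e.self_comp_symm, Function.comp_id]

/-- The elimination is the same as for `M`; only the substitution is transposed, and the components
at `I` are kept. -/
theorem arithCost_inv_transpose_mulVec_le (A : Θ → NonsingularHSSMatrix K t ρ m n r)
    (u : Θ → BlockIdx n → K) (hr : ∀ v, r v ≤ ρ) (ht : t.numLeaves = k) :
    (Nonempty Θ → (t.blockTree ht).Feasible ρ m n) ∧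
    arithCost (fun θ => (A θ).toHSSMatrix.input (u θ)) (fun θ => (A θ).Minvᵀ *ᵥ u θ) ≤
      ((elimCost ρ m n (t.blockTree ht) + solveCost ρ m n (t.blockTree ht) : ℕ) : ℕ∞) := by
  obtain ⟨I, J, _, _, e, f, hf, h⟩ := reach_solve A u hr ht
  refine ⟨hf, Reach.arithCost_le (h.bind ?_)⟩
  rintro st hst ⟨L, -, hL, hLM⟩
  have hu : st.KnownVec fun θ => u θ ∘ f :=
    ((knownVec_inputState (fun θ => (A θ).toHSSMatrix) u).mono hst).comp f
  refine (hL st (leRefl _) _ hu).imp fun st' hst' h' =>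
    KnownVec.of_comp_equiv e ((h'.comp Sum.inl).congr fun θ hθ => ?_)
  have h1 : ((L θ)ᵀ *ᵥ (u θ ∘ f)) ∘ Sum.inl = ((L θ).submatrix id Sum.inl)ᵀ *ᵥ (u θ ∘ f) := rfl
  rw [h1, hLM θ (hst'.1 hθ), Matrix.transpose_submatrix, Matrix.submatrix_mulVec_equiv,
    Function.comp_assoc, f.self_comp_symm, Function.comp_id]

/-- Covers formats without nonsingular matrices, where `Feasible` cannot be deduced. -/
theorem arithCost_eq_zero [IsEmpty Θ] {ι ω : Type*} (input : Θ → ι → K) (answer : Θ → ω → K) :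
    arithCost input answer = 0 := by
  have h : arithCost input answer ≤ ((0 : ℕ) : ℕ∞) := Reach.arithCost_le <| .done fun _ =>
    (known_const _ (0 : K)).congr fun θ _ => isEmptyElim θ
  exact le_antisymm h (zero_le)

theorem mulVecCost_lt_alphaBound (hb : t.IsBalanced) (ht : t.numLeaves = k)
    (hm : ∀ q, 0 < m q) (hn : ∀ q, 0 < n q) :
    mulVecCost ρ m n (t.blockTree ht) < alphaBound ρ m n := by
  obtain ⟨h0, h⟩ := mulVecCost_le (ρ := ρ) hm hn (t.blockTree ht)
  have hl := (hb.height_blockTree_le ht).1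
  simp only [MergeTree.sum_blockTree] at h0 h
  have h1 := Nat.mul_le_mul_left (2 * ρ * (∑ q, m q + ∑ q, n q)) hl
  have h2 : (∑ q, m q + 4 * (∑ q, m q + ∑ q, n q) * ρ) * Nat.clog 2 k =
      (∑ q, m q) * Nat.clog 2 k + 2 * (2 * ρ * (∑ q, m q + ∑ q, n q) * Nat.clog 2 k) := by ring
  rw [alphaBound, h2]
  omega

/-- The cubes are bounded by `n₊² n`, and the additional `ρ² n` comes from the last term of
`betaBound`. -/
theorem sum_cube_add_le_betaBound :
    ∑ q, n q ^ 3 + (Nat.clog 2 k + 1) * ρ ^ 2 * ∑ q, n q + k * ρ ^ 3 ≤ betaBound ρ m n := by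
  have h : ∑ q, n q ^ 3 ≤ (Finset.univ.sup n) ^ 2 * ∑ q, n q := by
    rw [Finset.mul_sum]
    refine Finset.sum_le_sum fun q hq => ?_
    rw [pow_succ]
    exact Nat.mul_le_mul_right _ (Nat.pow_le_pow_left (Finset.le_sup (f := n) hq) 2)
  simp only [betaBound]
  calc _ ≤ (Finset.univ.sup n) ^ 2 * ∑ q, n q +
        (Nat.clog 2 k + 1) * ρ ^ 2 * ∑ q, n q + k * ρ ^ 3 := by omega
    _ ≤ _ := by
      generalize Finset.univ.sup n = a
      generalize ∑ q, n q = b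
      generalize ∑ q, m q * n q = s
      generalize Nat.clog 2 k = l
      have h1 : 0 ≤ a * s := Nat.zero_le _
      have h2 : 0 ≤ ρ * a * b := Nat.zero_le _
      nlinarith

/-- The second bound replaces column sizes by row sizes at the leaves; `sum_cube_le` raises the
constant by the factor `5 = 4 + 1`. -/
theorem cost_le_betaBound (hb : t.IsBalanced) (ht : t.numLeaves = k)
    (h : (t.blockTree ht).Feasible ρ m n) (hmn : ∑ q, m q = ∑ q, n q) :
    elimCost ρ m n (t.blockTree ht) + solveCost ρ m n (t.blockTree ht) ≤
      50000000 * betaBound ρ m n ∧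
    elimCost ρ m n (t.blockTree ht) + solveCost ρ m n (t.blockTree ht) ≤
      50000000 * betaBound ρ n m := by
  obtain ⟨hl, hk⟩ := hb.height_blockTree_le ht
  have h1 := h.cost_le_of_sum_eq (by simpa only [MergeTree.sum_blockTree] using hmn) hl
    (by rwa [MergeTree.leaves_blockTree])
  have h2 := h.sum_cube_le
  simp only [MergeTree.leaves_blockTree, MergeTree.sum_blockTree] at h1 h2
  have h3 := sum_cube_add_le_betaBound (k := k) (ρ := ρ) (m := m) (n := n)
  have h4 := sum_cube_add_le_betaBound (k := k) (ρ := ρ) (m := n) (n := m)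
  rw [hmn] at h4
  constructor <;> omega

end Main

theorem mainTheorem5 : ∃ C : ℕ, ∀ (K : Type*) [Field K] (k ρ : ℕ) (t : MergeTree)
    (_ : t.numLeaves = k) (_ : t.IsBalanced) (m n : Fin k → ℕ)
    (_ : ∀ q, 0 < m q) (_ : ∀ q, 0 < n q) (r : t.Vertex → ℕ) (_ : ∀ v, r v ≤ ρ),
    alphaCost K t ρ m n r < (alphaBound ρ m n : ℕ∞) ∧
    (∑ q, m q = ∑ q, n q → betaCost K t ρ m n r ≤ ((C * betaBound ρ m n : ℕ) : ℕ∞)) ∧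
    alphaTransposeCost K t ρ n m r < (alphaBound ρ m n : ℕ∞) ∧
    (∑ q, m q = ∑ q, n q →
      betaTransposeCost K t ρ n m r ≤ ((C * betaBound ρ m n : ℕ) : ℕ∞)) := by
  refine ⟨50000000, fun K _ k ρ t ht hb m n hm hn r hr => ⟨?_, fun hmn => ?_, ?_, fun hmn => ?_⟩⟩
  · exact (arithCost_mulVec_le _ _ hr ht).trans_lt
      (by exact_mod_cast mulVecCost_lt_alphaBound hb ht hm hn)
  · rcases isEmpty_or_nonempty (NonsingularHSSMatrix K t ρ m n r × (BlockIdx m → K)) with h0 | h0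
    · exact (arithCost_eq_zero _ _).trans_le (zero_le)
    · obtain ⟨h, h'⟩ := arithCost_inv_mulVec_le
        (fun θ : NonsingularHSSMatrix K t ρ m n r × (BlockIdx m → K) => θ.1) (·.2) hr ht
      exact h'.trans (by exact_mod_cast (cost_le_betaBound hb ht (h h0) hmn).1)
  · exact (arithCost_transpose_mulVec_le _ _ hr ht).trans_lt
      (by exact_mod_cast mulVecCost_lt_alphaBound hb ht hm hn)
  · rcases isEmpty_or_nonempty (NonsingularHSSMatrix K t ρ n m r × (BlockIdx m → K)) with h0 | h0
    · exact (arithCost_eq_zero _ _).trans_le (zero_le)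
    · obtain ⟨h, h'⟩ := arithCost_inv_transpose_mulVec_le
        (fun θ : NonsingularHSSMatrix K t ρ n m r × (BlockIdx m → K) => θ.1) (·.2) hr ht
      -- Here `M` has row sizes `n`, so the bound is the one in terms of the row sizes of `M`.
      exact h'.trans (by exact_mod_cast (cost_le_betaBound hb ht (h h0) hmn.symm).2)
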